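/- **Conventions.** Complexified Minkowski space $\mathbb M\cong\mathbb C^4$ has spinor coordinates $x^{\alpha\dot\alpha}$, $\alpha,\dot\alpha\in\{0,1\}$, and $\partial_{\alpha\dot\alpha}=\partial/\partial x^{\alpha\dot\alpha}$. Let $\varepsilon^{01}=\varepsilon_{01}=1$, $a^\alpha=\varepsilon^{\alpha\beta}a_\beta$ (and $a_\beta=a^\alpha\varepsilon_{\alpha\beta}$), $\langle ab\rangle=a^\alpha b_\alpha$, $\mathrm D\lambda=\langle\lambda\,\mathrm d\lambda\rangle$, $\mathrm D\bar\lambda=[\bar\lambda\,\mathrm d\bar\lambda]$. For $x\in\mathbb M$ the twistor line $X\cong\mathbb{CP}^1$ is $\mu^{\dot\alpha}=x^{\alpha\dot\alpha}\lambda_\alpha$. Write $\partial_{\dot\alpha}=\partial/\partial\mu^{\dot\alpha}$. In all integrals over $X$ the $(1,1)$-form is $\mathrm D\lambda\wedge(\cdot)$ and $X$ has its complex orientation; in integrals over $X^2$ the pairs $\mathrm D\lambda_1\wedge\mathsf a_1$ and $\mathrm D\lambda_2\wedge\mathsf a_2$ are kept together. **Pure Yang–Mills.** Let $\mathfrak g=\mathfrak{gl}(r,\mathbb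 C)$, and let $A_+(u,\lambda,\bar\lambda)$ be a $\mathfrak g$-valued function of $u\in\mathbb C$, $\lambda\in\mathbb C^2\setminus 0$, smooth, holomorphic in $u$, with $A_+(|b|^2u,b\lambda,\bar b\bar\lambda)=\bar b^{-2}A_+(u,\lambda,\bar\lambda)$ for $b\in\mathbb C^*$. Let $\mathsf a=A_+(\mu^{\dot\alpha}\bar\lambda_{\dot\alpha},\lambda,\bar\lambda)\,\mathrm D\bar\lambda$. Let $U\subseteq\mathbb M$ be open and let $H(x,\lambda)\in \mathrm{GL}(r,\mathbb C)$ ($x\in U$) be a frame: smooth, holomorphic in $x$, of weight $0$ in $\lambda$, with $(\bar\partial+\mathsf a)|_XH=0$. A potential of $H$ is a $\mathfrak g$-valued $A_{\alpha\dot\alpha}(x)$ with $H^{-1}\lambda^\alpha\partial_{\alpha\dot\alpha}H=-\mathrm i\lambda^\alpha A_{\alpha\dot\alpha}$ for all $\lambda$; let $\nabla_{\alpha\dot\alpha}=\partial_{\alpha\dot\alpha}-\mathrm iA_{\alpha\dot\alpha}$ and $F_{\alpha\dot\alpha\beta\dot\beta}=[\nabla_{\alpha\dot\alpha},\nabla_{\beta\dot\beta}]$.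 Then a potential exists on $U$, it is unique and holomorphic, and: 1. If $H(x,\iota)=1$ on $U$ for a fixed spinor $\iota\neq0$, it is given by the absolutely convergent integral $$A_{\alpha\dot\alpha}(x)=\frac{\iota_\alpha}{2\pi}\int_X\frac{\mathrm D\lambda}{\langle\iota\lambda\rangle}H^{-1}\,\partial_{\dot\alpha}\mathsf a|_X\,H .$$ 2. For every frame $H$ (no normalisation), $F_{\alpha\dot\alpha\beta\dot\beta}=\varepsilon_{\alpha\beta}\tilde F_{\dot\alpha\dot\beta}$ with $\tilde F_{\dot\alpha\dot\beta}=\tilde F_{\dot\beta\dot\alpha}$ (self-duality), where, with absolutely convergent integrals, $$\tilde F_{\dot\alpha\dot\beta}=\int_X\frac{\mathrm D\lambda_1}{2\pi\mathrm i}H_1^{-1}\partial_{\dot\alpha}\partial_{\dot\beta}\mathsf a_1H_1-\int_{X^2}\frac{\mathrm D\lambda_1\mathrm D\lambda_2}{(2\pi\mathrm i)^2\langle\lambda_1\lambda_2\rangle}\,[H_1^{-1}\partial_{\dot\alpha}\mathsf a_1H_1,\;H_2^{-1}\partial_{\dot\beta}\mathsf a_2H_2].$$ **$\mathcal N=4$.**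 Let $x^{\alpha\dot\alpha}$, $\theta^{\alpha a}$ ($a=1,\dots,4$) be the coordinates of chiral superspace, $\mu^A=(\mu^{\dot\alpha},\chi^a)$, $A=(\dot\alpha,a)$, $\partial_A=\partial/\partial\mu^A$, $\partial_{\alpha A}=(\partial_{\alpha\dot\alpha},\partial/\partial\theta^{\alpha a})$ (left derivatives); coefficients of superfields may involve any finite number of further anticommuting constants. Let $\underline{\mathcal A}(u,\lambda,\bar\lambda,\chi)$ be an even $r\times r$ matrix of polynomials in $\chi$ with coefficients smooth in $(u,\lambda)$ and holomorphic in $u\in\mathbb C$, such that $\underline{\mathcal A}(|b|^2u,b\lambda,\bar b\bar\lambda,b\chi)=\bar b^{-2}\underline{\mathcal A}(u,\lambda,\bar\lambda,\chi)$, and let $\underline{\mathsf a}=\underline{\mathcal A}(\mu^{\dot\alpha}\bar\lambda_{\dot\alpha},\lambda,\bar\lambda,\chi)\mathrm D\bar\lambda$. The derivatives $\partial_A$ act on the coefficient of $\mathrm D\bar\lambda$. Restriction to $X$ is $\mu^{\dot\alpha}=x^{\alpha\dot\alpha}\lambda_\alpha$, $\chi^a=\theta^{\alpha a}\lambda_\alpha$.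 Let $\underline H(x,\theta,\lambda)$ ($x\in U$) be an even invertible frame, smooth, holomorphic in $x$, of weight $0$ in $\lambda$, with $(\bar\partial+\underline{\mathsf a})|_X\underline H=0$. Then there is a unique super-connection $\underline A_{\alpha A}(x,\theta)$ on $U$ with $\underline H^{-1}\lambda^\alpha\partial_{\alpha A}\underline H=-\mathrm i\lambda^\alpha\underline A_{\alpha A}$ for all $\lambda$, it is holomorphic in $x$, and with $\underline\nabla_{\alpha A}=\partial_{\alpha A}-\mathrm i\underline A_{\alpha A}$ and absolutely convergent integrals: 3. If $\underline H(x,\theta,\iota)=1$ on $U$ for a fixed $\iota\ne0$, then $\displaystyle\underline A_{\alpha A}=\frac{\iota_\alpha}{2\pi}\int_X\frac{\mathrm D\lambda}{\langle\iota\lambda\rangle}\underline H^{-1}\,\partial_A\underline{\mathsf a}|_X\,\underline H$. 4. For every frame $\underline H$, $[\underline\nabla_{\alpha\dot\alpha},\underline\nabla_{\beta\dot\beta}]=\varepsilon_{\alpha\beta}\underline{\tilde F}_{\dot\alpha\dot\beta}$, $[\underline\nabla_{\alpha a},\underline\nabla_{\beta\dot\alpha}]=\varepsilon_{\alpha\beta}\underline{\tilde\psi}_{a\dot\alpha}$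 and $\{\underline\nabla_{\alpha a},\underline\nabla_{\beta b}\}=\varepsilon_{\alpha\beta}\underline\phi_{ab}$, where $\underline{\tilde F}_{\dot\alpha\dot\beta}$ is given by the formula of part 2 with $(\underline H,\underline{\mathsf a})$ in place of $(H,\mathsf a)$, and $$\underline{\tilde\psi}_{a\dot\alpha}=\int_X\frac{\mathrm D\lambda_1}{2\pi\mathrm i}\underline H_1^{-1}\partial_a\partial_{\dot\alpha}\underline{\mathsf a}_1\underline H_1-\int_{X^2}\frac{\mathrm D\lambda_1\mathrm D\lambda_2}{(2\pi\mathrm i)^2\langle\lambda_1\lambda_2\rangle}[\underline H_1^{-1}\partial_a\underline{\mathsf a}_1\underline H_1,\underline H_2^{-1}\partial_{\dot\alpha}\underline{\mathsf a}_2\underline H_2],$$ $$\underline\phi_{ab}=\int_X\frac{\mathrm D\lambda_1}{2\pi\mathrm i}\underline H_1^{-1}\partial_a\partial_b\underline{\mathsf a}_1\underline H_1-\int_{X^2}\frac{\mathrm D\lambda_1\mathrm D\lambda_2}{(2\pi\mathrm i)^2\langle\lambda_1\lambda_2\rangle}\{\underline H_1^{-1}\partial_a\underline{\mathsf a}_1\underline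 H_1,\underline H_2^{-1}\partial_b\underline{\mathsf a}_2\underline H_2\}.$$ -/

import Mathlib

open scoped ContDiff ComplexConjugate

attribute [local instance] Matrix.normedAddCommGroup Matrix.normedSpace

namespace SDYM

noncomputable section

/-! ### Two-component spinors -/

/-- Two-component spinors, given by their components with lower index: `lam α` is `λ_α`.
The same type is used for `μ` with its upper dotted index. -/
abbrev Spinor := Fin 2 → ℂ

/-- Complexified Minkowski space in spinor coordinates: `x α α'` is `x^{αα̇}`. -/
abbrev Spacetime := Fin 2 → Fin 2 → ℂ

/-- The Levi-Civita symbol, `ε^{01} = ε_{01} = 1`. Indices are raised by `a^α = ε^{αβ} a_β` and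
lowered by `a_β = a^α ε_{αβ}`. -/
def eps : Matrix (Fin 2) (Fin 2) ℂ := !![0, 1; -1, 0]

/-- Raising of an index, `a^α = ε^{αβ} a_β`. -/
def up (a : Spinor) : Spinor := fun α => ∑ β, eps α β * a β

/-- The bracket `⟨a b⟩ = a^α b_α`. -/
def angle (a b : Spinor) : ℂ := ∑ α, up a α * b α

/-- The conjugate spinor `λ̄`. -/
def bar (lam : Spinor) : Spinor := fun α => conj (lam α)

/-- The incidence relation `μ^{α̇} = x^{αα̇} λ_α`. -/
def incidence (x : Spacetime) (lam : Spinor) : Spinor := fun α' => ∑ α, x α α' * lam α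

/-! ### Differential operators -/

/-- Smoothness in the real sense of a function with values in a complex vector space. -/
def SmoothOn {D E : Type*} [NormedAddCommGroup D] [NormedSpace ℝ D] [NormedAddCommGroup E]
    [NormedSpace ℂ E] (f : D → E) (s : Set D) : Prop :=
  ContDiffOn ℝ ∞ f s

/-- `∂_{αα̇} = ∂/∂x^{αα̇}` (holomorphic derivative on complexified Minkowski space). -/
def dX {E : Type*} [NormedAddCommGroup E] [NormedSpace ℂ E] (α α' : Fin 2)
    (f : Spacetime → E) (x : Spacetime) : E :=
  fderiv ℂ f x (Pi.single α (Pi.single α' 1))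

/-- `∂_{α̇} = ∂/∂μ^{α̇}` acting on a function of `(μ, λ)`. -/
def dMu {E : Type*} [NormedAddCommGroup E] [NormedSpace ℂ E] (α' : Fin 2)
    (f : Spinor → Spinor → E) : Spinor → Spinor → E :=
  fun μ lam => fderiv ℂ (fun ν => f ν lam) μ (Pi.single α' 1)

/-- The Wirtinger derivative `∂/∂λ̄_{α̇} = ½ (∂/∂Re λ_α + i ∂/∂Im λ_α)`. -/
def dBar {E : Type*} [NormedAddCommGroup E] [NormedSpace ℂ E] (α' : Fin 2)
    (f : Spinor → E) (lam : Spinor) : E :=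
  (1 / 2 : ℂ) • (fderiv ℝ f lam (Pi.single α' 1)
    + Complex.I • fderiv ℝ f lam (Pi.single α' Complex.I))

/-! ### Integration over a twistor line

A function `f` of `λ ≠ 0` with `f (b λ) = b⁻² b̄⁻² f λ` defines the `(1,1)`-form
`Dλ ∧ Dλ̄ f(λ)` on `ℂℙ¹`, where `Dλ = ⟨λ dλ⟩` and `Dλ̄ = [λ̄ dλ̄]`. On the chart
`λ = (1, z)`, which misses a single point, `Dλ ∧ Dλ̄ = dz ∧ dz̄ = -2i dRe z dIm z`. -/

/-- The point `λ = (1, z)` of the affine chart. -/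
def chart (z : ℂ) : Spinor := ![1, z]

/-- Absolute convergence of `∫_X Dλ ∧ Dλ̄ f(λ)`. -/
def LineIntegrable {E : Type*} [NormedAddCommGroup E] [NormedSpace ℂ E]
    (f : Spinor → E) : Prop :=
  MeasureTheory.Integrable (fun z : ℂ => f (chart z))

/-- `∫_X Dλ ∧ Dλ̄ f(λ)`. -/
def lineIntegral {E : Type*} [NormedAddCommGroup E] [NormedSpace ℂ E]
    (f : Spinor → E) : E :=
  (-2 * Complex.I) • ∫ z : ℂ, f (chart z)

/-- Absolute convergence of `∫_{X²} (Dλ₁ ∧ Dλ̄₁) (Dλ₂ ∧ Dλ̄₂) f(λ₁, λ₂)`. -/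
def LineIntegrable₂ {E : Type*} [NormedAddCommGroup E] [NormedSpace ℂ E]
    (f : Spinor → Spinor → E) : Prop :=
  MeasureTheory.Integrable (fun p : ℂ × ℂ => f (chart p.1) (chart p.2))

/-- `∫_{X²} (Dλ₁ ∧ Dλ̄₁) (Dλ₂ ∧ Dλ̄₂) f(λ₁, λ₂)`. -/
def lineIntegral₂ {E : Type*} [NormedAddCommGroup E] [NormedSpace ℂ E]
    (f : Spinor → Spinor → E) : E :=
  ((-2 * Complex.I) ^ 2) • ∫ p : ℂ × ℂ, f (chart p.1) (chart p.2)

/-! ### Pure Yang-Mills theory -/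

/-- Complex `r × r` matrices, the Lie algebra `𝔤` of the gauge group `GL(r, ℂ)`. -/
abbrev Gl (r : ℕ) := Matrix (Fin r) (Fin r) ℂ

/-- Self-dual radiative data at complexified null infinity: the smooth function
`A₊(u, λ, λ̄)`, holomorphic in `u`, for which `A₊ Dλ̄` has weight zero. -/
structure RadiativeData (r : ℕ) where
  val : ℂ → Spinor → Gl r
  smooth : SmoothOn (fun p : ℂ × Spinor => val p.1 p.2) {p | p.2 ≠ 0}
  holomorphic : ∀ lam : Spinor, lam ≠ 0 → Differentiable ℂ (fun u => val u lam)
  homogeneous : ∀ (b u : ℂ) (lam : Spinor), b ≠ 0 → lam ≠ 0 →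
    val (b * conj b * u) (b • lam) = ((conj b) ^ 2)⁻¹ • val u lam

/-- The twistor connection `𝖺 = p^*(A₊ Dλ̄) = A₊(μ^{α̇} λ̄_{α̇}, λ, λ̄) Dλ̄`, given by its
coefficient of `Dλ̄`. -/
def RadiativeData.twistor {r : ℕ} (𝒜 : RadiativeData r) (μ lam : Spinor) : Gl r :=
  𝒜.val (∑ α', μ α' * bar lam α') lam

/-- A holomorphic frame `H(x, λ)` of the bundle `E|_X`, for the lines `X` of the points `x ∈ U`:
a smooth function of weight zero in `λ`, holomorphic in `x`, with invertible values, which solves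
the Sparling equation `(∂̄ + 𝖺)|_X H = 0`. As `∂̄ = dλ̄_{α̇} ∂/∂λ̄_{α̇}` and
`Dλ̄ = λ̄^{α̇} dλ̄_{α̇}`, this is the equation `∂H/∂λ̄_{α̇} + λ̄^{α̇} 𝖺 H = 0`. -/
structure IsHolomorphicFrame {r : ℕ} (U : Set Spacetime) (𝒜 : RadiativeData r)
    (H : Spacetime → Spinor → Gl r) : Prop where
  smooth : SmoothOn (fun p : Spacetime × Spinor => H p.1 p.2) {p | p.1 ∈ U ∧ p.2 ≠ 0}
  holomorphic : ∀ lam : Spinor, lam ≠ 0 → DifferentiableOn ℂ (fun x => H x lam) U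
  homogeneous : ∀ x ∈ U, ∀ (b : ℂ) (lam : Spinor), b ≠ 0 → lam ≠ 0 → H x (b • lam) = H x lam
  invertible : ∀ x ∈ U, ∀ lam : Spinor, lam ≠ 0 → IsUnit (H x lam)
  sparling : ∀ x ∈ U, ∀ lam : Spinor, lam ≠ 0 → ∀ α' : Fin 2,
    dBar α' (H x) lam + up (bar lam) α' • (𝒜.twistor (incidence x lam) lam * H x lam) = 0

/-- The gauge potential of a frame: `H⁻¹ λ^α ∂_{αα̇} H = -i λ^α A_{αα̇}(x)`. -/
def IsPotential {r : ℕ} (U : Set Spacetime) (H : Spacetime → Spinor → Gl r)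
    (A : Spacetime → Fin 2 → Fin 2 → Gl r) : Prop :=
  ∀ x ∈ U, ∀ lam : Spinor, lam ≠ 0 → ∀ α' : Fin 2,
    (H x lam)⁻¹ * ∑ α, up lam α • dX α α' (fun y => H y lam) x
      = -Complex.I • ∑ α, up lam α • A x α α'

/-- The field strength `F_{αα̇ββ̇} = [∇_{αα̇}, ∇_{ββ̇}]` of `∇_{αα̇} = ∂_{αα̇} - i A_{αα̇}`. -/
def curvature {r : ℕ} (A : Spacetime → Fin 2 → Fin 2 → Gl r) (x : Spacetime)
    (α α' β β' : Fin 2) : Gl r :=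
  -Complex.I • (dX α α' (fun y => A y β β') x - dX β β' (fun y => A y α α') x)
    - (A x α α' * A x β β' - A x β β' * A x α α')

/-- `H⁻¹ f|_X H` for a matrix-valued function `f` on twistor space. -/
def dressed {r : ℕ} (H : Spacetime → Spinor → Gl r) (f : Spinor → Spinor → Gl r)
    (x : Spacetime) (lam : Spinor) : Gl r :=
  (H x lam)⁻¹ * f (incidence x lam) lam * H x lam

/-- The integrand of the gauge potential, `⟨ι λ⟩⁻¹ H⁻¹ ∂_{α̇}𝖺 H`. -/
def potentialIntegrand {r : ℕ} (𝒜 : RadiativeData r) (H : Spacetime → Spinor → Gl r)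
    (iota : Spinor) (x : Spacetime) (α' : Fin 2) (lam : Spinor) : Gl r :=
  (angle iota lam)⁻¹ • dressed H (dMu α' 𝒜.twistor) x lam

/-- The integrand `H⁻¹ ∂_{α̇}∂_{β̇}𝖺 H` of the single integral in the SD field strength. -/
def singleIntegrand {r : ℕ} (𝒜 : RadiativeData r) (H : Spacetime → Spinor → Gl r)
    (x : Spacetime) (α' β' : Fin 2) (lam : Spinor) : Gl r :=
  dressed H (dMu α' (dMu β' 𝒜.twistor)) x lam

/-- The integrand `⟨λ₁ λ₂⟩⁻¹ [H₁⁻¹ ∂_{α̇}𝖺₁ H₁, H₂⁻¹ ∂_{β̇}𝖺₂ H₂]` of the double integral in the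
SD field strength. -/
def doubleIntegrand {r : ℕ} (𝒜 : RadiativeData r) (H : Spacetime → Spinor → Gl r)
    (x : Spacetime) (α' β' : Fin 2) (lam₁ lam₂ : Spinor) : Gl r :=
  (angle lam₁ lam₂)⁻¹ •
    (dressed H (dMu α' 𝒜.twistor) x lam₁ * dressed H (dMu β' 𝒜.twistor) x lam₂
      - dressed H (dMu β' 𝒜.twistor) x lam₂ * dressed H (dMu α' 𝒜.twistor) x lam₁)

/-- The integral formula for the SD field strength `F̃_{α̇β̇}(x)`. -/
def fieldStrength {r : ℕ} (𝒜 : RadiativeData r) (H : Spacetime → Spinor → Gl r)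
    (x : Spacetime) (α' β' : Fin 2) : Gl r :=
  (2 * Real.pi * Complex.I)⁻¹ • lineIntegral (singleIntegrand 𝒜 H x α' β')
    - ((2 * Real.pi * Complex.I) ^ 2)⁻¹ • lineIntegral₂ (doubleIntegrand 𝒜 H x α' β')

/-! ### Grassmann algebras -/

/-- The complex Grassmann algebra with anticommuting generators indexed by `κ`. -/
abbrev Grassmann (κ : Type) := ExteriorAlgebra ℂ (κ → ℂ)

/-- The basis of the Grassmann algebra by the monomials in the generators. -/
def Grassmann.basis (κ : Type) [Fintype κ] :
    Module.Basis (Finset (Fin (Fintype.card κ))) ℂ (Grassmann κ) := by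
  classical
  exact ((Pi.basisFun ℂ κ).reindex (Fintype.equivFin κ)).ExteriorAlgebra

/-- The norm is the largest modulus of a coefficient; only the topology, which is the unique
Hausdorff vector space topology in finite dimension, is of importance. -/
instance Grassmann.normedAddCommGroup (κ : Type) [Fintype κ] :
    NormedAddCommGroup (Grassmann κ) :=
  NormedAddCommGroup.induced (Grassmann κ) (Finset (Fin (Fintype.card κ)) → ℂ)
    (Grassmann.basis κ).equivFun (Grassmann.basis κ).equivFun.injective

instance Grassmann.normedSpace (κ : Type) [Fintype κ] : NormedSpace ℂ (Grassmann κ) :=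
  NormedSpace.induced ℂ (Grassmann κ) (Finset (Fin (Fintype.card κ)) → ℂ)
    (Grassmann.basis κ).equivFun

/-- The generator with index `k`. -/
def gen {κ : Type} [DecidableEq κ] (k : κ) : Grassmann κ :=
  ExteriorAlgebra.ι ℂ (Pi.single k (1 : ℂ))

/-- The (left) derivative with respect to the generator with index `k`. -/
def oddDeriv {κ : Type} (k : κ) : Grassmann κ →ₗ[ℂ] Grassmann κ :=
  CliffordAlgebra.contractLeft (LinearMap.proj k)

theorem oddDeriv_gen_mul {κ : Type} [DecidableEq κ] (j k : κ) (m : Grassmann κ) :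
    oddDeriv k (gen j * m) = (if k = j then m else 0) - gen j * oddDeriv k m := by
  unfold oddDeriv gen ExteriorAlgebra.ι
  rw [CliffordAlgebra.contractLeft_ι_mul]
  by_cases h : k = j
  · subst h; simp
  · simp [h]

/-- Even elements of the Grassmann algebra. -/
def IsEven {κ : Type} (m : Grassmann κ) : Prop :=
  m ∈ CliffordAlgebra.evenOdd (0 : QuadraticForm ℂ (κ → ℂ)) 0

/-! ### `𝒩 = 4` super-Yang-Mills theory

The coefficients of superfields are taken in the Grassmann algebra on `N` anticommuting constants,
which allows fermionic component fields to be different from zero; `N` is arbitrary. -/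

/-- The odd generators of super-twistor space: `χ^a`, and the `N` anticommuting constants. -/
abbrev ChiGen (N : ℕ) := Fin 4 ⊕ Fin N

/-- The odd generators of chiral superspace: `θ^{αa}`, and the `N` anticommuting constants. -/
abbrev ThetaGen (N : ℕ) := (Fin 2 × Fin 4) ⊕ Fin N

/-- `r × r` matrices over a Grassmann algebra. -/
abbrev SGl (r : ℕ) (κ : Type) := Matrix (Fin r) (Fin r) (Grassmann κ)

/-- The `2|4` index `A = (α̇, a)`. -/
abbrev SIndex := Fin 2 ⊕ Fin 4

/-- `(-1)^{|A||B|}`. -/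
def sgn : SIndex → SIndex → ℂ
  | Sum.inr _, Sum.inr _ => -1
  | _, _ => 1

/-- The graded commutator `[P, Q} = P Q - (-1)^{|A||B|} Q P` of objects with indices `A`, `B`:
an anticommutator if both indices are odd, else a commutator. -/
def gcomm {r : ℕ} {κ : Type} (A B : SIndex) (P Q : SGl r κ) : SGl r κ :=
  P * Q - sgn A B • (Q * P)

/-- The substitution `χ^a ↦ b χ^a`. -/
def scaleChi (N : ℕ) (b : ℂ) : Grassmann (ChiGen N) →ₐ[ℂ] Grassmann (ChiGen N) :=
  ExteriorAlgebra.map (LinearMap.pi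
    (Sum.elim (fun a => b • LinearMap.proj (Sum.inl a)) (fun k => LinearMap.proj (Sum.inr k))))

/-- The substitution `χ^a ↦ θ^{αa} λ_α`. -/
def chiToTheta (N : ℕ) (lam : Spinor) : Grassmann (ChiGen N) →ₐ[ℂ] Grassmann (ThetaGen N) :=
  ExteriorAlgebra.map (LinearMap.pi
    (Sum.elim (fun p => lam p.1 • LinearMap.proj (Sum.inl p.2))
      (fun k => LinearMap.proj (Sum.inr k))))

theorem scaleChi_gen (N : ℕ) (b : ℂ) (a : Fin 4) :
    scaleChi N b (gen (Sum.inl a)) = b • gen (Sum.inl a) := by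
  unfold scaleChi gen
  rw [ExteriorAlgebra.map_apply_ι, ← map_smul]
  congr 1
  ext k
  rcases k with k | k <;> simp [Pi.single_apply]

theorem chiToTheta_gen (N : ℕ) (lam : Spinor) (a : Fin 4) :
    chiToTheta N lam (gen (Sum.inl a)) = ∑ α, lam α • gen (Sum.inl (α, a)) := by
  unfold chiToTheta gen
  simp_rw [ExteriorAlgebra.map_apply_ι, ← map_smul, ← map_sum]
  congr 1
  ext k
  rcases k with ⟨β, c⟩ | k
  · fin_cases β <;> simp [Pi.single_apply, Fin.sum_univ_two]
  · simp

/-- The characteristic data of the `𝒩 = 4` multiplet at complexified null infinity: the even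
function `𝒜(u, λ, λ̄, χ)` whose coefficients are smooth and holomorphic in `u`, and for which
`𝒜 Dλ̄` has weight zero, `χ` having weight one. -/
structure SuperRadiativeData (r N : ℕ) where
  val : ℂ → Spinor → SGl r (ChiGen N)
  smooth : SmoothOn (fun p : ℂ × Spinor => val p.1 p.2) {p | p.2 ≠ 0}
  holomorphic : ∀ lam : Spinor, lam ≠ 0 → Differentiable ℂ (fun u => val u lam)
  even : ∀ (u : ℂ) (lam : Spinor), lam ≠ 0 → ∀ i j : Fin r, IsEven (val u lam i j)
  homogeneous : ∀ (b u : ℂ) (lam : Spinor), b ≠ 0 → lam ≠ 0 →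
    (val (b * conj b * u) (b • lam)).map (scaleChi N b) = ((conj b) ^ 2)⁻¹ • val u lam

/-- The super-twistor connection `𝖺(μ, λ, χ) = 𝒜(μ^{α̇} λ̄_{α̇}, λ, λ̄, χ) Dλ̄`, given by its
coefficient of `Dλ̄`. -/
def SuperRadiativeData.twistor {r N : ℕ} (𝒜 : SuperRadiativeData r N) (μ lam : Spinor) :
    SGl r (ChiGen N) :=
  𝒜.val (∑ α', μ α' * bar lam α') lam

/-- Restriction of a function on super-twistor space to the line `X` of `(x, θ)`:
`μ^{α̇} = x^{αα̇} λ_α`, `χ^a = θ^{αa} λ_α`. -/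
def onLine {r N : ℕ} (f : Spinor → Spinor → SGl r (ChiGen N)) (x : Spacetime) (lam : Spinor) :
    SGl r (ThetaGen N) :=
  (f (incidence x lam) lam).map (chiToTheta N lam)

/-- `∂_A = (∂/∂μ^{α̇}, ∂/∂χ^a)` on functions on super-twistor space. -/
def sdMu {r N : ℕ} (A : SIndex) (f : Spinor → Spinor → SGl r (ChiGen N)) :
    Spinor → Spinor → SGl r (ChiGen N) :=
  match A with
  | Sum.inl α' => dMu α' f
  | Sum.inr a => fun μ lam => (f μ lam).map (oddDeriv (Sum.inl a))

/-- `∂_{αA} = (∂/∂x^{αα̇}, ∂/∂θ^{αa})` on superfields. -/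
def sdX {r N : ℕ} (α : Fin 2) (A : SIndex) (f : Spacetime → SGl r (ThetaGen N))
    (x : Spacetime) : SGl r (ThetaGen N) :=
  match A with
  | Sum.inl α' => dX α α' f x
  | Sum.inr a => (f x).map (oddDeriv (Sum.inl (α, a)))

/-- A holomorphic frame `H(x, θ, λ)`, for `x ∈ U`: an even superfield, smooth of weight zero in
`λ`, holomorphic in `x`, invertible, with `(∂̄ + 𝖺)|_X H = 0`. -/
structure IsSuperFrame {r N : ℕ} (U : Set Spacetime) (𝒜 : SuperRadiativeData r N)
    (H : Spacetime → Spinor → SGl r (ThetaGen N)) : Prop where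
  smooth : SmoothOn (fun p : Spacetime × Spinor => H p.1 p.2) {p | p.1 ∈ U ∧ p.2 ≠ 0}
  holomorphic : ∀ lam : Spinor, lam ≠ 0 → DifferentiableOn ℂ (fun x => H x lam) U
  even : ∀ x ∈ U, ∀ lam : Spinor, lam ≠ 0 → ∀ i j : Fin r, IsEven (H x lam i j)
  homogeneous : ∀ x ∈ U, ∀ (b : ℂ) (lam : Spinor), b ≠ 0 → lam ≠ 0 → H x (b • lam) = H x lam
  invertible : ∀ x ∈ U, ∀ lam : Spinor, lam ≠ 0 → IsUnit (H x lam)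
  sparling : ∀ x ∈ U, ∀ lam : Spinor, lam ≠ 0 → ∀ α' : Fin 2,
    dBar α' (H x) lam + up (bar lam) α' • (onLine 𝒜.twistor x lam * H x lam) = 0

/-- The super-connection of a frame: `H⁻¹ λ^α ∂_{αA} H = -i λ^α A_{αA}(x, θ)`. -/
def IsSuperPotential {r N : ℕ} (U : Set Spacetime) (H : Spacetime → Spinor → SGl r (ThetaGen N))
    (A : Spacetime → Fin 2 → SIndex → SGl r (ThetaGen N)) : Prop :=
  ∀ x ∈ U, ∀ lam : Spinor, lam ≠ 0 → ∀ B : SIndex,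
    Ring.inverse (H x lam) * ∑ α, up lam α • sdX α B (fun y => H y lam) x
      = -Complex.I • ∑ α, up lam α • A x α B

/-- The super-curvature `[∇_{αA}, ∇_{βB}}` of `∇_{αA} = ∂_{αA} - i A_{αA}`. The component
`A_{αA}` has the parity of its index `A`. -/
def superCurvature {r N : ℕ} (A : Spacetime → Fin 2 → SIndex → SGl r (ThetaGen N))
    (x : Spacetime) (α : Fin 2) (B : SIndex) (β : Fin 2) (C : SIndex) : SGl r (ThetaGen N) :=
  -Complex.I • (sdX α B (fun y => A y β C) x - sgn B C • sdX β C (fun y => A y α B) x)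
    - gcomm B C (A x α B) (A x β C)

/-- `H⁻¹ f|_X H` for a function `f` on super-twistor space. -/
def sdressed {r N : ℕ} (H : Spacetime → Spinor → SGl r (ThetaGen N))
    (f : Spinor → Spinor → SGl r (ChiGen N)) (x : Spacetime) (lam : Spinor) :
    SGl r (ThetaGen N) :=
  Ring.inverse (H x lam) * onLine f x lam * H x lam

/-- `⟨ι λ⟩⁻¹ H⁻¹ ∂_A 𝖺 H`. -/
def superPotentialIntegrand {r N : ℕ} (𝒜 : SuperRadiativeData r N)
    (H : Spacetime → Spinor → SGl r (ThetaGen N)) (iota : Spinor) (x : Spacetime) (B : SIndex)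
    (lam : Spinor) : SGl r (ThetaGen N) :=
  (angle iota lam)⁻¹ • sdressed H (sdMu B 𝒜.twistor) x lam

/-- `H⁻¹ ∂_A ∂_B 𝖺 H`. -/
def superSingleIntegrand {r N : ℕ} (𝒜 : SuperRadiativeData r N)
    (H : Spacetime → Spinor → SGl r (ThetaGen N)) (x : Spacetime) (B C : SIndex)
    (lam : Spinor) : SGl r (ThetaGen N) :=
  sdressed H (sdMu B (sdMu C 𝒜.twistor)) x lam

/-- `⟨λ₁ λ₂⟩⁻¹ [H₁⁻¹ ∂_A 𝖺₁ H₁, H₂⁻¹ ∂_B 𝖺₂ H₂}`. -/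
def superDoubleIntegrand {r N : ℕ} (𝒜 : SuperRadiativeData r N)
    (H : Spacetime → Spinor → SGl r (ThetaGen N)) (x : Spacetime) (B C : SIndex)
    (lam₁ lam₂ : Spinor) : SGl r (ThetaGen N) :=
  (angle lam₁ lam₂)⁻¹ •
    gcomm B C (sdressed H (sdMu B 𝒜.twistor) x lam₁) (sdressed H (sdMu C 𝒜.twistor) x lam₂)

/-- The integral formula for the component `F_{AB}(x, θ)` of the super-curvature. For two dotted
indices it is the superfield `F̃_{α̇β̇}`. -/
def superFieldStrength {r N : ℕ} (𝒜 : SuperRadiativeData r N)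
    (H : Spacetime → Spinor → SGl r (ThetaGen N)) (x : Spacetime) (B C : SIndex) :
    SGl r (ThetaGen N) :=
  (2 * Real.pi * Complex.I)⁻¹ • lineIntegral (superSingleIntegrand 𝒜 H x B C)
    - ((2 * Real.pi * Complex.I) ^ 2)⁻¹ • lineIntegral₂ (superDoubleIntegrand 𝒜 H x B C)

/-- The integral formula for the superfield `ψ̃_{aα̇}(x, θ)`. -/
def psiTilde {r N : ℕ} (𝒜 : SuperRadiativeData r N)
    (H : Spacetime → Spinor → SGl r (ThetaGen N)) (x : Spacetime) (a : Fin 4) (α' : Fin 2) :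
    SGl r (ThetaGen N) :=
  superFieldStrength 𝒜 H x (Sum.inr a) (Sum.inl α')

/-- The integral formula for the superfield `φ_{ab}(x, θ)`. -/
def phi {r N : ℕ} (𝒜 : SuperRadiativeData r N)
    (H : Spacetime → Spinor → SGl r (ThetaGen N)) (x : Spacetime) (a b : Fin 4) :
    SGl r (ThetaGen N) :=
  superFieldStrength 𝒜 H x (Sum.inr a) (Sum.inr b)

end

end SDYM

open SDYM

set_option linter.unusedSectionVars false

/-! Everything rests on `logD`, the function Q_{αA} = H⁻¹ ∂_{αA} H, and on K_A = H⁻¹ ∂_A 𝖺 H.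
Differentiating the Sparling equation gives ∂̄ Q_{αA} = λ_α K_A (`dBar_logD`), because 𝖺 depends on
x and θ only through μ = xλ and χ = θλ. Q has weight zero, so it extends over the point at infinity,
and the Cauchy-Pompeiu formula on the sphere recovers Q(∞) - Q(z) from K (`integral_inv_sub_smul`).

Since λ^α λ_α = 0, the contraction λ^α Q_{αA} is holomorphic of weight one and hence linear in λ.
This gives existence and uniqueness of the potential. In the proof the linearity comes from
comparing the Cauchy-Pompeiu formulas for α = 0 and α = 1 (`logD_chart`). If H = 1 at ι, then Q(ι) =
0, and the formula with its pole at ι is the integral formula for the potential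
(`conn_eq_lineIntegral`).

For fixed λ the components Q are those of a flat connection (`gradedCurv_logD`). The potential
agrees with Q along λ^α, so λ^α λ^β F_{αβ} = 0 for every λ: the curvature is ε_{αβ} times a single
field. To find this field, W_1 is written as Q_1(∞) - π⁻¹ ∫ K. Flatness at ∞ leaves the covariant
derivative of ∫ K, which is evaluated under the integral sign. The derivative of K yields the single
integral and a commutator with Q_0(∞) - Q_0(λ₂); expressing this difference by Cauchy-Pompeiu yields
the double integral (`gradedCurv_zero_one`).

The argument is carried out once, for a frame with values in a finite-dimensional algebra with odd
derivations (`FrameData`). Pure Yang-Mills theory is the case without odd directions; the 𝒩 = 4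
theory is the case of matrices over a Grassmann algebra. -/

namespace SDYM

open MeasureTheory Filter Topology Set

/-! ### The Cauchy-Pompeiu formula for functions with a limit at infinity -/

section CauchyPompeiu

variable {E : Type*} [NormedAddCommGroup E] [NormedSpace ℂ E]

/-- The Wirtinger derivative `∂f/∂z̄` of a function of one complex variable. -/
noncomputable def dzbar (f : ℂ → E) (z : ℂ) : E :=
  (1 / 2 : ℂ) • (fderiv ℝ f z 1 + Complex.I • fderiv ℝ f z Complex.I)

/-- The combination T 1 + i T i kills the complex-linear part of T and doubles the antilinear part,
which scales by the conjugate of `e`, here written as |e|² e⁻¹. For |e| = 1 this is the polar form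
of ∂/∂z̄. -/
theorem clm_apply_unit (T : ℂ →L[ℝ] E) (e : ℂ) (he : e ≠ 0) :
    T e + Complex.I • T (Complex.I * e)
      = (Complex.normSq e * e⁻¹ : ℂ) • (T 1 + Complex.I • T Complex.I) := by
  have h1 : (Complex.normSq e * e⁻¹ : ℂ) = e.re - e.im * Complex.I := by
    rw [← Complex.mul_conj]
    field_simp
    apply Complex.ext <;> simp
  have h2 : T e = (e.re : ℂ) • T 1 + (e.im : ℂ) • T Complex.I := by
    have : e = e.re • (1 : ℂ) + e.im • Complex.I := by apply Complex.ext <;> simp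
    conv_lhs => rw [this]
    rw [map_add, map_smul, map_smul]
    simp
  have h3 : T (Complex.I * e) = (e.re : ℂ) • T Complex.I - (e.im : ℂ) • T 1 := by
    have : Complex.I * e = e.re • Complex.I - e.im • (1 : ℂ) := by apply Complex.ext <;> simp
    rw [this, map_sub, map_smul, map_smul]
    simp
  rw [h1, h2, h3]
  match_scalars
  · ring
  · linear_combination (e.im : ℂ) * Complex.I_sq

/-- The unit complex number with argument `θ`. -/
noncomputable def cis (θ : ℝ) : ℂ := Complex.exp (θ * Complex.I)

theorem cis_ne_zero (θ : ℝ) : cis θ ≠ 0 := Complex.exp_ne_zero _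

theorem norm_cis (θ : ℝ) : ‖cis θ‖ = 1 := Complex.norm_exp_ofReal_mul_I θ

theorem continuous_cis : Continuous cis := by unfold cis; fun_prop

theorem hasDerivAt_cis (θ : ℝ) : HasDerivAt cis (Complex.I * cis θ) θ := by
  have h : HasDerivAt (fun t : ℝ => (t : ℂ) * Complex.I) Complex.I θ := by
    simpa using (Complex.ofRealCLM.hasDerivAt (x := θ)).mul_const Complex.I
  have h2 := h.cexp
  rw [mul_comm] at h2
  exact h2

theorem hasDerivAt_radial {f : ℂ → E} (hf : ContDiff ℝ 1 f) (r θ : ℝ) :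
    HasDerivAt (fun s : ℝ => f (s * cis θ)) (fderiv ℝ f (r * cis θ) (cis θ)) r := by
  have h : HasDerivAt (fun s : ℝ => (s : ℂ) * cis θ) (cis θ) r := by
    simpa using (Complex.ofRealCLM.hasDerivAt (x := r)).mul_const (cis θ)
  exact ((hf.differentiable one_ne_zero) _).hasFDerivAt.comp_hasDerivAt r h

theorem hasDerivAt_angular {f : ℂ → E} (hf : ContDiff ℝ 1 f) (r θ : ℝ) :
    HasDerivAt (fun t : ℝ => f (r * cis t))
      (fderiv ℝ f (r * cis θ) (r * (Complex.I * cis θ))) θ := by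
  have h : HasDerivAt (fun t : ℝ => (r : ℂ) * cis t) (r * (Complex.I * cis θ)) θ :=
    (hasDerivAt_cis θ).const_mul _
  exact ((hf.differentiable one_ne_zero) _).hasFDerivAt.comp_hasDerivAt θ h

theorem continuous_fderiv_radial {f : ℂ → E} (hf : ContDiff ℝ 1 f) :
    Continuous (fun p : ℝ × ℝ => fderiv ℝ f (p.1 * cis p.2) (cis p.2)) := by
  have h1 : Continuous (fun p : ℝ × ℝ => fderiv ℝ f (p.1 * cis p.2)) :=
    (hf.continuous_fderiv one_ne_zero).comp
      ((Complex.continuous_ofReal.comp continuous_fst).mul (continuous_cis.comp continuous_snd))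
  exact h1.clm_apply (continuous_cis.comp continuous_snd)

/-- Up to the factor `r`, the integrand is the derivative of the periodic function θ ↦ f(r e^{iθ}).
-/
theorem integral_angular_eq_zero [CompleteSpace E] {f : ℂ → E} (hf : ContDiff ℝ 1 f) {r : ℝ}
    (hr : r ≠ 0) :
    ∫ θ in (-Real.pi)..Real.pi, fderiv ℝ f (r * cis θ) (Complex.I * cis θ) = 0 := by
  have hc : Continuous (fun θ : ℝ => fderiv ℝ f (r * cis θ) (r * (Complex.I * cis θ))) := by
    have h1 : Continuous (fun θ : ℝ => fderiv ℝ f (r * cis θ)) :=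
      (hf.continuous_fderiv one_ne_zero).comp (continuous_const.mul continuous_cis)
    exact h1.clm_apply (continuous_const.mul (continuous_const.mul continuous_cis))
  have h := intervalIntegral.integral_eq_sub_of_hasDerivAt
    (fun θ _ => hasDerivAt_angular hf r θ) (hc.intervalIntegrable (-Real.pi) Real.pi)
  have h0 : cis Real.pi = cis (-Real.pi) := by
    simp only [cis, Complex.ofReal_neg, neg_mul, Complex.exp_neg, Complex.exp_pi_mul_I]
    norm_num
  rw [h0, sub_self] at h
  have h2 : ∀ θ : ℝ, fderiv ℝ f (r * cis θ) (r * (Complex.I * cis θ))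
      = r • fderiv ℝ f (r * cis θ) (Complex.I * cis θ) := by
    intro θ
    rw [← map_smul]
    simp
  simp_rw [h2] at h
  rw [intervalIntegral.integral_smul] at h
  exact (smul_eq_zero.mp h).resolve_left hr

theorem hasDerivAt_circleMean {f : ℂ → E} (hf : ContDiff ℝ 1 f) (r : ℝ) :
    HasDerivAt (fun s : ℝ => ∫ θ in Ioo (-Real.pi) Real.pi, f (s * cis θ))
      (∫ θ in Ioo (-Real.pi) Real.pi, fderiv ℝ f (r * cis θ) (cis θ)) r := by
  -- The radius |r| + 1 leaves room for all `s` within distance 1 of `r`, so `B` dominates the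
  -- radial derivatives near `r`.
  obtain ⟨B, hB⟩ := (isCompact_closedBall (0 : ℂ) (|r| + 1)).exists_bound_of_continuousOn
    (hf.continuous_fderiv one_ne_zero).continuousOn
  have hcf : ∀ s : ℝ, Continuous (fun θ : ℝ => f (s * cis θ)) := fun s =>
    hf.continuous.comp (continuous_const.mul continuous_cis)
  have hmeas : ∀ s : ℝ, AEStronglyMeasurable (fun θ : ℝ => f (s * cis θ))
      (volume.restrict (Ioo (-Real.pi) Real.pi)) := fun s => (hcf s).aestronglyMeasurable
  refine (hasDerivAt_integral_of_dominated_loc_of_deriv_le (bound := fun _ => B)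
    (F' := fun s θ => fderiv ℝ f (s * cis θ) (cis θ))
    (Metric.ball_mem_nhds r one_pos) (Eventually.of_forall hmeas) ?_ ?_ ?_ ?_ ?_).2
  · exact ((hcf r).integrableOn_Icc).mono_set Ioo_subset_Icc_self
  · exact ((continuous_fderiv_radial hf).comp (Continuous.prodMk_right r)).aestronglyMeasurable
  · refine Eventually.of_forall fun θ s hs => ?_
    have h1 : (s * cis θ : ℂ) ∈ Metric.closedBall (0 : ℂ) (|r| + 1) := by
      rw [mem_closedBall_zero_iff, norm_mul, norm_cis, mul_one, Complex.norm_real,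
        Real.norm_eq_abs]
      rw [Metric.mem_ball, Real.dist_eq] at hs
      have := abs_sub_abs_le_abs_sub s r
      linarith
    refine (ContinuousLinearMap.le_opNorm _ _).trans ?_
    rw [norm_cis, mul_one]
    exact hB _ h1
  · exact integrable_const B
  · exact Eventually.of_forall fun θ s _ => hasDerivAt_radial hf s θ

theorem tendsto_circleMean {f : ℂ → E} (hf : Continuous f) {l : E}
    (hl : Tendsto f (cocompact ℂ) (𝓝 l)) :
    Tendsto (fun s : ℝ => ∫ θ in Ioo (-Real.pi) Real.pi, f (s * cis θ)) atTop
      (𝓝 (∫ _ in Ioo (-Real.pi) Real.pi, l)) := by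
  have hlim : ∀ θ : ℝ, Tendsto (fun s : ℝ => (s * cis θ : ℂ)) atTop (cocompact ℂ) := by
    intro θ
    rw [← Metric.cobounded_eq_cocompact, ← tendsto_norm_atTop_iff_cobounded]
    simp only [norm_mul, norm_cis, mul_one, Complex.norm_real]
    exact tendsto_norm_atTop_atTop
  have hb : ∀ᶠ w in cocompact ℂ, ‖f w‖ ≤ ‖l‖ + 1 := by
    have := hl.norm.eventually_le_const (show ‖l‖ < ‖l‖ + 1 by linarith)
    exact this
  rw [← Metric.cobounded_eq_cocompact, ← comap_norm_atTop, eventually_comap] at hb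
  refine tendsto_integral_filter_of_dominated_convergence (fun _ => ‖l‖ + 1) ?_ ?_
    (integrable_const _) ?_
  · exact Eventually.of_forall fun s =>
      (hf.comp (continuous_const.mul continuous_cis)).aestronglyMeasurable
  · filter_upwards [hb, eventually_ge_atTop 0] with s hs h0
    refine Eventually.of_forall fun θ => hs _ ?_
    rw [norm_mul, norm_cis, mul_one, Complex.norm_real, Real.norm_of_nonneg h0]
  · exact Eventually.of_forall fun θ => hl.comp (hlim θ)

theorem integrable_sq_decay_real : Integrable (fun r : ℝ => ((1 + ‖r‖) ^ 2)⁻¹) := by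
  have h := integrable_one_add_norm (E := ℝ) (μ := volume) (r := 2) (by simp)
  refine h.congr (Eventually.of_forall fun x => ?_)
  simp only
  rw [Real.rpow_neg (by positivity)]
  norm_cast

/-- In polar coordinates e^{-iθ} ∂f/∂z̄ = ½ (∂_r f + (i/r) ∂_θ f). The angular term integrates to
zero, and the radial term is the derivative of the integral of `f` over angles. The fundamental
theorem of calculus on (0, ∞) then gives half of 2π(l - f 0). -/
theorem integral_inv_smul_dzbar [CompleteSpace E] {f k : ℂ → E} {l : E} {C : ℝ}
    (hf : ContDiff ℝ 1 f) (hk : ∀ z, dzbar f z = k z)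
    (hC : ∀ z, ‖k z‖ ≤ C * ((1 + ‖z‖) ^ 2)⁻¹) (hl : Tendsto f (cocompact ℂ) (𝓝 l)) :
    ∫ w, w⁻¹ • k w = Real.pi • (l - f 0) := by
  have hC0 : 0 ≤ C := by simpa using (norm_nonneg _).trans (hC 0)
  have hkc : Continuous k := by
    have : k = dzbar f := (funext hk).symm
    rw [this]
    have h1 := hf.continuous_fderiv one_ne_zero
    exact continuous_const.smul ((h1.clm_apply continuous_const).add
      (continuous_const.smul (h1.clm_apply continuous_const)))
  set G : ℝ × ℝ → E := fun p => (cis p.2)⁻¹ • k (p.1 * cis p.2) with hG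
  have hGc : Continuous G := by
    refine Continuous.smul ?_ (hkc.comp ?_)
    · exact (continuous_cis.comp continuous_snd).inv₀ fun p => cis_ne_zero _
    · exact (Complex.continuous_ofReal.comp continuous_fst).mul (continuous_cis.comp continuous_snd)
  -- The polar Jacobian cancels the modulus of w⁻¹, so decay of order two suffices even though such
  -- a `k` need not be integrable on the plane.
  have hGi : IntegrableOn G (Ioi (0 : ℝ) ×ˢ Ioo (-Real.pi) Real.pi) := by
    have h1 : Integrable (fun p : ℝ × ℝ => (C * ((1 + ‖p.1‖) ^ 2)⁻¹) * 1)
        ((volume.restrict (Ioi (0 : ℝ))).prod (volume.restrict (Ioo (-Real.pi) Real.pi))) :=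
      Integrable.mul_prod ((integrable_sq_decay_real.const_mul C).restrict)
        (integrable_const (1 : ℝ))
    rw [IntegrableOn, Measure.volume_eq_prod, ← Measure.prod_restrict]
    refine h1.mono' hGc.aestronglyMeasurable (Eventually.of_forall fun p => ?_)
    rw [hG, mul_one]
    simp only [norm_smul, norm_inv, norm_cis, inv_one, one_mul]
    refine (hC _).trans_eq ?_
    rw [norm_mul, norm_cis, mul_one, Complex.norm_real]
  have hGi' := hGi
  rw [IntegrableOn, Measure.volume_eq_prod, ← Measure.prod_restrict] at hGi'
  have hpolar : ∫ w, w⁻¹ • k w = ∫ p in Ioi (0 : ℝ) ×ˢ Ioo (-Real.pi) Real.pi, G p := by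
    rw [← Complex.integral_comp_polarCoord_symm, polarCoord_target]
    refine setIntegral_congr_fun (measurableSet_Ioi.prod measurableSet_Ioo) fun p hp => ?_
    have hp1 : (p.1 : ℂ) ≠ 0 := by
      have : (0 : ℝ) < p.1 := hp.1
      exact_mod_cast this.ne'
    have hs : Complex.polarCoord.symm p = p.1 * cis p.2 := by
      rw [Complex.polarCoord_symm_apply, cis, Complex.exp_mul_I]
      simp
    simp only [hG]
    rw [hs, mul_inv, mul_smul, ← Complex.coe_smul p.1, smul_smul, mul_inv_cancel₀ hp1, one_smul]
  have hinner : ∀ r ∈ Ioi (0 : ℝ), ∫ θ in Ioo (-Real.pi) Real.pi, G (r, θ)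
      = (1 / 2 : ℂ) • ∫ θ in Ioo (-Real.pi) Real.pi, fderiv ℝ f (r * cis θ) (cis θ) := by
    intro r hr
    have hr0 : r ≠ 0 := (ne_of_gt hr)
    have h1 : ∀ θ : ℝ, G (r, θ) = (1 / 2 : ℂ) • (fderiv ℝ f (r * cis θ) (cis θ)
        + Complex.I • fderiv ℝ f (r * cis θ) (Complex.I * cis θ)) := by
      intro θ
      rw [clm_apply_unit _ _ (cis_ne_zero θ)]
      have : Complex.normSq (cis θ) = 1 := by
        rw [Complex.normSq_eq_norm_sq, norm_cis, one_pow]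
      rw [this, hG]
      simp only [← hk, dzbar, Complex.ofReal_one, one_mul]
      rw [smul_comm]
    have hcr : Continuous (fun θ : ℝ => fderiv ℝ f (r * cis θ) (cis θ)) :=
      (continuous_fderiv_radial hf).comp (Continuous.prodMk_right r)
    have hca : Continuous (fun θ : ℝ => fderiv ℝ f (r * cis θ) (Complex.I * cis θ)) := by
      have h1 : Continuous (fun θ : ℝ => fderiv ℝ f (r * cis θ)) :=
        (hf.continuous_fderiv one_ne_zero).comp (continuous_const.mul continuous_cis)
      exact h1.clm_apply (continuous_const.mul continuous_cis)
    have hi1 := (hcr.integrableOn_Icc (μ := volume) (a := -Real.pi) (b := Real.pi)).mono_set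
      Ioo_subset_Icc_self
    have hi2 := (hca.integrableOn_Icc (μ := volume) (a := -Real.pi) (b := Real.pi)).mono_set
      Ioo_subset_Icc_self
    have hi3 : IntegrableOn (fun θ : ℝ =>
        Complex.I • fderiv ℝ f (r * cis θ) (Complex.I * cis θ)) (Ioo (-Real.pi) Real.pi) :=
      hi2.smul Complex.I
    have h0 := integral_angular_eq_zero hf hr0
    rw [intervalIntegral.integral_of_le (by linarith [Real.pi_pos]),
      integral_Ioc_eq_integral_Ioo] at h0
    simp_rw [h1]
    rw [integral_smul, integral_add hi1 hi3, integral_smul, h0, smul_zero, add_zero]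
  have hM : IntegrableOn (fun r : ℝ => ∫ θ in Ioo (-Real.pi) Real.pi,
      fderiv ℝ f (r * cis θ) (cis θ)) (Ioi 0) := by
    have h1 : IntegrableOn (fun r : ℝ => ∫ θ in Ioo (-Real.pi) Real.pi, G (r, θ)) (Ioi 0) :=
      hGi'.integral_prod_left
    have h2 := h1.smul (2 : ℂ)
    refine IntegrableOn.congr_fun h2 (fun r hr => ?_) measurableSet_Ioi
    simp only [Pi.smul_apply]
    rw [hinner r hr, smul_smul]
    norm_num
  have hftc := integral_Ioi_of_hasDerivAt_of_tendsto' (a := (0 : ℝ))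
    (fun r _ => hasDerivAt_circleMean hf r) hM (tendsto_circleMean hf.continuous hl)
  rw [hpolar, Measure.volume_eq_prod, setIntegral_prod _ (by
    rwa [IntegrableOn, ← Measure.prod_restrict])]
  rw [setIntegral_congr_fun measurableSet_Ioi hinner, integral_smul, hftc]
  simp only [Complex.ofReal_zero, zero_mul, setIntegral_const, ← smul_sub]
  rw [measureReal_def, Real.volume_Ioo, ENNReal.toReal_ofReal (by linarith [Real.pi_pos]),
    ← Complex.coe_smul, ← Complex.coe_smul, smul_smul]
  congr 1
  push_cast
  ring

/-- The Cauchy-Pompeiu formula on the Riemann sphere. -/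
theorem integral_inv_sub_smul_dzbar [CompleteSpace E] {f k : ℂ → E} {l : E} {C : ℝ}
    (hf : ContDiff ℝ 1 f) (hk : ∀ z, dzbar f z = k z)
    (hC : ∀ z, ‖k z‖ ≤ C * ((1 + ‖z‖) ^ 2)⁻¹) (hl : Tendsto f (cocompact ℂ) (𝓝 l)) (z : ℂ) :
    ∫ w, (w - z)⁻¹ • k w = Real.pi • (l - f z) := by
  have hC0 : 0 ≤ C := by simpa using (norm_nonneg _).trans (hC 0)
  -- Translation moves the pole to the origin; the new constant comes from 1 + |w| ≤ (1 + |w + z|)(1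
  -- + |z|).
  have h := integral_inv_smul_dzbar (f := fun w => f (w + z)) (k := fun w => k (w + z)) (l := l)
    (C := C * (1 + ‖z‖) ^ 2) (by fun_prop) ?_ ?_ ?_
  · rw [zero_add] at h
    rw [← h, ← integral_add_right_eq_self (fun w => (w - z)⁻¹ • k w) z]
    simp
  · intro w
    rw [← hk]
    simp only [dzbar, fderiv_comp_add_right]
  · intro w
    refine (hC _).trans ?_
    rw [mul_assoc]
    refine mul_le_mul_of_nonneg_left ?_ hC0
    rw [← div_eq_mul_inv, inv_eq_one_div, div_le_div_iff₀ (by positivity) (by positivity), one_mul,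
      ← mul_pow]
    refine pow_le_pow_left₀ (by positivity) ?_ 2
    have : ‖w‖ ≤ ‖w + z‖ + ‖z‖ := by simpa using norm_sub_le (w + z) z
    nlinarith [norm_nonneg z, norm_nonneg (w + z)]
  · exact hl.comp (Homeomorph.addRight z).isClosedEmbedding.tendsto_cocompact

end CauchyPompeiu

/-! ### Decay of homogeneous functions in the affine chart, and integrability of Cauchy kernels -/

section Decay

variable {E : Type*} [NormedAddCommGroup E]

theorem integrable_cube_decay : Integrable (fun z : ℂ => ((1 + ‖z‖) ^ 3)⁻¹) := by
  have h := integrable_one_add_norm (E := ℂ) (μ := volume) (r := 3) (by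
    rw [Complex.finrank_real_complex]; norm_num)
  refine h.congr (Eventually.of_forall fun x => ?_)
  simp only
  rw [Real.rpow_neg (by positivity)]
  norm_cast

/-- The singular part of `‖z‖⁻¹`. -/
noncomputable def invNormNear (z : ℂ) : ℝ := if ‖z‖ < 1 then ‖z‖⁻¹ else 0

/-- The radial Jacobian `y` in two real dimensions cancels the singularity y⁻¹. -/
theorem integrable_invNormNear : Integrable invNormNear := by
  have h := integrable_fun_norm_addHaar (E := ℂ) (μ := volume)
    (f := fun y : ℝ => if y < 1 then y⁻¹ else 0)
  refine h.2 ?_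
  rw [Complex.finrank_real_complex]
  have h1 : IntegrableOn (fun y : ℝ => (Iio (1 : ℝ)).indicator (fun _ => (1 : ℝ)) y) (Ioi 0) := by
    rw [integrableOn_indicator_iff measurableSet_Iio, inter_comm, Ioi_inter_Iio]
    simp [IntegrableOn]
  refine IntegrableOn.congr_fun h1 (fun y hy => ?_) measurableSet_Ioi
  have hy0 : y ≠ 0 := ne_of_gt hy
  by_cases hy1 : y < 1 <;> simp [indicator, hy1, hy0]

theorem inv_norm_le (z : ℂ) : ‖z‖⁻¹ ≤ 1 + invNormNear z := by
  unfold invNormNear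
  split_ifs with h
  · linarith
  · rw [add_zero]
    exact inv_le_one_of_one_le₀ (not_lt.mp h)

theorem integrable_of_cube_decay {k : ℂ → E} {C : ℝ} (hk : Continuous k)
    (hC : ∀ z, ‖k z‖ ≤ C * ((1 + ‖z‖) ^ 3)⁻¹) : Integrable k :=
  (integrable_cube_decay.const_mul C).mono' hk.aestronglyMeasurable (Eventually.of_forall hC)

/-- The kernel is at most 1 plus its singular part near the pole. The first term is controlled by
the decay of `k`, the second by the boundedness of `k`. -/
theorem integrable_inv_sub_smul [NormedSpace ℂ E] {k : ℂ → E} {C : ℝ} (hk : Continuous k)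
    (hC : ∀ z, ‖k z‖ ≤ C * ((1 + ‖z‖) ^ 3)⁻¹) (z : ℂ) :
    Integrable (fun w => (w - z)⁻¹ • k w) := by
  have hC0 : 0 ≤ C := by simpa using (norm_nonneg _).trans (hC 0)
  have h1 : Integrable (fun w => C * ((1 + ‖w‖) ^ 3)⁻¹ + C * invNormNear (w - z)) :=
    (integrable_cube_decay.const_mul C).add
      ((integrable_invNormNear.comp_sub_right z).const_mul C)
  refine h1.mono' ?_ (Eventually.of_forall fun w => ?_)
  · exact ((measurable_id.sub_const z).inv).aestronglyMeasurable.smul hk.aestronglyMeasurable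
  · rw [norm_smul, norm_inv]
    have h2 := inv_norm_le (w - z)
    have h3 : ((1 + ‖w‖) ^ 3)⁻¹ ≤ 1 :=
      inv_le_one_of_one_le₀ (one_le_pow₀ (by linarith [norm_nonneg w]))
    have h4 : 0 ≤ invNormNear (w - z) := by unfold invNormNear; positivity
    calc ‖w - z‖⁻¹ * ‖k w‖ ≤ (1 + invNormNear (w - z)) * (C * ((1 + ‖w‖) ^ 3)⁻¹) := by
          gcongr; exact hC w
      _ = C * ((1 + ‖w‖) ^ 3)⁻¹ + C * (invNormNear (w - z) * ((1 + ‖w‖) ^ 3)⁻¹) := by ring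
      _ ≤ _ := by gcongr; exact mul_le_of_le_one_right h4 h3

theorem integrable_prod_inv_sub_smul [NormedSpace ℂ E] {F : ℂ × ℂ → E} {C : ℝ} (hF : Continuous F)
    (hC : ∀ p, ‖F p‖ ≤ C * (((1 + ‖p.1‖) ^ 3)⁻¹ * ((1 + ‖p.2‖) ^ 3)⁻¹)) :
    Integrable (fun p : ℂ × ℂ => (p.1 - p.2)⁻¹ • F p) := by
  have hC0 : 0 ≤ C := by simpa using (norm_nonneg _).trans (hC 0)
  have h1 : Integrable (fun p : ℂ × ℂ => ((1 + ‖p.1‖) ^ 3)⁻¹ * ((1 + ‖p.2‖) ^ 3)⁻¹) :=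
    integrable_cube_decay.mul_prod integrable_cube_decay
  -- The part near the diagonal is the integrand of a convolution of two integrable functions; the
  -- decay in the first variable is not needed there.
  have h2 : Integrable (fun p : ℂ × ℂ => ((1 + ‖p.2‖) ^ 3)⁻¹ * invNormNear (p.1 - p.2)) :=
    Integrable.convolution_integrand (ContinuousLinearMap.mul ℝ ℝ)
      integrable_cube_decay integrable_invNormNear
  refine ((h1.const_mul C).add (h2.const_mul C)).mono' ?_ (Eventually.of_forall fun p => ?_)
  · exact ((measurable_fst.sub measurable_snd).inv).aestronglyMeasurable.smul
      hF.aestronglyMeasurable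
  · rw [norm_smul, norm_inv]
    have h3 := inv_norm_le (p.1 - p.2)
    have h4 : ((1 + ‖p.1‖) ^ 3)⁻¹ ≤ 1 :=
      inv_le_one_of_one_le₀ (one_le_pow₀ (by linarith [norm_nonneg p.1]))
    have h5 : 0 ≤ invNormNear (p.1 - p.2) := by unfold invNormNear; positivity
    set a := ((1 + ‖p.1‖) ^ 3)⁻¹
    set b := ((1 + ‖p.2‖) ^ 3)⁻¹ with hb
    have hb0 : 0 ≤ b := by positivity
    calc ‖p.1 - p.2‖⁻¹ * ‖F p‖ ≤ (1 + invNormNear (p.1 - p.2)) * (C * (a * b)) := by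
          gcongr; exact hC p
      _ = C * (a * b) + C * (b * (invNormNear (p.1 - p.2) * a)) := by ring
      _ ≤ C * (a * b) + C * (b * invNormNear (p.1 - p.2)) := by
          gcongr; exact mul_le_of_le_one_right h5 h4

theorem norm_chart_ge (z : ℂ) : (1 + ‖z‖) / 2 ≤ ‖chart z‖ := by
  have h0 := norm_le_pi_norm (chart z) 0
  have h1 := norm_le_pi_norm (chart z) 1
  have e0 : ‖chart z 0‖ = 1 := by simp [chart]
  have e1 : ‖chart z 1‖ = ‖z‖ := by simp [chart]
  linarith

theorem chart_ne_zero (z : ℂ) : chart z ≠ 0 := fun h => by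
  have := congrFun h 0
  simp [chart] at this

/-- A continuous function of `(x, λ)` which is homogeneous of degree `-n` in modulus is bounded
by `‖λ‖⁻ⁿ`, locally uniformly in `x`. -/
theorem exists_homogeneous_bound {X : Type*} [MetricSpace X] [ProperSpace X] {U : Set X}
    (hU : IsOpen U) {f : X → Spinor → E} (n : ℕ)
    (hf : ContinuousOn (fun p : X × Spinor => f p.1 p.2) {p | p.1 ∈ U ∧ p.2 ≠ 0})
    (hh : ∀ x ∈ U, ∀ (b : ℂ) (lam : Spinor), b ≠ 0 → lam ≠ 0 →
      ‖f x (b • lam)‖ = (‖b‖ ^ n)⁻¹ * ‖f x lam‖) {x₀ : X} (hx₀ : x₀ ∈ U) :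
    ∃ δ > 0, ∃ C : ℝ, Metric.ball x₀ δ ⊆ U ∧
      ∀ x ∈ Metric.ball x₀ δ, ∀ z : ℂ, ‖f x (chart z)‖ ≤ C * ((1 + ‖z‖) ^ n)⁻¹ := by
  obtain ⟨δ, hδ, hδU⟩ := Metric.nhds_basis_closedBall.mem_iff.mp (hU.mem_nhds hx₀)
  have hK : IsCompact (Metric.closedBall x₀ δ ×ˢ Metric.sphere (0 : Spinor) 1) :=
    (isCompact_closedBall x₀ δ).prod (isCompact_sphere 0 1)
  obtain ⟨B, hB⟩ := hK.exists_bound_of_continuousOn (hf.mono fun p hp => by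
    refine ⟨hδU hp.1, fun h => ?_⟩
    have h2 := hp.2
    rw [h] at h2
    simp at h2)
  -- Rescaling to the unit sphere gives the bound B ‖chart z‖⁻ⁿ; the factor 2ⁿ comes from ‖chart z‖
  -- ≥ (1 + ‖z‖)/2.
  refine ⟨δ, hδ, B * 2 ^ n, Metric.ball_subset_closedBall.trans hδU, fun x hx z => ?_⟩
  have hz : 0 < ‖chart z‖ := norm_pos_iff.mpr (chart_ne_zero z)
  have hs : ((‖chart z‖⁻¹ : ℝ) : ℂ) • chart z ∈ Metric.sphere (0 : Spinor) 1 := by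
    rw [mem_sphere_zero_iff_norm, norm_smul, Complex.norm_real, norm_inv, norm_norm,
      inv_mul_cancel₀ hz.ne']
  have h1 := hB (x, ((‖chart z‖⁻¹ : ℝ) : ℂ) • chart z) ⟨Metric.ball_subset_closedBall hx, hs⟩
  have h2 := hh x (hδU (Metric.ball_subset_closedBall hx)) ((‖chart z‖⁻¹ : ℝ) : ℂ) (chart z)
    (by simpa using hz.ne') (chart_ne_zero z)
  simp only at h1
  rw [h2, Complex.norm_real, norm_inv, norm_norm, inv_pow, inv_inv] at h1
  have hB0 : 0 ≤ B := le_trans (by positivity) h1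
  have h3 : ‖f x (chart z)‖ ≤ B * (‖chart z‖ ^ n)⁻¹ := by
    rw [← div_eq_mul_inv, le_div_iff₀ (by positivity)]
    linarith
  refine h3.trans ?_
  rw [mul_assoc]
  refine mul_le_mul_of_nonneg_left ?_ hB0
  rw [inv_eq_one_div, ← div_eq_mul_inv, div_le_div_iff₀ (by positivity) (by positivity), one_mul,
    ← mul_pow]
  exact pow_le_pow_left₀ (by positivity) (by linarith [norm_chart_ge z]) n

end Decay

/-! ### Finite-dimensional algebras and smoothness of inversion -/

/-- A ring with a norm that defines its topology but need not be submultiplicative. -/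
class NormedAddRing (R : Type*) extends NormedAddCommGroup R, Ring R

section RingCalculus

variable {R : Type*} [NormedAddRing R] [NormedSpace ℂ R] [IsScalarTower ℂ R R]
  [SMulCommClass ℂ R R] [FiniteDimensional ℂ R]

/-- Multiplication as a continuous bilinear map. -/
noncomputable def mulCLM (R : Type*) [NormedAddRing R] [NormedSpace ℂ R] [IsScalarTower ℂ R R]
    [SMulCommClass ℂ R R] [FiniteDimensional ℂ R] : R →L[ℂ] R →L[ℂ] R :=
  (LinearMap.mk₂ ℂ (fun x y : R => x * y) add_mul (fun c x y => smul_mul_assoc c x y) mul_add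
    (fun c x y => mul_smul_comm c x y)).toContinuousBilinearMap

@[simp] theorem mulCLM_apply (x y : R) : mulCLM R x y = x * y := rfl

theorem isBoundedBilinearMap_mul' : IsBoundedBilinearMap ℂ (fun p : R × R => p.1 * p.2) :=
  (mulCLM R).isBoundedBilinearMap

/-- If left multiplication by `x` is bijective, the preimage of 1 is a right inverse of `x`;
injectivity makes it a left inverse as well. -/
theorem isUnit_mulCLM_iff (x : R) : IsUnit (mulCLM R x) ↔ IsUnit x := by
  constructor
  · rintro ⟨u, hu⟩
    have h1 : ∀ y, mulCLM R x (u.inv y) = y := fun y => by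
      rw [← hu]; exact congrArg (fun T : R →L[ℂ] R => T y) u.val_inv
    have h2 : ∀ y, u.inv (mulCLM R x y) = y := fun y => by
      rw [← hu]; exact congrArg (fun T : R →L[ℂ] R => T y) u.inv_val
    have h3 : x * u.inv 1 = 1 := h1 1
    refine ⟨⟨x, u.inv 1, h3, ?_⟩, rfl⟩
    have h4 : mulCLM R x (u.inv 1 * x) = mulCLM R x 1 := by
      simp only [mulCLM_apply]
      rw [← mul_assoc, h3, one_mul, mul_one]
    have h5 := congrArg u.inv h4
    rwa [h2, h2] at h5
  · rintro ⟨u, rfl⟩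
    exact ⟨⟨mulCLM R u, mulCLM R ↑u⁻¹, by ext; simp, by ext; simp⟩, rfl⟩

/-- The largest-entry norm on matrices is not submultiplicative, so `R` need not be a normed
algebra. Left multiplication embeds it into the Banach algebra of its endomorphisms, and smoothness
of inversion is transported from there. -/
theorem ringInverse_eq_mulCLM (x : R) : Ring.inverse x = Ring.inverse (mulCLM R x) 1 := by
  by_cases h : IsUnit x
  · obtain ⟨u, rfl⟩ := h
    set v : (R →L[ℂ] R)ˣ := ⟨mulCLM R u, mulCLM R ↑u⁻¹, by ext; simp, by ext; simp⟩
    have hv : mulCLM R (u : R) = v := rfl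
    rw [hv, Ring.inverse_unit, Ring.inverse_unit]
    change _ = mulCLM R ↑u⁻¹ 1
    simp
  · rw [Ring.inverse_non_unit _ h, Ring.inverse_non_unit _ (mt (isUnit_mulCLM_iff x).1 h)]
    rfl

theorem contDiffAt_ringInverse_of_isUnit {n : WithTop ℕ∞} {x : R} (hx : IsUnit x) :
    ContDiffAt ℂ n (Ring.inverse : R → R) x := by
  have : CompleteSpace R := FiniteDimensional.complete ℂ R
  obtain ⟨u, hu⟩ := (isUnit_mulCLM_iff x).2 hx
  have h1 : ContDiffAt ℂ n (Ring.inverse : (R →L[ℂ] R) → _) (mulCLM R x) := by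
    rw [← hu]; exact contDiffAt_ringInverse ℂ u
  have h2 : ContDiffAt ℂ n (fun y : R => Ring.inverse (mulCLM R y) (1 : R)) x :=
    (h1.comp x (mulCLM R).contDiff.contDiffAt).clm_apply contDiffAt_const
  exact h2.congr_of_eventuallyEq (Eventually.of_forall ringInverse_eq_mulCLM)

end RingCalculus

/-! ### Functions smooth in (x, λ) and holomorphic in x -/

section SmoothHolo

variable {E : Type*} [NormedAddCommGroup E] [NormedSpace ℂ E]
  {E' : Type*} [NormedAddCommGroup E'] [NormedSpace ℂ E']
  {X : Type*} [NormedAddCommGroup X] [NormedSpace ℂ X]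

/-- Functions of `(x, λ)`, `x ∈ U`, `λ ≠ 0`, which are smooth, and holomorphic in `x`. -/
structure SmoothHolo (U : Set X) (F : X → Spinor → E) : Prop where
  smooth : ContDiffOn ℝ ∞ (fun p : X × Spinor => F p.1 p.2) {p | p.1 ∈ U ∧ p.2 ≠ 0}
  holo : ∀ lam : Spinor, lam ≠ 0 → DifferentiableOn ℂ (fun x => F x lam) U

theorem isOpen_punctured {X : Type*} [TopologicalSpace X] {U : Set X} (hU : IsOpen U) :
    IsOpen {p : X × Spinor | p.1 ∈ U ∧ p.2 ≠ 0} :=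
  (hU.preimage continuous_fst).inter (isOpen_ne.preimage continuous_snd)

variable {U : Set X} {F : X → Spinor → E}

theorem SmoothHolo.contDiffAt (hF : SmoothHolo U F) (hU : IsOpen U) {x : X} (hx : x ∈ U)
    {lam : Spinor} (hl : lam ≠ 0) :
    ContDiffAt ℝ ∞ (fun p : X × Spinor => F p.1 p.2) (x, lam) :=
  hF.smooth.contDiffAt ((isOpen_punctured hU).mem_nhds ⟨hx, hl⟩)

theorem SmoothHolo.differentiableAt (hF : SmoothHolo U F) (hU : IsOpen U) {x : X}
    (hx : x ∈ U) {lam : Spinor} (hl : lam ≠ 0) : DifferentiableAt ℂ (fun y => F y lam) x :=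
  (hF.holo lam hl).differentiableAt (hU.mem_nhds hx)

theorem SmoothHolo.contDiffAt_right (hF : SmoothHolo U F) (hU : IsOpen U) {x : X}
    (hx : x ∈ U) {lam : Spinor} (hl : lam ≠ 0) : ContDiffAt ℝ ∞ (F x) lam :=
  (hF.contDiffAt hU hx hl).comp lam (contDiff_prodMk_right x).contDiffAt

theorem SmoothHolo.contDiffAt_left (hF : SmoothHolo U F) (hU : IsOpen U) {x : X}
    (hx : x ∈ U) {lam : Spinor} (hl : lam ≠ 0) : ContDiffAt ℝ ∞ (fun y => F y lam) x :=
  (hF.contDiffAt hU hx hl).comp x (contDiff_prodMk_left lam).contDiffAt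

theorem SmoothHolo.clm_comp (hF : SmoothHolo U F) (T : E →L[ℂ] E') :
    SmoothHolo U (fun x lam => T (F x lam)) where
  smooth := (T.contDiff.restrict_scalars ℝ).comp_contDiffOn hF.smooth
  holo lam hl := T.differentiable.comp_differentiableOn (hF.holo lam hl)

/-- Rewriting complex derivatives as real derivatives of one jointly smooth function reduces all
later interchanges of derivatives to the symmetry of its second derivative. -/
theorem SmoothHolo.fderiv_left (hF : SmoothHolo U F) (hU : IsOpen U) {x : X}
    (hx : x ∈ U) {lam : Spinor} (hl : lam ≠ 0) (v : X) :
    fderiv ℂ (fun y => F y lam) x v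
      = fderiv ℝ (fun p : X × Spinor => F p.1 p.2) (x, lam) (v, 0) := by
  have h1 := (hF.differentiableAt hU hx hl).hasFDerivAt.restrictScalars ℝ
  have h2 : HasFDerivAt (fun y : X => F y lam) _ x :=
    HasFDerivAt.comp (g := fun p : X × Spinor => F p.1 p.2) x
      (((hF.contDiffAt hU hx hl).differentiableAt (by simp)).hasFDerivAt)
      (hasFDerivAt_prodMk_left (𝕜 := ℝ) x lam)
  have h3 := h1.unique h2
  have h4 := congrArg (fun T => T v) h3
  simpa using h4

theorem SmoothHolo.fderiv_right (hF : SmoothHolo U F) (hU : IsOpen U) {x : X}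
    (hx : x ∈ U) {lam : Spinor} (hl : lam ≠ 0) (v : Spinor) :
    fderiv ℝ (F x) lam v
      = fderiv ℝ (fun p : X × Spinor => F p.1 p.2) (x, lam) (0, v) := by
  have h2 : HasFDerivAt (F x) _ lam :=
    (((hF.contDiffAt hU hx hl).differentiableAt (by simp)).hasFDerivAt).comp lam
      (hasFDerivAt_prodMk_right (𝕜 := ℝ) x lam)
  have h4 := congrArg (fun T => T v) h2.fderiv
  simpa using h4

theorem fderiv_fderiv_apply_comm {D E : Type*} [NormedAddCommGroup D] [NormedSpace ℝ D]
    [NormedAddCommGroup E] [NormedSpace ℝ E] {g : D → E} {p : D} (hg : ContDiffAt ℝ ∞ g p) (v w : D) :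
    fderiv ℝ (fun y => fderiv ℝ g y v) p w = fderiv ℝ (fun y => fderiv ℝ g y w) p v := by
  have h1 : DifferentiableAt ℝ (fderiv ℝ g) p :=
    (hg.fderiv_right (m := 1) (by norm_cast)).differentiableAt (by simp)
  have h2 : ∀ u : D, fderiv ℝ (fun y => fderiv ℝ g y u) p
      = (ContinuousLinearMap.apply ℝ E u).comp (fderiv ℝ (fderiv ℝ g) p) := fun u =>
    ((ContinuousLinearMap.apply ℝ E u).hasFDerivAt.comp p h1.hasFDerivAt).fderiv
  rw [h2, h2]
  exact (hg.isSymmSndFDerivAt (by simp; exact WithTop.coe_le_coe.2 (le_top : (2 : ℕ∞) ≤ ⊤))).eq w v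

theorem contDiffAt_fderiv_apply {D E : Type*} [NormedAddCommGroup D] [NormedSpace ℝ D]
    [NormedAddCommGroup E] [NormedSpace ℝ E] {g : D → E} {p : D} (hg : ContDiffAt ℝ ∞ g p) (v : D) :
    ContDiffAt ℝ ∞ (fun y => fderiv ℝ g y v) p :=
  (hg.fderiv_right (m := ∞) (by norm_cast)).clm_apply contDiffAt_const

/-- Directional derivatives of smooth holomorphic functions are holomorphic. -/
theorem differentiableAt_fderiv_apply {D : Type*} [NormedAddCommGroup D] [NormedSpace ℂ D]
    {g : D → E} {x : D} (hg : ContDiffAt ℝ ∞ g x) (hh : ∀ᶠ y in 𝓝 x, DifferentiableAt ℂ g y)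
    (v : D) : DifferentiableAt ℂ (fun y => fderiv ℂ g y v) x := by
  have he : ∀ u : D, (fun y => fderiv ℂ g y u) =ᶠ[𝓝 x] fun y => fderiv ℝ g y u := fun u => by
    filter_upwards [hh] with y hy
    rw [hy.fderiv_restrictScalars ℝ]
    rfl
  have hd : ∀ u : D, DifferentiableAt ℝ (fun y => fderiv ℝ g y u) x := fun u =>
    (contDiffAt_fderiv_apply hg u).differentiableAt (by simp)
  -- By symmetry of the second real derivative, complex linearity in the direction of the first
  -- derivative passes to the direction of the second, and this is holomorphy of the derivative.
  have key : ∀ w, fderiv ℝ (fun y => fderiv ℝ g y v) x (Complex.I • w)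
      = Complex.I • fderiv ℝ (fun y => fderiv ℝ g y v) x w := fun w => by
    rw [fderiv_fderiv_apply_comm hg v (Complex.I • w), fderiv_fderiv_apply_comm hg v w]
    have h1 : (fun y => fderiv ℝ g y (Complex.I • w))
        =ᶠ[𝓝 x] fun y => Complex.I • fderiv ℝ g y w := by
      filter_upwards [he w, he (Complex.I • w)] with y h2 h3
      rw [← h2, ← h3, map_smul]
    rw [h1.fderiv_eq, fderiv_fun_const_smul (hd w)]
    rfl
  refine DifferentiableAt.congr_of_eventuallyEq ?_ (he v)
  rw [differentiableAt_iff_restrictScalars ℝ (hd v)]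
  refine ⟨⟨{ toFun := fderiv ℝ (fun y => fderiv ℝ g y v) x
             map_add' := map_add _
             map_smul' := fun c w => ?_ }, ContinuousLinearMap.cont _⟩, rfl⟩
  have hc : c • w = c.re • w + c.im • (Complex.I • w) := by
    conv_lhs => rw [← Complex.re_add_im c]
    rw [add_smul, mul_smul, Complex.coe_smul, Complex.coe_smul]
  simp only [RingHom.id_apply]
  rw [hc, map_add, map_smul, map_smul, key]
  conv_rhs => rw [← Complex.re_add_im c]
  rw [add_smul, mul_smul, Complex.coe_smul, Complex.coe_smul]

theorem SmoothHolo.fderiv_apply (hF : SmoothHolo U F) (hU : IsOpen U) (v : X) :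
    SmoothHolo U (fun x lam => fderiv ℂ (fun y => F y lam) x v) where
  smooth := by
    rintro ⟨x, lam⟩ ⟨hx, hl⟩
    refine ContDiffAt.contDiffWithinAt ?_
    refine (contDiffAt_fderiv_apply (hF.contDiffAt hU hx hl)
      ((v, 0) : X × Spinor)).congr_of_eventuallyEq ?_
    filter_upwards [(isOpen_punctured hU).mem_nhds (x := (x, lam)) ⟨hx, hl⟩] with p hp
    exact hF.fderiv_left hU hp.1 hp.2 v
  holo lam hl x hx := by
    refine (differentiableAt_fderiv_apply (hF.contDiffAt_left hU hx hl) ?_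
      v).differentiableWithinAt
    filter_upwards [hU.mem_nhds hx] with y hy
    exact hF.differentiableAt hU hy hl

theorem SmoothHolo.fderiv_comm (hF : SmoothHolo U F) (hU : IsOpen U) {x : X}
    (hx : x ∈ U) {lam : Spinor} (hl : lam ≠ 0) (v w : X) :
    fderiv ℂ (fun y => fderiv ℂ (fun z => F z lam) y v) x w
      = fderiv ℂ (fun y => fderiv ℂ (fun z => F z lam) y w) x v := by
  have hev : ∀ u : X,
      (fun y : X × Spinor => fderiv ℂ (fun z => F z y.2) y.1 u) =ᶠ[𝓝 (x, lam)]
      fun y => fderiv ℝ (fun p : X × Spinor => F p.1 p.2) y (u, 0) := fun u => by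
    filter_upwards [(isOpen_punctured hU).mem_nhds (x := (x, lam)) ⟨hx, hl⟩] with p hp
    exact hF.fderiv_left hU hp.1 hp.2 u
  rw [(hF.fderiv_apply hU v).fderiv_left hU hx hl, (hF.fderiv_apply hU w).fderiv_left hU hx hl,
    (hev v).fderiv_eq, (hev w).fderiv_eq]
  exact fderiv_fderiv_apply_comm (hF.contDiffAt hU hx hl) _ _

/-- Both sides are combinations of second real derivatives of the joint function in the directions
(v, 0) and (0, w), so they agree by symmetry. `G` stands for the λ̄-derivative of `F`; its
holomorphy in x gives the complex derivative on the right its meaning. -/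
theorem SmoothHolo.dBar_fderiv (hF : SmoothHolo U F) (hU : IsOpen U) {x : X}
    (hx : x ∈ U) {lam : Spinor} (hl : lam ≠ 0) (v : X) (α' : Fin 2)
    {G : X → Spinor → E} (hG : SmoothHolo U G)
    (hFG : ∀ y ∈ U, dBar α' (F y) lam = G y lam) :
    dBar α' (fun l => fderiv ℂ (fun y => F y l) x v) lam
      = fderiv ℂ (fun y => G y lam) x v := by
  set g := fun p : X × Spinor => F p.1 p.2
  have hg := hF.contDiffAt hU hx hl
  have hr : ∀ w : Spinor, fderiv ℝ (fun l => fderiv ℂ (fun y => F y l) x v) lam w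
      = fderiv ℝ (fun p => fderiv ℝ g p (0, w)) (x, lam) (v, 0) := fun w => by
    rw [(hF.fderiv_apply hU v).fderiv_right hU hx hl]
    have hev : (fun y : X × Spinor => fderiv ℂ (fun z => F z y.2) y.1 v)
        =ᶠ[𝓝 (x, lam)] fun y => fderiv ℝ g y (v, 0) := by
      filter_upwards [(isOpen_punctured hU).mem_nhds (x := (x, lam)) ⟨hx, hl⟩] with p hp
      exact hF.fderiv_left hU hp.1 hp.2 v
    rw [hev.fderiv_eq]
    exact fderiv_fderiv_apply_comm hg _ _
  have hd : ∀ w : Spinor, DifferentiableAt ℝ (fun p => fderiv ℝ g p (0, w)) (x, lam) := fun w =>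
    (contDiffAt_fderiv_apply hg _).differentiableAt (by simp)
  have hleft : ∀ w : Spinor, HasFDerivAt (fun y => fderiv ℝ g (y, lam) (0, w))
      ((fderiv ℝ (fun p => fderiv ℝ g p (0, w)) (x, lam)).comp
        (ContinuousLinearMap.inl ℝ X Spinor)) x := fun w =>
    HasFDerivAt.comp (g := fun p => fderiv ℝ g p (0, w)) x (hd w).hasFDerivAt
      (hasFDerivAt_prodMk_left (𝕜 := ℝ) x lam)
  have h1 : HasFDerivAt (fun y => G y lam) _ x :=
    ((((hleft (Pi.single α' 1)).add ((hleft (Pi.single α' Complex.I)).const_smul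
      Complex.I)).const_smul (1 / 2 : ℂ))).congr_of_eventuallyEq (by
        filter_upwards [hU.mem_nhds hx] with y hy
        rw [← hFG y hy, dBar, hF.fderiv_right hU hy hl, hF.fderiv_right hU hy hl]
        rfl)
  have h2 := (hG.differentiableAt hU hx hl).hasFDerivAt.restrictScalars ℝ
  have h3 := congrArg (fun T => T v) (h2.unique h1)
  simp only [ContinuousLinearMap.coe_restrictScalars'] at h3
  rw [h3, dBar, hr, hr]
  simp

theorem SmoothHolo.comp {Y : Type*} [NormedAddCommGroup Y] [NormedSpace ℂ Y] {V : Set Y}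
    {G : Y → Spinor → E} (hG : SmoothHolo V G) {g : X → Spinor → Y} (hg : SmoothHolo U g)
    (hgV : ∀ x ∈ U, ∀ lam : Spinor, lam ≠ 0 → g x lam ∈ V) :
    SmoothHolo U (fun x lam => G (g x lam) lam) where
  smooth := ContDiffOn.comp (g := fun p : Y × Spinor => G p.1 p.2) hG.smooth
    (hg.smooth.prodMk contDiffOn_snd) fun p hp => ⟨hgV p.1 hp.1 p.2 hp.2, hp.2⟩
  holo lam hl := DifferentiableOn.comp (g := fun y => G y lam) (hG.holo lam hl) (hg.holo lam hl)
    fun x hx => hgV x hx lam hl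

variable {R : Type*} [NormedAddRing R] [NormedSpace ℂ R] [IsScalarTower ℂ R R]
  [SMulCommClass ℂ R R] [FiniteDimensional ℂ R]

theorem SmoothHolo.mul {F G : X → Spinor → R} (hF : SmoothHolo U F)
    (hG : SmoothHolo U G) : SmoothHolo U (fun x lam => F x lam * G x lam) where
  smooth := (isBoundedBilinearMap_mul'.contDiff.restrict_scalars ℝ).comp_contDiffOn
    (hF.smooth.prodMk hG.smooth)
  holo lam hl := (isBoundedBilinearMap_mul'.contDiff.differentiable
    one_ne_zero).comp_differentiableOn ((hF.holo lam hl).prodMk (hG.holo lam hl))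

theorem SmoothHolo.ringInverse {F : X → Spinor → R} (hF : SmoothHolo U F)
    (hu : ∀ x ∈ U, ∀ lam : Spinor, lam ≠ 0 → IsUnit (F x lam)) :
    SmoothHolo U (fun x lam => Ring.inverse (F x lam)) where
  smooth p hp := ContDiffAt.comp_contDiffWithinAt (g := Ring.inverse) p
    ((contDiffAt_ringInverse_of_isUnit (hu p.1 hp.1 p.2 hp.2)).restrict_scalars ℝ)
    (hF.smooth p hp)
  holo lam hl x hx := DifferentiableAt.comp_differentiableWithinAt (g := Ring.inverse) x
    ((contDiffAt_ringInverse_of_isUnit (n := 1) (hu x hx lam hl)).differentiableAt one_ne_zero)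
    (hF.holo lam hl x hx)

end SmoothHolo

/-! ### Even and odd derivations of superfields -/

section Derivations

/-- A parity automorphism of a ring, and odd derivations of it with indices `(α, a)`. -/
structure OddDerivations (R ι : Type*) [NormedAddRing R] [NormedSpace ℂ R] where
  parity : R →+* R
  parity_smul : ∀ (c : ℂ) (m : R), parity (c • m) = c • parity m
  δ : Fin 2 → ι → R →ₗ[ℂ] R
  δ_mul : ∀ α a m n, δ α a (m * n) = δ α a m * n + parity m * δ α a n
  δ_comm : ∀ α a β b m, δ α a (δ β b m) = -δ β b (δ α a m)

variable {R ι : Type*} [NormedAddRing R] [NormedSpace ℂ R]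

/-- `(-1)^{|A||B|}`. -/
def gradedSign : Fin 2 ⊕ ι → Fin 2 ⊕ ι → ℂ
  | Sum.inr _, Sum.inr _ => -1
  | _, _ => 1

namespace OddDerivations

variable (𝔒 : OddDerivations R ι)

/-- The power of the parity automorphism by which `∂_{αA}` is twisted. -/
def twist : Fin 2 ⊕ ι → R →+* R
  | Sum.inl _ => RingHom.id R
  | Sum.inr _ => 𝔒.parity

/-- `∂_{αA} = (∂/∂x^{αα̇}, ∂/∂θ^{αa})`. -/
noncomputable def gD (α : Fin 2) (A : Fin 2 ⊕ ι) (f : Spacetime → R) (x : Spacetime) : R :=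
  match A with
  | Sum.inl α' => dX α α' f x
  | Sum.inr a => 𝔒.δ α a (f x)

theorem gD_congr {α : Fin 2} {A : Fin 2 ⊕ ι} {f g : Spacetime → R} {x : Spacetime}
    (h : f =ᶠ[𝓝 x] g) : 𝔒.gD α A f x = 𝔒.gD α A g x := by
  rcases A with α' | a
  · simp only [gD, dX, h.fderiv_eq]
  · simp only [gD, h.eq_of_nhds]

theorem gD_add {α : Fin 2} {A : Fin 2 ⊕ ι} {f g : Spacetime → R} {x : Spacetime}
    (hf : DifferentiableAt ℂ f x) (hg : DifferentiableAt ℂ g x) :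
    𝔒.gD α A (fun y => f y + g y) x = 𝔒.gD α A f x + 𝔒.gD α A g x := by
  rcases A with α' | a
  · simp only [gD, dX, fderiv_fun_add hf hg, _root_.add_apply]
  · simp only [gD, map_add]

theorem gD_const_smul {α : Fin 2} {A : Fin 2 ⊕ ι} {f : Spacetime → R} {x : Spacetime}
    (hf : DifferentiableAt ℂ f x) (c : ℂ) :
    𝔒.gD α A (fun y => c • f y) x = c • 𝔒.gD α A f x := by
  rcases A with α' | a
  · simp only [gD, dX, fderiv_fun_const_smul hf, _root_.smul_apply]
  · simp only [gD, map_smul]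

variable [IsScalarTower ℂ R R] [SMulCommClass ℂ R R] [FiniteDimensional ℂ R]

theorem gD_mul {α : Fin 2} {A : Fin 2 ⊕ ι} {f g : Spacetime → R} {x : Spacetime}
    (hf : DifferentiableAt ℂ f x) (hg : DifferentiableAt ℂ g x) :
    𝔒.gD α A (fun y => f y * g y) x
      = 𝔒.gD α A f x * g x + 𝔒.twist A (f x) * 𝔒.gD α A g x := by
  rcases A with α' | a
  · have h := (mulCLM R).fderiv_of_bilinear hf hg
    simp only [mulCLM_apply] at h
    simp only [gD, dX, h, twist]
    simp [ContinuousLinearMap.precompR_apply, ContinuousLinearMap.precompL_apply, add_comm]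
  · simp only [gD, twist, 𝔒.δ_mul]

theorem smoothHolo_gD {U : Set Spacetime} (hU : IsOpen U) {F : Spacetime → Spinor → R}
    (hF : SmoothHolo U F) (α : Fin 2) (A : Fin 2 ⊕ ι) :
    SmoothHolo U (fun x lam => 𝔒.gD α A (fun y => F y lam) x) := by
  rcases A with α' | a
  · exact hF.fderiv_apply hU _
  · exact hF.clm_comp (𝔒.δ α a).toContinuousLinearMap

theorem gD_comm {U : Set Spacetime} (hU : IsOpen U) {F : Spacetime → Spinor → R}
    (hF : SmoothHolo U F) {x : Spacetime} (hx : x ∈ U) {lam : Spinor} (hl : lam ≠ 0)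
    (α : Fin 2) (A : Fin 2 ⊕ ι) (β : Fin 2) (B : Fin 2 ⊕ ι) :
    𝔒.gD α A (fun y => 𝔒.gD β B (fun z => F z lam) y) x
      = gradedSign A B • 𝔒.gD β B (fun y => 𝔒.gD α A (fun z => F z lam) y) x := by
  -- The odd derivation is a fixed continuous linear map on values, so it commutes with
  -- differentiation in x.
  have hc : ∀ (α : Fin 2) (α' : Fin 2) (β : Fin 2) (b : ι),
      𝔒.gD α (Sum.inl α') (fun y => 𝔒.gD β (Sum.inr b) (fun z => F z lam) y) x
      = 𝔒.gD β (Sum.inr b) (fun y => 𝔒.gD α (Sum.inl α') (fun z => F z lam) y) x := by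
    intro α α' β b
    simp only [gD, dX]
    have h := ((𝔒.δ β b).toContinuousLinearMap.hasFDerivAt.comp x
      (hF.differentiableAt hU hx hl).hasFDerivAt).fderiv
    exact congrArg (fun T => T (Pi.single α (Pi.single α' 1))) h
  rcases A with α' | a <;> rcases B with β' | b
  · simp only [gD, dX, gradedSign, one_smul]
    exact hF.fderiv_comm hU hx hl _ _
  · simp only [gradedSign, one_smul]
    exact hc α α' β b
  · simp only [gradedSign, one_smul]
    exact (hc β β' α a).symm
  · simp only [gD, gradedSign, neg_smul, one_smul]
    exact 𝔒.δ_comm α a β b _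

theorem dBar_gD {U : Set Spacetime} (hU : IsOpen U) {F G : Spacetime → Spinor → R}
    (hF : SmoothHolo U F) (hG : SmoothHolo U G) {x : Spacetime} (hx : x ∈ U) {lam : Spinor}
    (hl : lam ≠ 0) (α' : Fin 2) (hFG : ∀ y ∈ U, dBar α' (F y) lam = G y lam)
    (α : Fin 2) (A : Fin 2 ⊕ ι) :
    dBar α' (fun l => 𝔒.gD α A (fun y => F y l) x) lam = 𝔒.gD α A (fun y => G y lam) x := by
  rcases A with β' | a
  · exact hF.dBar_fderiv hU hx hl _ α' hG hFG
  · simp only [gD, ← hFG x hx, dBar]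
    have h := ((𝔒.δ α a).toContinuousLinearMap.restrictScalars ℝ).hasFDerivAt.comp lam
      ((hF.contDiffAt_right hU hx hl).differentiableAt (by simp)).hasFDerivAt
    have h' : fderiv ℝ (fun l => 𝔒.δ α a (F x l)) lam = _ := h.fderiv
    rw [h']
    simp

end OddDerivations

end Derivations

/-! ### Frames, flatness of H⁻¹ ∂ H and its ∂̄-derivative -/

section Frames

variable {R ι : Type*} [NormedAddRing R] [NormedSpace ℂ R] [IsScalarTower ℂ R R]
  [SMulCommClass ℂ R R] [FiniteDimensional ℂ R]

/-- A holomorphic frame `H` for the restriction `a` of a twistor connection to the lines of the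
points of `U`; `a₁` and `a₂` are the restrictions of the derivatives `∂_A a` and `∂_A ∂_B a`. -/
structure FrameData (𝔒 : OddDerivations R ι) (U : Set Spacetime) (H a : Spacetime → Spinor → R)
    (a₁ : Fin 2 ⊕ ι → Spacetime → Spinor → R)
    (a₂ : Fin 2 ⊕ ι → Fin 2 ⊕ ι → Spacetime → Spinor → R) : Prop where
  isOpen : IsOpen U
  holo_H : SmoothHolo U H
  holo_a : SmoothHolo U a
  holo_a₁ : ∀ A, SmoothHolo U (a₁ A)
  holo_a₂ : ∀ A B, SmoothHolo U (a₂ A B)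
  isUnit : ∀ x ∈ U, ∀ lam : Spinor, lam ≠ 0 → IsUnit (H x lam)
  parity_H : ∀ x ∈ U, ∀ lam : Spinor, lam ≠ 0 → 𝔒.parity (H x lam) = H x lam
  parity_a : ∀ x ∈ U, ∀ lam : Spinor, lam ≠ 0 → 𝔒.parity (a x lam) = a x lam
  -- The connection is even, so its derivative along `B` has the parity of `B`; moving a derivative
  -- along `A` past it costs the graded sign.
  twist_a₁ : ∀ A B, ∀ x ∈ U, ∀ lam : Spinor, lam ≠ 0 →
    𝔒.twist A (a₁ B x lam) = gradedSign A B • a₁ B x lam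
  gD_a : ∀ α A, ∀ x ∈ U, ∀ lam : Spinor, lam ≠ 0 →
    𝔒.gD α A (fun y => a y lam) x = lam α • a₁ A x lam
  gD_a₁ : ∀ α A B, ∀ x ∈ U, ∀ lam : Spinor, lam ≠ 0 →
    𝔒.gD α A (fun y => a₁ B y lam) x = lam α • a₂ A B x lam
  smul_H : ∀ x ∈ U, ∀ (b : ℂ) (lam : Spinor), b ≠ 0 → lam ≠ 0 → H x (b • lam) = H x lam
  smul_a₁ : ∀ A, ∀ x ∈ U, ∀ (b : ℂ) (lam : Spinor), b ≠ 0 → lam ≠ 0 →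
    a₁ A x (b • lam) = (b * conj b ^ 2)⁻¹ • a₁ A x lam
  smul_a₂ : ∀ A B, ∀ x ∈ U, ∀ (b : ℂ) (lam : Spinor), b ≠ 0 → lam ≠ 0 →
    a₂ A B x (b • lam) = (b ^ 2 * conj b ^ 2)⁻¹ • a₂ A B x lam
  -- Only λ̄_1 varies on the chart (1, z), so this component is enough. The sign of λ̄^1 = -λ̄_0 is
  -- absorbed by moving the term to the right.
  sparling : ∀ x ∈ U, ∀ lam : Spinor, lam ≠ 0 →
    dBar 1 (H x) lam = conj (lam 0) • (a x lam * H x lam)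

/-- `H⁻¹ f H`. -/
noncomputable def dress (H f : Spacetime → Spinor → R) (x : Spacetime) (lam : Spinor) : R :=
  Ring.inverse (H x lam) * f x lam * H x lam

/-- `H⁻¹ ∂_{αA} H`. -/
noncomputable def logD (𝔒 : OddDerivations R ι) (H : Spacetime → Spinor → R) (α : Fin 2)
    (A : Fin 2 ⊕ ι) (x : Spacetime) (lam : Spinor) : R :=
  Ring.inverse (H x lam) * 𝔒.gD α A (fun y => H y lam) x

/-- The graded commutator. -/
noncomputable def gradedComm (A B : Fin 2 ⊕ ι) (P Q : R) : R := P * Q - gradedSign A B • (Q * P)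

/-- The graded curvature `∂_{αA} W_{βB} ∓ ∂_{βB} W_{αA} + [W_{αA}, W_{βB}}` of a connection with
components `V = W_{αA}` and `W = W_{βB}`. -/
noncomputable def gradedCurv (𝔒 : OddDerivations R ι) (α : Fin 2) (A : Fin 2 ⊕ ι)
    (β : Fin 2) (B : Fin 2 ⊕ ι) (V W : Spacetime → R) (x : Spacetime) : R :=
  𝔒.gD α A W x - gradedSign A B • 𝔒.gD β B V x + gradedComm A B (V x) (W x)

namespace FrameData

variable {𝔒 : OddDerivations R ι} {U : Set Spacetime} {H a : Spacetime → Spinor → R}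
  {a₁ : Fin 2 ⊕ ι → Spacetime → Spinor → R}
  {a₂ : Fin 2 ⊕ ι → Fin 2 ⊕ ι → Spacetime → Spinor → R}

theorem twist_H (h : FrameData 𝔒 U H a a₁ a₂) (A : Fin 2 ⊕ ι) {x : Spacetime} (hx : x ∈ U)
    {lam : Spinor} (hl : lam ≠ 0) : 𝔒.twist A (H x lam) = H x lam := by
  rcases A with _ | _
  · rfl
  · exact h.parity_H x hx lam hl

theorem twist_a (h : FrameData 𝔒 U H a a₁ a₂) (A : Fin 2 ⊕ ι) {x : Spacetime} (hx : x ∈ U)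
    {lam : Spinor} (hl : lam ≠ 0) : 𝔒.twist A (a x lam) = a x lam := by
  rcases A with _ | _
  · rfl
  · exact h.parity_a x hx lam hl

theorem holo_dress (h : FrameData 𝔒 U H a a₁ a₂) {f : Spacetime → Spinor → R}
    (hf : SmoothHolo U f) : SmoothHolo U (dress H f) :=
  ((h.holo_H.ringInverse h.isUnit).mul hf).mul h.holo_H

theorem holo_logD (h : FrameData 𝔒 U H a a₁ a₂) (α : Fin 2) (A : Fin 2 ⊕ ι) :
    SmoothHolo U (logD 𝔒 H α A) :=
  (h.holo_H.ringInverse h.isUnit).mul (𝔒.smoothHolo_gD h.isOpen h.holo_H α A)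

theorem mul_dress (h : FrameData 𝔒 U H a a₁ a₂) (f : Spacetime → Spinor → R) {x : Spacetime}
    (hx : x ∈ U) {lam : Spinor} (hl : lam ≠ 0) :
    H x lam * dress H f x lam = f x lam * H x lam := by
  rw [dress, mul_assoc, Ring.mul_inverse_cancel_left _ _ (h.isUnit x hx lam hl)]

theorem mul_logD (h : FrameData 𝔒 U H a a₁ a₂) (α : Fin 2) (A : Fin 2 ⊕ ι) {x : Spacetime}
    (hx : x ∈ U) {lam : Spinor} (hl : lam ≠ 0) :
    H x lam * logD 𝔒 H α A x lam = 𝔒.gD α A (fun y => H y lam) x := by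
  rw [logD, Ring.mul_inverse_cancel_left _ _ (h.isUnit x hx lam hl)]

theorem mul_left_cancel' (h : FrameData 𝔒 U H a a₁ a₂) {x : Spacetime} (hx : x ∈ U)
    {lam : Spinor} (hl : lam ≠ 0) {m n : R} (hmn : H x lam * m = H x lam * n) : m = n :=
  (h.isUnit x hx lam hl).mul_left_cancel hmn

/-- `∂_{αA}(H⁻¹ ∂_B a H) = λ_α H⁻¹ ∂_A ∂_B a H - [H⁻¹ ∂_{αA} H, H⁻¹ ∂_B a H}`. -/
theorem gD_dress (h : FrameData 𝔒 U H a a₁ a₂) (α : Fin 2) (A B : Fin 2 ⊕ ι) {x : Spacetime}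
    (hx : x ∈ U) {lam : Spinor} (hl : lam ≠ 0) :
    𝔒.gD α A (fun y => dress H (a₁ B) y lam) x
      = lam α • dress H (a₂ A B) x lam
        - gradedComm A B (logD 𝔒 H α A x lam) (dress H (a₁ B) x lam) := by
  have hH := h.holo_H.differentiableAt h.isOpen hx hl
  -- The identity H (H⁻¹ f H) = f H is differentiated, which avoids any derivative of the inverse; H
  -- is cancelled at the end.
  have h1 : 𝔒.gD α A (fun y => H y lam * dress H (a₁ B) y lam) x
      = 𝔒.gD α A (fun y => a₁ B y lam * H y lam) x := by
    refine 𝔒.gD_congr ?_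
    filter_upwards [h.isOpen.mem_nhds hx] with y hy
    exact h.mul_dress _ hy hl
  rw [𝔒.gD_mul hH ((h.holo_dress (h.holo_a₁ B)).differentiableAt h.isOpen hx hl),
    𝔒.gD_mul ((h.holo_a₁ B).differentiableAt h.isOpen hx hl) hH, h.twist_H A hx hl,
    h.gD_a₁ α A B x hx lam hl, h.twist_a₁ A B x hx lam hl, ← h.mul_logD α A hx hl] at h1
  refine h.mul_left_cancel' hx hl ?_
  rw [← eq_sub_iff_add_eq'] at h1
  rw [h1, gradedComm, mul_sub, mul_sub, mul_smul_comm, mul_smul_comm, h.mul_dress _ hx hl,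
    ← mul_assoc (H x lam) (dress H (a₁ B) x lam), h.mul_dress _ hx hl, smul_mul_assoc,
    smul_mul_assoc, ← mul_assoc (a₁ B x lam), ← mul_assoc]
  abel

/-- The connection `H⁻¹ ∂ H` is flat. -/
theorem gradedCurv_logD (h : FrameData 𝔒 U H a a₁ a₂) (α : Fin 2) (A : Fin 2 ⊕ ι) (β : Fin 2)
    (B : Fin 2 ⊕ ι) {x : Spacetime} (hx : x ∈ U) {lam : Spinor} (hl : lam ≠ 0) :
    gradedCurv 𝔒 α A β B (fun y => logD 𝔒 H α A y lam) (fun y => logD 𝔒 H β B y lam) x = 0 := by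
  have hH := h.holo_H.differentiableAt h.isOpen hx hl
  -- Differentiating H Q = ∂H expresses second derivatives of H through Q. Their graded symmetry is
  -- then the vanishing of the curvature, multiplied by H.
  have key : ∀ (α : Fin 2) (A : Fin 2 ⊕ ι) (β : Fin 2) (B : Fin 2 ⊕ ι),
      𝔒.gD α A (fun y => 𝔒.gD β B (fun z => H z lam) y) x
        = H x lam * (logD 𝔒 H α A x lam * logD 𝔒 H β B x lam)
          + H x lam * 𝔒.gD α A (fun y => logD 𝔒 H β B y lam) x := by
    intro α A β B
    have h1 : 𝔒.gD α A (fun y => H y lam * logD 𝔒 H β B y lam) x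
        = 𝔒.gD α A (fun y => 𝔒.gD β B (fun z => H z lam) y) x := by
      refine 𝔒.gD_congr ?_
      filter_upwards [h.isOpen.mem_nhds hx] with y hy
      exact h.mul_logD β B hy hl
    rw [← h1, 𝔒.gD_mul hH ((h.holo_logD β B).differentiableAt h.isOpen hx hl), h.twist_H A hx hl,
      ← h.mul_logD α A hx hl, mul_assoc]
  have hc := 𝔒.gD_comm h.isOpen h.holo_H hx hl α A β B
  rw [key, key] at hc
  refine h.mul_left_cancel' hx hl ?_
  rw [gradedCurv, gradedComm, mul_zero, mul_add, mul_sub, mul_sub, mul_smul_comm, mul_smul_comm]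
  rw [smul_add] at hc
  rw [← sub_eq_zero] at hc
  rw [← hc]
  abel

theorem dBar_mul {F G : Spinor → R} {lam : Spinor} (hF : DifferentiableAt ℝ F lam)
    (hG : DifferentiableAt ℝ G lam) (α' : Fin 2) :
    dBar α' (fun l => F l * G l) lam = dBar α' F lam * G lam + F lam * dBar α' G lam := by
  have hd : HasFDerivAt (fun l => F l * G l) _ lam :=
    HasFDerivAt.comp (g := fun p : R × R => p.1 * p.2) lam
      ((isBoundedBilinearMap_mul'.hasFDerivAt (F lam, G lam)).restrictScalars ℝ)
      (hF.hasFDerivAt.prodMk hG.hasFDerivAt)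
  simp only [dBar, hd.fderiv]
  simp [IsBoundedBilinearMap.deriv_apply, smul_add, add_mul, mul_add, smul_mul_assoc,
    mul_smul_comm]
  abel

/-- `∂̄(H⁻¹ ∂_{αA} H) = λ_α H⁻¹ ∂_A a H`. -/
theorem dBar_logD (h : FrameData 𝔒 U H a a₁ a₂) (α : Fin 2) (A : Fin 2 ⊕ ι) {x : Spacetime}
    (hx : x ∈ U) {lam : Spinor} (hl : lam ≠ 0) :
    dBar 1 (logD 𝔒 H α A x) lam = (conj (lam 0) * lam α) • dress H (a₁ A) x lam := by
  have hH := (h.holo_H.contDiffAt_right h.isOpen hx hl).differentiableAt (by simp)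
  have hQ := ((h.holo_logD α A).contDiffAt_right h.isOpen hx hl).differentiableAt (by simp)
  have haH := h.holo_a.mul h.holo_H
  -- Applying ∂̄ to H Q = ∂H and using the Sparling equation on both sides produces the term 𝖺 H Q
  -- twice; it cancels, and only the derivative of 𝖺 survives.
  have h1 : dBar 1 (fun l => H x l * logD 𝔒 H α A x l) lam
      = dBar 1 (fun l => 𝔒.gD α A (fun y => H y l) x) lam := by
    have he : (fun l => H x l * logD 𝔒 H α A x l)
        =ᶠ[𝓝 lam] fun l => 𝔒.gD α A (fun y => H y l) x := by
      filter_upwards [isOpen_ne.mem_nhds hl] with l hl'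
      exact h.mul_logD α A hx hl'
    simp only [dBar, he.fderiv_eq]
  rw [dBar_mul hH hQ, 𝔒.dBar_gD h.isOpen h.holo_H
    (haH.clm_comp (conj (lam 0) • ContinuousLinearMap.id ℂ R)) hx hl 1
    (fun y hy => by simpa using h.sparling y hy lam hl) α A] at h1
  have h2 : 𝔒.gD α A (fun y => (conj (lam 0) • ContinuousLinearMap.id ℂ R)
      (a y lam * H y lam)) x = conj (lam 0) • 𝔒.gD α A (fun y => a y lam * H y lam) x :=
    𝔒.gD_const_smul (haH.differentiableAt h.isOpen hx hl) _
  rw [h2, 𝔒.gD_mul (h.holo_a.differentiableAt h.isOpen hx hl)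
    (h.holo_H.differentiableAt h.isOpen hx hl), h.gD_a α A x hx lam hl, h.twist_a A hx hl,
    h.sparling x hx lam hl, ← h.mul_logD α A hx hl, smul_add, smul_mul_assoc, mul_assoc,
    add_comm, add_left_inj] at h1
  refine h.mul_left_cancel' hx hl ?_
  rw [h1, mul_smul_comm, h.mul_dress _ hx hl, smul_mul_assoc, smul_smul]

end FrameData

end Frames

/-! ### The twistor line and its affine chart -/

section LineGeometry

variable {E : Type*} [NormedAddCommGroup E] [NormedSpace ℂ E]

theorem up_zero (lam : Spinor) : up lam 0 = lam 1 := by simp [up, eps]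

theorem up_one (lam : Spinor) : up lam 1 = -lam 0 := by simp [up, eps]

theorem angle_eq (a b : Spinor) : angle a b = a 1 * b 0 - a 0 * b 1 := by
  simp [angle, up_zero, up_one]; ring

theorem angle_chart (a : Spinor) (w : ℂ) : angle a (chart w) = a 1 - a 0 * w := by
  simp [angle_eq, chart]

theorem angle_chart_chart (v w : ℂ) : angle (chart v) (chart w) = v - w := by
  simp [angle_eq, chart]

/-- The spinor `(0, 1)`, the point of the line at infinity of the chart. -/
def lamInfty : Spinor := ![0, 1]

theorem lamInfty_ne_zero : lamInfty ≠ 0 := fun h => by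
  have := congrFun h 1
  simp [lamInfty] at this

theorem eq_smul_chart {lam : Spinor} (h : lam 0 ≠ 0) : lam = lam 0 • chart (lam 1 / lam 0) := by
  funext i
  fin_cases i
  · simp [chart]
  · simp [chart]; field_simp

theorem eq_smul_lamInfty {lam : Spinor} (h : lam 0 = 0) : lam = lam 1 • lamInfty := by
  funext i
  fin_cases i
  · simp [lamInfty, h]
  · simp [lamInfty]

theorem hasFDerivAt_chart (z : ℂ) :
    HasFDerivAt chart (ContinuousLinearMap.single ℝ (fun _ : Fin 2 => ℂ) 1) z := by
  have h : chart = fun z : ℂ => (Pi.single 0 1 : Spinor)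
      + ContinuousLinearMap.single ℝ (fun _ : Fin 2 => ℂ) 1 z := by
    funext z i
    fin_cases i <;> simp [chart]
  rw [h]
  exact (ContinuousLinearMap.hasFDerivAt _).const_add _

theorem contDiff_chart : ContDiff ℝ ∞ chart := by
  rw [contDiff_pi]
  intro i
  fin_cases i
  · exact contDiff_const
  · exact contDiff_id

theorem dzbar_comp_chart {f : Spinor → E} {z : ℂ} (hf : DifferentiableAt ℝ f (chart z)) :
    dzbar (fun w => f (chart w)) z = dBar 1 f (chart z) := by
  have h : HasFDerivAt (fun w => f (chart w)) _ z :=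
    HasFDerivAt.comp (g := f) z hf.hasFDerivAt (hasFDerivAt_chart z)
  rw [dzbar, dBar, h.fderiv]
  rfl

/-- As (1, z) = z (z⁻¹, 1), weight zero turns the limit z → ∞ into continuity at (0, 1). -/
theorem tendsto_comp_chart {f : Spinor → E} (hf : ContinuousAt f lamInfty)
    (hh : ∀ (b : ℂ) (lam : Spinor), b ≠ 0 → lam ≠ 0 → f (b • lam) = f lam) :
    Tendsto (fun z => f (chart z)) (cocompact ℂ) (𝓝 (f lamInfty)) := by
  have h1 : Tendsto (fun z : ℂ => (![z⁻¹, 1] : Spinor)) (cocompact ℂ) (𝓝 lamInfty) := by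
    rw [tendsto_pi_nhds]
    intro i
    rw [← Metric.cobounded_eq_cocompact]
    fin_cases i
    · exact tendsto_inv₀_cobounded
    · exact tendsto_const_nhds
  refine (hf.tendsto.comp h1).congr' ?_
  have h2 : ∀ᶠ z : ℂ in cocompact ℂ, z ≠ 0 := by
    have := (isCompact_singleton (x := (0 : ℂ))).compl_mem_cocompact
    exact this
  filter_upwards [h2] with z hz
  have h3 : chart z = z • (![z⁻¹, 1] : Spinor) := by
    funext i
    fin_cases i <;> simp [chart, hz]
  rw [h3, hh z _ hz]
  · rfl
  · intro h
    have := congrFun h 1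
    simp at this

variable {U : Set Spacetime} {F : Spacetime → Spinor → E}

theorem SmoothHolo.contDiff_chart (hF : SmoothHolo U F) (hU : IsOpen U) {x : Spacetime}
    (hx : x ∈ U) : ContDiff ℝ ∞ (fun z => F x (chart z)) :=
  contDiff_iff_contDiffAt.mpr fun z => ContDiffAt.comp (g := F x) z
    (hF.contDiffAt_right hU hx (chart_ne_zero z)) SDYM.contDiff_chart.contDiffAt

theorem norm_weight (b : ℂ) : ‖(b * conj b ^ 2)⁻¹‖ = (‖b‖ ^ 3)⁻¹ := by
  rw [norm_inv, norm_mul, norm_pow, RCLike.norm_conj]; ring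

theorem norm_weight' (b : ℂ) : ‖(b ^ 2 * conj b ^ 2)⁻¹‖ = (‖b‖ ^ 4)⁻¹ := by
  rw [norm_inv, norm_mul, norm_pow, norm_pow, RCLike.norm_conj]; ring

/-- At λ = (0, 1) and λ = (1, 0) the raised spinor is (1, 0) and (0, -1), so each choice isolates
one component. -/
theorem eq_of_sum_up_smul_eq {V W : Fin 2 → E}
    (h : ∀ lam : Spinor, lam ≠ 0 → ∑ α, up lam α • V α = ∑ α, up lam α • W α) : V = W := by
  have h0 := h lamInfty lamInfty_ne_zero
  have h1 := h (chart 0) (chart_ne_zero 0)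
  simp [Fin.sum_univ_two, up_zero, up_one, lamInfty, chart] at h0 h1
  funext α
  fin_cases α
  · exact h0
  · exact h1

end LineGeometry

/-! ### Linearity of λ^α Q_α and the integral formula for the potential -/

namespace FrameData

variable {R ι : Type*} [NormedAddRing R] [NormedSpace ℂ R] [IsScalarTower ℂ R R]
  [SMulCommClass ℂ R R] [FiniteDimensional ℂ R]
  {𝔒 : OddDerivations R ι} {U : Set Spacetime} {H a : Spacetime → Spinor → R}
  {a₁ : Fin 2 ⊕ ι → Spacetime → Spinor → R}
  {a₂ : Fin 2 ⊕ ι → Fin 2 ⊕ ι → Spacetime → Spinor → R}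

theorem smul_logD (h : FrameData 𝔒 U H a a₁ a₂) (α : Fin 2) (A : Fin 2 ⊕ ι) {x : Spacetime}
    (hx : x ∈ U) (b : ℂ) (lam : Spinor) (hb : b ≠ 0) (hl : lam ≠ 0) :
    logD 𝔒 H α A x (b • lam) = logD 𝔒 H α A x lam := by
  rw [logD, logD, h.smul_H x hx b lam hb hl]
  congr 1
  refine 𝔒.gD_congr ?_
  filter_upwards [h.isOpen.mem_nhds hx] with y hy
  exact h.smul_H y hy b lam hb hl

theorem smul_dress (h : FrameData 𝔒 U H a a₁ a₂) {f : Spacetime → Spinor → R} {x : Spacetime}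
    (hx : x ∈ U) {b c : ℂ} {lam : Spinor} (hb : b ≠ 0) (hl : lam ≠ 0)
    (hf : f x (b • lam) = c • f x lam) : dress H f x (b • lam) = c • dress H f x lam := by
  rw [dress, dress, h.smul_H x hx b lam hb hl, hf, mul_smul_comm, smul_mul_assoc]

/-- The dressed derivative of the connection has weights -1 in λ and -2 in λ̄, hence total degree -3
in modulus. -/
theorem exists_bound (h : FrameData 𝔒 U H a a₁ a₂) (A : Fin 2 ⊕ ι) {x : Spacetime}
    (hx : x ∈ U) : ∃ C : ℝ, ∀ z : ℂ, ‖dress H (a₁ A) x (chart z)‖ ≤ C * ((1 + ‖z‖) ^ 3)⁻¹ := by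
  obtain ⟨δ, hδ, C, _, hC⟩ := exists_homogeneous_bound h.isOpen (f := dress H (a₁ A)) 3
    (h.holo_dress (h.holo_a₁ A)).smooth.continuousOn (fun y hy b lam hb hl => by
      rw [h.smul_dress hy hb hl (h.smul_a₁ A y hy b lam hb hl), norm_smul, norm_weight]) hx
  exact ⟨C, hC x (Metric.mem_ball_self hδ)⟩

theorem continuous_dress (h : FrameData 𝔒 U H a a₁ a₂) {f : Spacetime → Spinor → R}
    (hf : SmoothHolo U f) {x : Spacetime} (hx : x ∈ U) :
    Continuous (fun z => dress H f x (chart z)) :=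
  ((h.holo_dress hf).contDiff_chart h.isOpen hx).continuous

theorem integrable_dress (h : FrameData 𝔒 U H a a₁ a₂) (A : Fin 2 ⊕ ι) {x : Spacetime}
    (hx : x ∈ U) : Integrable (fun z => dress H (a₁ A) x (chart z)) := by
  obtain ⟨C, hC⟩ := h.exists_bound A hx
  exact integrable_of_cube_decay (h.continuous_dress (h.holo_a₁ A) hx) hC

theorem integrable_dress₂ (h : FrameData 𝔒 U H a a₁ a₂) (A B : Fin 2 ⊕ ι) {x : Spacetime}
    (hx : x ∈ U) : Integrable (fun z => dress H (a₂ A B) x (chart z)) := by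
  obtain ⟨δ, hδ, C, _, hC⟩ := exists_homogeneous_bound h.isOpen (f := dress H (a₂ A B)) 4
    (h.holo_dress (h.holo_a₂ A B)).smooth.continuousOn (fun y hy b lam hb hl => by
      rw [h.smul_dress hy hb hl (h.smul_a₂ A B y hy b lam hb hl), norm_smul, norm_weight']) hx
  have hC := hC x (Metric.mem_ball_self hδ)
  have hC0 : 0 ≤ C := by simpa using (norm_nonneg _).trans (hC 0)
  refine integrable_of_cube_decay (h.continuous_dress (h.holo_a₂ A B) hx) (C := C)
    fun z => (hC z).trans ?_
  gcongr
  · linarith [norm_nonneg z]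
  · norm_num

theorem dzbar_logD (h : FrameData 𝔒 U H a a₁ a₂) (α : Fin 2) (A : Fin 2 ⊕ ι) {x : Spacetime}
    (hx : x ∈ U) (z : ℂ) :
    dzbar (fun w => logD 𝔒 H α A x (chart w)) z = chart z α • dress H (a₁ A) x (chart z) := by
  rw [dzbar_comp_chart (((h.holo_logD α A).contDiffAt_right h.isOpen hx
    (chart_ne_zero z)).differentiableAt (by simp)), h.dBar_logD α A hx (chart_ne_zero z)]
  simp [chart]

/-- This is Cauchy-Pompeiu for Q_α, whose limit at infinity is its value at (0, 1). The factor λ_α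
costs at most one of the three powers of decay, leaving the two that the formula requires. -/
theorem integral_inv_sub_smul (h : FrameData 𝔒 U H a a₁ a₂) (α : Fin 2) (A : Fin 2 ⊕ ι)
    {x : Spacetime} (hx : x ∈ U) (z : ℂ) :
    ∫ w, (w - z)⁻¹ • (chart w α • dress H (a₁ A) x (chart w))
      = Real.pi • (logD 𝔒 H α A x lamInfty - logD 𝔒 H α A x (chart z)) := by
  have : CompleteSpace R := FiniteDimensional.complete ℂ R
  obtain ⟨C, hC⟩ := h.exists_bound A hx
  have hC0 : 0 ≤ C := by simpa using (norm_nonneg _).trans (hC 0)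
  refine integral_inv_sub_smul_dzbar (C := C)
    (((h.holo_logD α A).contDiff_chart h.isOpen hx).of_le (by norm_cast))
    (h.dzbar_logD α A hx) (fun w => ?_)
    (tendsto_comp_chart ((h.holo_logD α A).contDiffAt_right h.isOpen hx
      lamInfty_ne_zero).continuousAt (h.smul_logD α A hx)) z
  rw [norm_smul]
  have h1 : ‖chart w α‖ ≤ 1 + ‖w‖ := by
    fin_cases α <;> simp [chart]
  calc ‖chart w α‖ * ‖dress H (a₁ A) x (chart w)‖
      ≤ (1 + ‖w‖) * (C * ((1 + ‖w‖) ^ 3)⁻¹) := by gcongr; exact hC w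
    _ = C * ((1 + ‖w‖) ^ 2)⁻¹ := by
      have : (1 + ‖w‖) ≠ 0 := by positivity
      field_simp

theorem integral_inv_sub_smul_dress (h : FrameData 𝔒 U H a a₁ a₂) (A : Fin 2 ⊕ ι)
    {x : Spacetime} (hx : x ∈ U) (z : ℂ) :
    ∫ w, (w - z)⁻¹ • dress H (a₁ A) x (chart w)
      = Real.pi • (logD 𝔒 H 0 A x lamInfty - logD 𝔒 H 0 A x (chart z)) := by
  rw [← h.integral_inv_sub_smul 0 A hx z]
  simp [chart]

/-- With λ = (1, w), the formulas for α = 0 and α = 1 differ by a factor `w` in the integrand, and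
w/(w - z) = 1 + z/(w - z). -/
theorem integral_dress_add (h : FrameData 𝔒 U H a a₁ a₂) (A : Fin 2 ⊕ ι)
    {x : Spacetime} (hx : x ∈ U) (z : ℂ) :
    (∫ w, dress H (a₁ A) x (chart w))
        + z • Real.pi • (logD 𝔒 H 0 A x lamInfty - logD 𝔒 H 0 A x (chart z))
      = Real.pi • (logD 𝔒 H 1 A x lamInfty - logD 𝔒 H 1 A x (chart z)) := by
  obtain ⟨C, hC⟩ := h.exists_bound A hx
  have hi := integrable_inv_sub_smul (h.continuous_dress (h.holo_a₁ A) hx) hC z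
  have hi' : Integrable (fun w => z • (w - z)⁻¹ • dress H (a₁ A) x (chart w)) := hi.smul z
  rw [← h.integral_inv_sub_smul 1 A hx z, ← h.integral_inv_sub_smul_dress A hx z,
    ← integral_smul, ← integral_add (h.integrable_dress A hx) hi']
  refine integral_congr_ae ?_
  have hz : ∀ᵐ w : ℂ, w ≠ z := by simp [ae_iff]
  filter_upwards [hz] with w hw
  have hw' : w - z ≠ 0 := sub_ne_zero.mpr hw
  have h1 : (w - z)⁻¹ * w = 1 + z * (w - z)⁻¹ := by field_simp; ring
  change _ + z • _ = _
  rw [smul_smul, smul_smul]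
  change _ = ((w - z)⁻¹ * w) • _
  rw [h1, add_smul, one_smul]

/-- `i` times the gauge potential of the frame. -/
noncomputable def conn (𝔒 : OddDerivations R ι) (H : Spacetime → Spinor → R) (α : Fin 2)
    (A : Fin 2 ⊕ ι) (x : Spacetime) : R :=
  -- At (0, 1) the contraction λ^α Q_α equals Q_0, at (1, 0) it equals -Q_1; these two points
  -- therefore determine the coefficients of the linear function. The potential is `Complex.I` times
  -- this value.
  logD 𝔒 H α A x (if α = 0 then lamInfty else chart 0)

theorem integral_dress (h : FrameData 𝔒 U H a a₁ a₂) (A : Fin 2 ⊕ ι)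
    {x : Spacetime} (hx : x ∈ U) :
    ∫ w, dress H (a₁ A) x (chart w)
      = Real.pi • (logD 𝔒 H 1 A x lamInfty - conn 𝔒 H 1 A x) := by
  simpa [conn] using h.integral_dress_add A hx 0

/-- This is Liouville's theorem for the contraction λ^α Q_α at λ = (1, z). It follows from
`integral_dress_add` at z, with the integral of K eliminated by the same identity at z = 0. -/
theorem logD_chart (h : FrameData 𝔒 U H a a₁ a₂) (A : Fin 2 ⊕ ι)
    {x : Spacetime} (hx : x ∈ U) (z : ℂ) :
    z • logD 𝔒 H 0 A x (chart z) - logD 𝔒 H 1 A x (chart z)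
      = z • conn 𝔒 H 0 A x - conn 𝔒 H 1 A x := by
  have h1 := h.integral_dress_add A hx z
  rw [h.integral_dress A hx, smul_comm z, ← smul_add] at h1
  have h2 := smul_right_injective R Real.pi_ne_zero h1
  have h3 : conn 𝔒 H 0 A x = logD 𝔒 H 0 A x lamInfty := rfl
  rw [h3]
  rw [smul_sub] at h2
  linear_combination (norm := module) (-1 : ℂ) • h2

theorem sum_up_smul_logD (h : FrameData 𝔒 U H a a₁ a₂) (A : Fin 2 ⊕ ι) {x : Spacetime}
    (hx : x ∈ U) {lam : Spinor} (hl : lam ≠ 0) :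
    ∑ α, up lam α • logD 𝔒 H α A x lam = ∑ α, up lam α • conn 𝔒 H α A x := by
  simp only [Fin.sum_univ_two, up_zero, up_one]
  by_cases h0 : lam 0 = 0
  · have h1 : lam 1 ≠ 0 := fun h1 => hl (by funext i; fin_cases i <;> assumption)
    rw [h0, neg_zero, zero_smul, zero_smul, eq_smul_lamInfty h0,
      h.smul_logD 0 A hx _ _ h1 lamInfty_ne_zero]
    rfl
  · have h1 := h.logD_chart A hx (lam 1 / lam 0)
    have h2 : ∀ α, logD 𝔒 H α A x lam = logD 𝔒 H α A x (chart (lam 1 / lam 0)) := fun α => by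
      conv_lhs => rw [eq_smul_chart h0]
      exact h.smul_logD α A hx _ _ h0 (chart_ne_zero _)
    rw [h2, h2]
    have h3 := congrArg (fun m => lam 0 • m) h1
    simp only [smul_sub, smul_smul, mul_div_cancel₀ _ h0] at h3
    simpa [sub_eq_add_neg] using h3

theorem conn_holo (h : FrameData 𝔒 U H a a₁ a₂) (α : Fin 2) (A : Fin 2 ⊕ ι) :
    DifferentiableOn ℂ (conn 𝔒 H α A) U := by
  refine (h.holo_logD α A).holo _ ?_
  split_ifs
  · exact lamInfty_ne_zero
  · exact chart_ne_zero 0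

/-- The potentials of a frame. -/
theorem isPotential_iff (h : FrameData 𝔒 U H a a₁ a₂) {A : Spacetime → Fin 2 → Fin 2 ⊕ ι → R} :
    (∀ x ∈ U, ∀ lam : Spinor, lam ≠ 0 → ∀ B,
      Ring.inverse (H x lam) * ∑ α, up lam α • 𝔒.gD α B (fun y => H y lam) x
        = -Complex.I • ∑ α, up lam α • A x α B)
    ↔ ∀ x ∈ U, ∀ α B, A x α B = Complex.I • conn 𝔒 H α B x := by
  have h1 : ∀ (x : Spacetime) (lam : Spinor) (B : Fin 2 ⊕ ι),
      Ring.inverse (H x lam) * ∑ α, up lam α • 𝔒.gD α B (fun y => H y lam) x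
        = ∑ α, up lam α • logD 𝔒 H α B x lam := fun x lam B => by
    simp only [Finset.mul_sum, mul_smul_comm, logD]
  simp only [h1]
  constructor
  · intro hA x hx α B
    have h2 : (fun α => conn 𝔒 H α B x) = fun α => -Complex.I • A x α B := by
      refine eq_of_sum_up_smul_eq fun lam hl => ?_
      rw [← h.sum_up_smul_logD B hx hl, hA x hx lam hl B, Finset.smul_sum]
      exact Finset.sum_congr rfl fun α _ => smul_comm _ _ _
    rw [show conn 𝔒 H α B x = -Complex.I • A x α B from congrFun h2 α, smul_smul]
    simp
  · intro hA x hx lam hl B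
    rw [h.sum_up_smul_logD B hx hl, Finset.smul_sum]
    refine Finset.sum_congr rfl fun α _ => ?_
    rw [hA x hx, smul_comm (-Complex.I), smul_smul (-Complex.I)]
    simp

theorem logD_eq_zero_of_eq_one (h : FrameData 𝔒 U H a a₁ a₂) {iota : Spinor}
    (hH : ∀ x ∈ U, H x iota = 1) (α : Fin 2) (A : Fin 2 ⊕ ι) {x : Spacetime} (hx : x ∈ U) :
    logD 𝔒 H α A x iota = 0 := by
  have h1 : 𝔒.gD α A (fun y => H y iota) x = 𝔒.gD α A (fun _ => 1) x := by
    refine 𝔒.gD_congr ?_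
    filter_upwards [h.isOpen.mem_nhds hx] with y hy
    exact hH y hy
  have h2 : 𝔒.gD α A (fun _ => 1) x = 0 := by
    rcases A with α' | b
    · simp [OddDerivations.gD, dX]
    -- An odd derivation kills 1, by the Leibniz rule for 1 · 1.
    · have := 𝔒.δ_mul α b 1 1
      simpa [OddDerivations.gD] using this
  rw [logD, h1, h2, mul_zero]

theorem integrable_potential (h : FrameData 𝔒 U H a a₁ a₂) (iota : Spinor) (A : Fin 2 ⊕ ι) {x : Spacetime} (hx : x ∈ U) :
    LineIntegrable (fun lam => (angle iota lam)⁻¹ • dress H (a₁ A) x lam) := by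
  unfold LineIntegrable
  simp only [angle_chart]
  by_cases h0 : iota 0 = 0
  · simp only [h0, zero_mul, sub_zero]
    exact (h.integrable_dress A hx).smul _
  · obtain ⟨C, hC⟩ := h.exists_bound A hx
    have h1 := (integrable_inv_sub_smul (h.continuous_dress (h.holo_a₁ A) hx) hC
      (iota 1 / iota 0)).smul (-(iota 0)⁻¹)
    refine h1.congr (Eventually.of_forall fun w => ?_)
    simp only [Pi.smul_apply, smul_smul]
    congr 1
    rw [← inv_neg, ← mul_inv]
    congr 1
    field_simp
    ring

/-- The normalisation makes Q vanish at ι. For ι in the chart, Cauchy-Pompeiu with its pole at ι₁/ι₀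
gives component 0, and ι^α W_α = 0 gives component 1. For ι at infinity the kernel is constant on
the chart, component 0 vanishes, and component 1 is a multiple of the integral of K. -/
theorem conn_eq_lineIntegral (h : FrameData 𝔒 U H a a₁ a₂) {iota : Spinor} (hi : iota ≠ 0)
    (hH : ∀ x ∈ U, H x iota = 1) (α : Fin 2) (A : Fin 2 ⊕ ι) {x : Spacetime} (hx : x ∈ U) :
    Complex.I • conn 𝔒 H α A x = (iota α / (2 * Real.pi)) •
      lineIntegral (fun lam => (angle iota lam)⁻¹ • dress H (a₁ A) x lam) := by
  have hpi : (Real.pi : ℂ) ≠ 0 := by exact_mod_cast Real.pi_ne_zero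
  have hc0 : conn 𝔒 H 0 A x = logD 𝔒 H 0 A x lamInfty := rfl
  unfold lineIntegral
  simp only [angle_chart, smul_smul]
  by_cases h0 : iota 0 = 0
  · have h1 : iota 1 ≠ 0 := fun h1 => hi (by funext i; fin_cases i <;> assumption)
    have h2 : ∀ β, logD 𝔒 H β A x lamInfty = 0 := fun β => by
      rw [← h.smul_logD β A hx _ _ h1 lamInfty_ne_zero, ← eq_smul_lamInfty h0]
      exact h.logD_eq_zero_of_eq_one hH β A hx
    simp only [h0, zero_mul, sub_zero]
    rw [integral_smul, h.integral_dress A hx, h2, ← Complex.coe_smul]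
    fin_cases α
    · simp [hc0, h2, h0]
    · simp only [Fin.mk_one, zero_sub, smul_neg, smul_smul, ← neg_smul]
      congr 1
      field_simp
  · have h2 : ∀ β, logD 𝔒 H β A x (chart (iota 1 / iota 0)) = 0 := fun β => by
      rw [← h.smul_logD β A hx _ _ h0 (chart_ne_zero _), ← eq_smul_chart h0]
      exact h.logD_eq_zero_of_eq_one hH β A hx
    have h3 : ∀ w : ℂ, (iota 1 - iota 0 * w)⁻¹ = -(iota 0)⁻¹ * (w - iota 1 / iota 0)⁻¹ := by
      intro w
      rw [← inv_neg, ← mul_inv]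
      congr 1
      field_simp
      ring
    have h4 := h.logD_chart A hx (iota 1 / iota 0)
    rw [h2, h2, smul_zero, sub_zero, eq_comm, sub_eq_zero] at h4
    simp only [h3, mul_smul]
    rw [integral_smul, h.integral_inv_sub_smul_dress A hx, h2, sub_zero, ← Complex.coe_smul,
      ← hc0]
    fin_cases α
    · simp only [Fin.zero_eta, smul_smul]
      congr 1
      field_simp
    · simp only [Fin.mk_one, ← h4, smul_smul]
      congr 1
      field_simp

end FrameData

/-! ### Self-duality and the integral formula for the curvature -/

section Curvature

variable {R ι : Type*} [NormedAddRing R] [NormedSpace ℂ R] [IsScalarTower ℂ R R]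
  [SMulCommClass ℂ R R] [FiniteDimensional ℂ R]

/-- The graded commutator as a continuous bilinear map. -/
noncomputable def gradedCommCLM (A B : Fin 2 ⊕ ι) : R →L[ℂ] R →L[ℂ] R :=
  mulCLM R - gradedSign A B • (mulCLM R).flip

theorem gradedCommCLM_apply (A B : Fin 2 ⊕ ι) (P Q : R) :
    gradedCommCLM A B P Q = gradedComm A B P Q := by
  simp [gradedCommCLM, gradedComm]

theorem gradedCurv_congr (𝔒 : OddDerivations R ι) {α β : Fin 2} {A B : Fin 2 ⊕ ι}
    {V V' W W' : Spacetime → R} {x : Spacetime} (hV : V =ᶠ[𝓝 x] V') (hW : W =ᶠ[𝓝 x] W') :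
    gradedCurv 𝔒 α A β B V W x = gradedCurv 𝔒 α A β B V' W' x := by
  simp only [gradedCurv, 𝔒.gD_congr hV, 𝔒.gD_congr hW, hV.eq_of_nhds, hW.eq_of_nhds]

theorem OddDerivations.gD_sub (𝔒 : OddDerivations R ι) {α : Fin 2} {A : Fin 2 ⊕ ι}
    {f g : Spacetime → R} {x : Spacetime} (hf : DifferentiableAt ℂ f x)
    (hg : DifferentiableAt ℂ g x) :
    𝔒.gD α A (fun y => f y - g y) x = 𝔒.gD α A f x - 𝔒.gD α A g x := by
  have h := 𝔒.gD_add (α := α) (A := A) hf (hg.const_smul (-1 : ℂ))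
  have h' := 𝔒.gD_const_smul (α := α) (A := A) hg (-1)
  rw [show (fun y => f y - g y) = fun y => f y + ((-1 : ℂ) • g) y by
    funext y; simp [sub_eq_add_neg]]
  rw [h, show ((-1 : ℂ) • g) = fun y => (-1 : ℂ) • g y from rfl, h']
  simp [sub_eq_add_neg]

/-- The symmetric part of the curvature depends only on the difference of the components. -/
theorem gradedCurv_symm_part (𝔒 : OddDerivations R ι) {A B : Fin 2 ⊕ ι}
    {V W : Fin 2 → Spacetime → R} {x : Spacetime} (hV : ∀ α, DifferentiableAt ℂ (V α) x)
    (hW : ∀ α, DifferentiableAt ℂ (W α) x) :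
    gradedCurv 𝔒 0 A 0 B (V 0) (W 0) x - gradedCurv 𝔒 0 A 1 B (V 0) (W 1) x
      - gradedCurv 𝔒 1 A 0 B (V 1) (W 0) x + gradedCurv 𝔒 1 A 1 B (V 1) (W 1) x
    = 𝔒.gD 0 A (fun y => W 0 y - W 1 y) x - 𝔒.gD 1 A (fun y => W 0 y - W 1 y) x
      - gradedSign A B • (𝔒.gD 0 B (fun y => V 0 y - V 1 y) x
        - 𝔒.gD 1 B (fun y => V 0 y - V 1 y) x)
      + gradedComm A B (V 0 x - V 1 x) (W 0 x - W 1 x) := by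
  rw [𝔒.gD_sub (hW 0) (hW 1), 𝔒.gD_sub (hW 0) (hW 1), 𝔒.gD_sub (hV 0) (hV 1),
    𝔒.gD_sub (hV 0) (hV 1)]
  simp only [gradedCurv, gradedComm, sub_mul, mul_sub, smul_sub]
  abel

namespace FrameData

variable {𝔒 : OddDerivations R ι} {U : Set Spacetime} {H a : Spacetime → Spinor → R}
  {a₁ : Fin 2 ⊕ ι → Spacetime → Spinor → R}
  {a₂ : Fin 2 ⊕ ι → Fin 2 ⊕ ι → Spacetime → Spinor → R}

/-- The integral is π(Q_1(∞) - W_1), and both terms are known to be holomorphic in x. -/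
theorem integral_dress_holo (h : FrameData 𝔒 U H a a₁ a₂) (B : Fin 2 ⊕ ι) :
    DifferentiableOn ℂ (fun y => ∫ w, dress H (a₁ B) y (chart w)) U := by
  have h1 : DifferentiableOn ℂ
      (fun y => (Real.pi : ℂ) • (logD 𝔒 H 1 B y lamInfty - conn 𝔒 H 1 B y)) U :=
    (((h.holo_logD 1 B).holo _ lamInfty_ne_zero).sub (h.conn_holo 1 B)).const_smul _
  refine h1.congr fun y hy => ?_
  rw [h.integral_dress B hy, Complex.coe_smul]

/-- In an even direction, dominated convergence along a complex line through x gives the derivative.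
The integral is already differentiable in x, so this line derivative is its partial derivative. In
an odd direction a continuous linear map passes through the integral. -/
theorem gD_integral_dress (h : FrameData 𝔒 U H a a₁ a₂) (α : Fin 2) (A B : Fin 2 ⊕ ι)
    {x : Spacetime} (hx : x ∈ U) :
    Integrable (fun w => 𝔒.gD α A (fun y => dress H (a₁ B) y (chart w)) x) ∧
    𝔒.gD α A (fun y => ∫ w, dress H (a₁ B) y (chart w)) x
      = ∫ w, 𝔒.gD α A (fun y => dress H (a₁ B) y (chart w)) x := by
  have : CompleteSpace R := FiniteDimensional.complete ℂ R
  have hK := h.holo_dress (h.holo_a₁ B)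
  rcases A with α' | b
  · set e : Spacetime := Pi.single α (Pi.single α' 1) with he
    have hD := 𝔒.smoothHolo_gD h.isOpen hK α (Sum.inl α')
    obtain ⟨δ, hδ, C, hδU, hC⟩ := exists_homogeneous_bound h.isOpen
      (f := fun x lam => 𝔒.gD α (Sum.inl α') (fun y => dress H (a₁ B) y lam) x) 3
      hD.smooth.continuousOn (fun y hy b lam hb hl => by
        have h1 : 𝔒.gD α (Sum.inl α') (fun z => dress H (a₁ B) z (b • lam)) y
            = 𝔒.gD α (Sum.inl α')
              (fun z => (b * conj b ^ 2)⁻¹ • dress H (a₁ B) z lam) y := by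
          refine 𝔒.gD_congr ?_
          filter_upwards [h.isOpen.mem_nhds hy] with z hz
          exact h.smul_dress hz hb hl (h.smul_a₁ B z hz b lam hb hl)
        rw [h1, 𝔒.gD_const_smul (hK.differentiableAt h.isOpen hy hl), norm_smul,
          norm_weight]) hx
    have hline : ∀ t : ℂ, HasDerivAt (fun t : ℂ => x + t • e) e t := fun t => by
      simpa using ((hasDerivAt_id t).smul_const e).const_add x
    have hcont : Continuous (fun t : ℂ => x + t • e) := by fun_prop
    have hs : (fun t : ℂ => x + t • e) ⁻¹' Metric.ball x δ ∈ 𝓝 (0 : ℂ) :=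
      hcont.continuousAt.preimage_mem_nhds (Metric.isOpen_ball.mem_nhds (by simpa using hδ))
    have hder := hasDerivAt_integral_of_dominated_loc_of_deriv_le (μ := volume)
      (F := fun (t : ℂ) (w : ℂ) => dress H (a₁ B) (x + t • e) (chart w))
      (F' := fun (t : ℂ) (w : ℂ) =>
        𝔒.gD α (Sum.inl α') (fun y => dress H (a₁ B) y (chart w)) (x + t • e))
      (x₀ := 0) (bound := fun w => C * ((1 + ‖w‖) ^ 3)⁻¹) hs ?_ ?_ ?_ ?_
      (integrable_cube_decay.const_mul C) ?_
    · simp only [zero_smul, add_zero] at hder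
      refine ⟨hder.1, ?_⟩
      have hJ : HasDerivAt (fun t : ℂ => ∫ w, dress H (a₁ B) (x + t • e) (chart w))
          (fderiv ℂ (fun y => ∫ w, dress H (a₁ B) y (chart w)) x e) 0 := by
        refine HasFDerivAt.comp_hasDerivAt (f := fun t : ℂ => x + t • e)
          (l := fun y => ∫ w, dress H (a₁ B) y (chart w)) 0 ?_ (hline 0)
        rw [zero_smul, add_zero]
        exact ((h.integral_dress_holo B).differentiableAt (h.isOpen.mem_nhds hx)).hasFDerivAt
      exact hJ.unique hder.2
    · filter_upwards [hs] with t ht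
      exact (h.continuous_dress (h.holo_a₁ B) (hδU ht)).aestronglyMeasurable
    · simpa using h.integrable_dress B hx
    · simpa using ((hD.contDiff_chart h.isOpen hx).continuous.aestronglyMeasurable)
    · exact Eventually.of_forall fun w t ht => hC _ ht w
    · refine Eventually.of_forall fun w t ht => ?_
      exact HasFDerivAt.comp_hasDerivAt (f := fun t : ℂ => x + t • e)
        (l := fun y => dress H (a₁ B) y (chart w)) t
        (hK.differentiableAt h.isOpen (hδU ht) (chart_ne_zero w)).hasFDerivAt (hline t)
  · have hi := h.integrable_dress B hx
    exact ⟨(𝔒.δ α b).toContinuousLinearMap.integrable_comp hi,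
      ((𝔒.δ α b).toContinuousLinearMap.integral_comp_comm hi).symm⟩

theorem integrable_double (h : FrameData 𝔒 U H a a₁ a₂) (A B : Fin 2 ⊕ ι) {x : Spacetime}
    (hx : x ∈ U) : LineIntegrable₂ (fun lam₁ lam₂ => (angle lam₁ lam₂)⁻¹ •
      gradedComm A B (dress H (a₁ A) x lam₁) (dress H (a₁ B) x lam₂)) := by
  obtain ⟨C, hC⟩ := h.exists_bound A hx
  obtain ⟨C', hC'⟩ := h.exists_bound B hx
  have h1 := integrable_prod_inv_sub_smul (F := fun p : ℂ × ℂ =>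
    gradedCommCLM A B (dress H (a₁ A) x (chart p.1)) (dress H (a₁ B) x (chart p.2)))
    (C := ‖gradedCommCLM (R := R) A B‖ * C * C') ?_ ?_
  · refine h1.congr (Eventually.of_forall fun p => ?_)
    simp only [angle_chart_chart, gradedCommCLM_apply]
  · exact ((gradedCommCLM A B).continuous.comp ((h.continuous_dress (h.holo_a₁ A) hx).comp
      continuous_fst)).clm_apply ((h.continuous_dress (h.holo_a₁ B) hx).comp continuous_snd)
  · intro p
    refine ((gradedCommCLM A B).le_opNorm₂ _ _).trans ?_
    calc ‖gradedCommCLM (R := R) A B‖ * ‖dress H (a₁ A) x (chart p.1)‖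
          * ‖dress H (a₁ B) x (chart p.2)‖
        ≤ ‖gradedCommCLM (R := R) A B‖ * (C * ((1 + ‖p.1‖) ^ 3)⁻¹)
          * (C' * ((1 + ‖p.2‖) ^ 3)⁻¹) := by
          gcongr
          · have := (norm_nonneg _).trans (hC p.1); positivity
          · exact hC p.1
          · exact hC' p.2
      _ = _ := by ring

/-- By Fubini the integral over λ₁ is done first; it acts on the first argument of the commutator
only and is a Cauchy-Pompeiu integral. -/
theorem integral_double (h : FrameData 𝔒 U H a a₁ a₂) (A B : Fin 2 ⊕ ι) {x : Spacetime}
    (hx : x ∈ U) :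
    ∫ p : ℂ × ℂ, (angle (chart p.1) (chart p.2))⁻¹ •
        gradedComm A B (dress H (a₁ A) x (chart p.1)) (dress H (a₁ B) x (chart p.2))
      = ∫ w, gradedComm A B
        ((Real.pi : ℂ) • (logD 𝔒 H 0 A x lamInfty - logD 𝔒 H 0 A x (chart w)))
          (dress H (a₁ B) x (chart w)) := by
  have : CompleteSpace R := FiniteDimensional.complete ℂ R
  obtain ⟨C, hC⟩ := h.exists_bound A hx
  have hi := h.integrable_double A B hx
  unfold LineIntegrable₂ at hi
  rw [Measure.volume_eq_prod] at hi ⊢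
  rw [integral_prod_symm _ hi]
  refine integral_congr_ae (Eventually.of_forall fun w => ?_)
  have h1 := integrable_inv_sub_smul (h.continuous_dress (h.holo_a₁ A) hx) hC w
  have h2 := ((gradedCommCLM A B).flip (dress H (a₁ B) x (chart w))).integral_comp_comm h1
  rw [h.integral_inv_sub_smul_dress A hx w] at h2
  simp only [ContinuousLinearMap.flip_apply, map_smul, gradedCommCLM_apply] at h2
  simp only [angle_chart_chart, Complex.coe_smul]
  exact h2

/-- The integral formula for the curvature. -/
noncomputable def curvFormula (H : Spacetime → Spinor → R)
    (a₁ : Fin 2 ⊕ ι → Spacetime → Spinor → R)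
    (a₂ : Fin 2 ⊕ ι → Fin 2 ⊕ ι → Spacetime → Spinor → R) (A B : Fin 2 ⊕ ι) (x : Spacetime) :
    R :=
  (2 * Real.pi * Complex.I)⁻¹ • lineIntegral (dress H (a₂ A B) x)
    - ((2 * Real.pi * Complex.I) ^ 2)⁻¹ • lineIntegral₂ (fun lam₁ lam₂ => (angle lam₁ lam₂)⁻¹ •
      gradedComm A B (dress H (a₁ A) x lam₁) (dress H (a₁ B) x lam₂))

/-- The components W_0 = Q_0(∞) and W_1 = Q_1(∞) - π⁻¹ J, with J the integral of K, differ from a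
flat connection only by J. The curvature is therefore -π⁻¹ times the covariant derivative of J along
Q_0(∞). -/
theorem gradedCurv_zero_one (h : FrameData 𝔒 U H a a₁ a₂) (A B : Fin 2 ⊕ ι) {x : Spacetime}
    (hx : x ∈ U) :
    gradedCurv 𝔒 0 A 1 B (conn 𝔒 H 0 A) (conn 𝔒 H 1 B) x = curvFormula H a₁ a₂ A B x := by
  have : CompleteSpace R := FiniteDimensional.complete ℂ R
  have hpi : (Real.pi : ℂ) ≠ 0 := by exact_mod_cast Real.pi_ne_zero
  set J : Spacetime → R := fun y => ∫ w, dress H (a₁ B) y (chart w) with hJ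
  set q := logD 𝔒 H 0 A x lamInfty with hq
  have hJd : DifferentiableAt ℂ J x :=
    (h.integral_dress_holo B).differentiableAt (h.isOpen.mem_nhds hx)
  have hJd' : DifferentiableAt ℂ (fun y => (Real.pi : ℂ)⁻¹ • J y) x := hJd.const_smul _
  have hqd := (h.holo_logD 1 B).differentiableAt h.isOpen hx lamInfty_ne_zero
  have hc1 : ∀ y ∈ U, conn 𝔒 H 1 B y = logD 𝔒 H 1 B y lamInfty - (Real.pi : ℂ)⁻¹ • J y := by
    intro y hy
    rw [hJ]
    simp only
    rw [h.integral_dress B hy, ← Complex.coe_smul, smul_smul, inv_mul_cancel₀ hpi, one_smul]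
    abel
  have hflat := h.gradedCurv_logD 0 A 1 B hx lamInfty_ne_zero
  have h1 : gradedCurv 𝔒 0 A 1 B (conn 𝔒 H 0 A) (conn 𝔒 H 1 B) x
      = -(Real.pi : ℂ)⁻¹ • (𝔒.gD 0 A J x + gradedComm A B q (J x)) := by
    rw [gradedCurv_congr 𝔒 (V := conn 𝔒 H 0 A) (V' := fun y => logD 𝔒 H 0 A y lamInfty)
      (Eventually.of_forall fun _ => rfl) (by filter_upwards [h.isOpen.mem_nhds hx] with y hy using hc1 y hy)]
    have h2 : gradedComm A B q (logD 𝔒 H 1 B x lamInfty - (Real.pi : ℂ)⁻¹ • J x)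
        = gradedComm A B q (logD 𝔒 H 1 B x lamInfty)
          - (Real.pi : ℂ)⁻¹ • gradedComm A B q (J x) := by
      simp only [← gradedCommCLM_apply, map_sub, map_smul]
    rw [gradedCurv] at hflat ⊢
    rw [𝔒.gD_sub hqd hJd', ← hq, h2, 𝔒.gD_const_smul hJd]
    rw [← hq] at hflat
    linear_combination (norm := module) hflat
  have hSi := h.integrable_dress₂ A B hx
  obtain ⟨hDi, hD⟩ := h.gD_integral_dress 0 A B hx
  have hDK : ∀ w : ℂ, 𝔒.gD 0 A (fun y => dress H (a₁ B) y (chart w)) x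
      = dress H (a₂ A B) x (chart w)
        - gradedComm A B (logD 𝔒 H 0 A x (chart w)) (dress H (a₁ B) x (chart w)) := by
    intro w
    rw [h.gD_dress 0 A B hx (chart_ne_zero w)]
    simp [chart]
  have hGi : Integrable (fun w =>
      gradedComm A B q (dress H (a₁ B) x (chart w))) := by
    simp only [← gradedCommCLM_apply]
    exact (gradedCommCLM A B q).integrable_comp (h.integrable_dress B hx)
  have hDGi : Integrable (fun w => 𝔒.gD 0 A (fun y => dress H (a₁ B) y (chart w)) x
      + gradedComm A B q (dress H (a₁ B) x (chart w))) := hDi.add hGi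
  have hG : gradedComm A B q (J x) = ∫ w, gradedComm A B q (dress H (a₁ B) x (chart w)) := by
    simp only [← gradedCommCLM_apply]
    exact ((gradedCommCLM A B q).integral_comp_comm (h.integrable_dress B hx)).symm
  -- On the chart λ_0 = 1, so the integrand is the dressed second derivative plus the commutator of
  -- Q_0(∞) - Q_0(w) with K_B; `integral_double` identifies the integral of the latter.
  have hsum : 𝔒.gD 0 A J x + gradedComm A B q (J x)
      = (∫ w, dress H (a₂ A B) x (chart w)) + (Real.pi : ℂ)⁻¹ •
        ∫ p : ℂ × ℂ, (angle (chart p.1) (chart p.2))⁻¹ •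
          gradedComm A B (dress H (a₁ A) x (chart p.1)) (dress H (a₁ B) x (chart p.2)) := by
    rw [hD, hG, ← integral_add hDi hGi, h.integral_double A B hx, ← integral_smul,
      ← sub_eq_iff_eq_add', ← integral_sub hDGi hSi]
    refine integral_congr_ae (Eventually.of_forall fun w => ?_)
    simp only [hDK]
    simp only [← gradedCommCLM_apply, map_sub, map_smul, _root_.smul_apply, _root_.sub_apply]
    rw [smul_smul, inv_mul_cancel₀ hpi, one_smul]
    abel
  rw [h1, hsum, curvFormula, lineIntegral, lineIntegral₂, smul_smul, smul_smul, smul_add,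
    smul_smul, sub_eq_add_neg, ← neg_smul]
  congr 2
  · field_simp
  · field_simp

/-- The equal-index components are curvatures of the flat connection at the points (0, 1) and (1,
0). A third point, (1, 1), then forces the mixed components to be opposite. -/
theorem gradedCurv_conn (h : FrameData 𝔒 U H a a₁ a₂) (α β : Fin 2) (A B : Fin 2 ⊕ ι)
    {x : Spacetime} (hx : x ∈ U) :
    gradedCurv 𝔒 α A β B (conn 𝔒 H α A) (conn 𝔒 H β B) x
      = eps α β • curvFormula H a₁ a₂ A B x := by
  have hd : ∀ (α : Fin 2) (A : Fin 2 ⊕ ι), DifferentiableAt ℂ (conn 𝔒 H α A) x := fun α A =>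
    (h.conn_holo α A).differentiableAt (h.isOpen.mem_nhds hx)
  have h00 : gradedCurv 𝔒 0 A 0 B (conn 𝔒 H 0 A) (conn 𝔒 H 0 B) x = 0 :=
    h.gradedCurv_logD 0 A 0 B hx lamInfty_ne_zero
  have h11 : gradedCurv 𝔒 1 A 1 B (conn 𝔒 H 1 A) (conn 𝔒 H 1 B) x = 0 :=
    h.gradedCurv_logD 1 A 1 B hx (chart_ne_zero 0)
  have h01 := h.gradedCurv_zero_one A B hx
  have h10 : gradedCurv 𝔒 1 A 0 B (conn 𝔒 H 1 A) (conn 𝔒 H 0 B) x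
      = -gradedCurv 𝔒 0 A 1 B (conn 𝔒 H 0 A) (conn 𝔒 H 1 B) x := by
    -- At λ = (1, 1) the raised spinor is (1, -1), and W_0 - W_1 = Q_0 - Q_1 there. The contracted
    -- curvature depends on these differences alone, so it equals that of the flat connection.
    have e1 := gradedCurv_symm_part 𝔒 (A := A) (B := B) (V := fun α => conn 𝔒 H α A)
      (W := fun α => conn 𝔒 H α B) (fun α => hd α A) (fun α => hd α B)
    have e2 := gradedCurv_symm_part 𝔒 (A := A) (B := B)
      (V := fun α y => logD 𝔒 H α A y (chart 1)) (W := fun α y => logD 𝔒 H α B y (chart 1))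
      (fun α => (h.holo_logD α A).differentiableAt h.isOpen hx (chart_ne_zero 1))
      (fun α => (h.holo_logD α B).differentiableAt h.isOpen hx (chart_ne_zero 1))
    have hdiff : ∀ A : Fin 2 ⊕ ι, (fun y => conn 𝔒 H 0 A y - conn 𝔒 H 1 A y)
        =ᶠ[𝓝 x] fun y => logD 𝔒 H 0 A y (chart 1) - logD 𝔒 H 1 A y (chart 1) := fun A => by
      filter_upwards [h.isOpen.mem_nhds hx] with y hy
      simpa using (h.logD_chart A hy 1).symm
    simp only [h.gradedCurv_logD _ _ _ _ hx (chart_ne_zero 1), sub_zero, add_zero] at e2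
    rw [𝔒.gD_congr (hdiff A), 𝔒.gD_congr (hdiff A), 𝔒.gD_congr (hdiff B),
      𝔒.gD_congr (hdiff B), (hdiff A).eq_of_nhds, (hdiff B).eq_of_nhds, ← e2, h00, h11,
      zero_sub, add_zero, sub_eq_zero] at e1
    exact e1.symm
  fin_cases α <;> fin_cases β
  · simpa [eps] using h00
  · simpa [eps] using h01
  · simpa [eps] using h10.trans (congrArg Neg.neg h01)
  · simpa [eps] using h11

/-- The curvature of a potential of a frame. -/
theorem curvature_potential (h : FrameData 𝔒 U H a a₁ a₂) {V : Spacetime → Fin 2 → Fin 2 ⊕ ι → R}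
    (hV : ∀ x ∈ U, ∀ α B, V x α B = Complex.I • conn 𝔒 H α B x) (α β : Fin 2)
    (A B : Fin 2 ⊕ ι) {x : Spacetime} (hx : x ∈ U) :
    -Complex.I • (𝔒.gD α A (fun y => V y β B) x
        - gradedSign A B • 𝔒.gD β B (fun y => V y α A) x)
      - gradedComm A B (V x α A) (V x β B) = eps α β • curvFormula H a₁ a₂ A B x := by
  have hd : ∀ (α : Fin 2) (A : Fin 2 ⊕ ι), DifferentiableAt ℂ (conn 𝔒 H α A) x := fun α A =>
    (h.conn_holo α A).differentiableAt (h.isOpen.mem_nhds hx)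
  have he : ∀ (α : Fin 2) (A : Fin 2 ⊕ ι),
      (fun y => V y α A) =ᶠ[𝓝 x] fun y => Complex.I • conn 𝔒 H α A y := fun α A => by
    filter_upwards [h.isOpen.mem_nhds hx] with y hy using hV y hy α A
  rw [← h.gradedCurv_conn α β A B hx, gradedCurv, 𝔒.gD_congr (he β B), 𝔒.gD_congr (he α A),
    𝔒.gD_const_smul (hd β B), 𝔒.gD_const_smul (hd α A), hV x hx, hV x hx]
  simp only [← gradedCommCLM_apply, map_smul, _root_.smul_apply, smul_smul, smul_sub]
  have hI : Complex.I * Complex.I = -1 := Complex.I_mul_I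
  rw [hI]
  match_scalars
  · linear_combination -hI
  · linear_combination gradedSign A B * hI
  · ring

theorem potential_holo (h : FrameData 𝔒 U H a a₁ a₂) {V : Spacetime → Fin 2 → Fin 2 ⊕ ι → R}
    (hV : ∀ x ∈ U, ∀ α B, V x α B = Complex.I • conn 𝔒 H α B x) (α : Fin 2) (A : Fin 2 ⊕ ι) :
    DifferentiableOn ℂ (fun x => V x α A) U :=
  ((h.conn_holo α A).const_smul Complex.I).congr fun x hx => hV x hx α A

end FrameData

end Curvature

/-! ### Left derivatives, parity and substitutions in Grassmann algebras -/

section GrassmannCalculus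

variable {κ κ' : Type}

theorem Grassmann.induction {P : Grassmann κ → Prop} (algebraMap : ∀ c : ℂ, P (algebraMap ℂ _ c))
    (add : ∀ m n, P m → P n → P (m + n))
    (ι_mul : ∀ (v : κ → ℂ) (m : Grassmann κ), P m → P (ExteriorAlgebra.ι ℂ v * m))
    (m : Grassmann κ) : P m :=
  CliffordAlgebra.left_induction (0 : QuadraticForm ℂ (κ → ℂ)) algebraMap add
    (fun m v hm => ι_mul v m hm) m

/-- The left derivative along a covector. -/
noncomputable def leftDeriv (d : Module.Dual ℂ (κ → ℂ)) : Grassmann κ →ₗ[ℂ] Grassmann κ :=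
  CliffordAlgebra.contractLeft d

theorem leftDeriv_ι_mul (d : Module.Dual ℂ (κ → ℂ)) (v : κ → ℂ) (m : Grassmann κ) :
    leftDeriv d (ExteriorAlgebra.ι ℂ v * m)
      = d v • m - ExteriorAlgebra.ι ℂ v * leftDeriv d m :=
  CliffordAlgebra.contractLeft_ι_mul d v m

theorem leftDeriv_algebraMap (d : Module.Dual ℂ (κ → ℂ)) (c : ℂ) :
    leftDeriv d (algebraMap ℂ (Grassmann κ) c) = 0 :=
  CliffordAlgebra.contractLeft_algebraMap _ _ _

theorem leftDeriv_comm (d d' : Module.Dual ℂ (κ → ℂ)) (m : Grassmann κ) :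
    leftDeriv d (leftDeriv d' m) = -leftDeriv d' (leftDeriv d m) :=
  CliffordAlgebra.contractLeft_comm _ _ _

/-- The parity automorphism of the Grassmann algebra. -/
noncomputable def gInvol : Grassmann κ →ₐ[ℂ] Grassmann κ := CliffordAlgebra.involute

theorem gInvol_ι (v : κ → ℂ) :
    gInvol (ExteriorAlgebra.ι ℂ v : Grassmann κ) = -ExteriorAlgebra.ι ℂ v :=
  CliffordAlgebra.involute_ι v

theorem gInvol_eq_of_isEven {m : Grassmann κ} (h : IsEven m) : gInvol m = m :=
  CliffordAlgebra.involute_eq_of_mem_even h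

theorem leftDeriv_mul (d : Module.Dual ℂ (κ → ℂ)) (m n : Grassmann κ) :
    leftDeriv d (m * n) = leftDeriv d m * n + gInvol m * leftDeriv d n := by
  induction m using Grassmann.induction with
  | algebraMap c =>
    rw [leftDeriv_algebraMap, AlgHom.commutes, zero_mul, zero_add, ← Algebra.smul_def, map_smul,
      ← Algebra.smul_def]
  | add m m' h h' => simp only [add_mul, map_add, h, h']; abel
  | ι_mul v m h =>
    rw [mul_assoc, leftDeriv_ι_mul, leftDeriv_ι_mul, h, map_mul, gInvol_ι]
    simp only [sub_mul, mul_add, mul_assoc, smul_mul_assoc, neg_mul]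
    abel

theorem gInvol_leftDeriv (d : Module.Dual ℂ (κ → ℂ)) (m : Grassmann κ) :
    gInvol (leftDeriv d m) = -leftDeriv d (gInvol m) := by
  induction m using Grassmann.induction with
  | algebraMap c => simp [leftDeriv_algebraMap, AlgHom.commutes]
  | add m m' h h' => simp only [map_add, h, h']; abel
  | ι_mul v m h =>
    rw [leftDeriv_ι_mul, map_sub, map_smul, map_mul, h, map_mul, gInvol_ι, neg_mul_neg, neg_mul,
      map_neg, leftDeriv_ι_mul, neg_neg]

/-- This is the chain rule for a linear substitution. It serves χ = θλ with c = λ_α, and χ ↦ bχ with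
c = b. -/
theorem leftDeriv_map (L : (κ → ℂ) →ₗ[ℂ] (κ' → ℂ)) {d : Module.Dual ℂ (κ' → ℂ)}
    {d' : Module.Dual ℂ (κ → ℂ)} {c : ℂ} (hd : ∀ v, d (L v) = c * d' v) (m : Grassmann κ) :
    leftDeriv d (ExteriorAlgebra.map L m) = c • ExteriorAlgebra.map L (leftDeriv d' m) := by
  induction m using Grassmann.induction with
  | algebraMap r => simp [leftDeriv_algebraMap, AlgHom.commutes]
  | add m m' h h' => simp only [map_add, h, h', smul_add]
  | ι_mul v m h =>
    rw [map_mul, ExteriorAlgebra.map_apply_ι, leftDeriv_ι_mul, leftDeriv_ι_mul, map_sub, map_smul,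
      map_mul, ExteriorAlgebra.map_apply_ι, h, hd, smul_sub, mul_smul_comm, smul_smul]

theorem gInvol_map (L : (κ → ℂ) →ₗ[ℂ] (κ' → ℂ)) (m : Grassmann κ) :
    gInvol (ExteriorAlgebra.map L m) = ExteriorAlgebra.map L (gInvol m) := by
  induction m using Grassmann.induction with
  | algebraMap r => simp [AlgHom.commutes]
  | add m m' h h' => simp only [map_add, h, h']
  | ι_mul v m h =>
    simp only [map_mul, ExteriorAlgebra.map_apply_ι, gInvol_ι, h, map_neg]

theorem oddDeriv_chiToTheta (N : ℕ) (lam : Spinor) (α : Fin 2) (a : Fin 4)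
    (m : Grassmann (ChiGen N)) :
    oddDeriv (Sum.inl (α, a)) (chiToTheta N lam m)
      = lam α • chiToTheta N lam (oddDeriv (Sum.inl a) m) :=
  leftDeriv_map _ (by intro v; simp) m

theorem oddDeriv_scaleChi (N : ℕ) (b : ℂ) (a : Fin 4) (m : Grassmann (ChiGen N)) :
    oddDeriv (Sum.inl a) (scaleChi N b m) = b • scaleChi N b (oddDeriv (Sum.inl a) m) :=
  leftDeriv_map _ (by intro v; simp) m

/-- Rescaling λ in χ = θλ amounts to rescaling χ, which lets homogeneity on super-twistor space
descend to the line. -/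
theorem chiToTheta_smul (N : ℕ) (b : ℂ) (lam : Spinor) (m : Grassmann (ChiGen N)) :
    chiToTheta N (b • lam) m = chiToTheta N lam (scaleChi N b m) := by
  unfold chiToTheta scaleChi
  rw [← AlgHom.comp_apply, ExteriorAlgebra.map_comp_map]
  congr 2
  ext v k
  rcases k with ⟨α, a⟩ | k
  · simp; ring
  · simp

noncomputable instance Grassmann.normedAddRing (κ : Type) [Fintype κ] : NormedAddRing (Grassmann κ) :=
  { Grassmann.normedAddCommGroup κ, (inferInstance : Ring (Grassmann κ)) with }

instance Grassmann.finiteDimensional (κ : Type) [Fintype κ] :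
    FiniteDimensional ℂ (Grassmann κ) :=
  Module.Finite.of_basis (Grassmann.basis κ)

noncomputable instance Gl.normedAddRing (r : ℕ) : NormedAddRing (Gl r) :=
  { (inferInstance : NormedAddCommGroup (Gl r)), (inferInstance : Ring (Gl r)) with }

noncomputable instance SGl.normedAddRing (r : ℕ) (κ : Type) [Fintype κ] : NormedAddRing (SGl r κ) :=
  { (inferInstance : NormedAddCommGroup (SGl r κ)), (inferInstance : Ring (SGl r κ)) with }

/-- The image of a fixed element is polynomial in λ. Expanding a variable element in the finite
basis then gives joint smoothness in `contDiff_chiToTheta`. -/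
theorem contDiff_chiToTheta_left (N : ℕ) (m : Grassmann (ChiGen N)) :
    ContDiff ℂ ∞ (fun lam : Spinor => chiToTheta N lam m) := by
  induction m using Grassmann.induction with
  | algebraMap r => simpa [AlgHom.commutes] using contDiff_const
  | add m m' h h' => simpa only [map_add] using h.add h'
  | ι_mul v m h =>
    simp only [map_mul]
    refine isBoundedBilinearMap_mul'.contDiff.comp (ContDiff.prodMk ?_ h)
    unfold chiToTheta
    simp only [ExteriorAlgebra.map_apply_ι]
    refine (LinearMap.toContinuousLinearMap
      (ExteriorAlgebra.ι ℂ : (ThetaGen N → ℂ) →ₗ[ℂ] Grassmann (ThetaGen N))).contDiff.comp ?_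
    rw [contDiff_pi]
    rintro (⟨α, a⟩ | k)
    · simp only [LinearMap.pi_apply, Sum.elim_inl, LinearMap.smul_apply, LinearMap.proj_apply,
        smul_eq_mul]
      fun_prop
    · simp only [LinearMap.pi_apply, Sum.elim_inr, LinearMap.proj_apply]
      fun_prop

theorem contDiff_chiToTheta (N : ℕ) :
    ContDiff ℂ ∞ (fun p : Spinor × Grassmann (ChiGen N) => chiToTheta N p.1 p.2) := by
  let c : Finset (Fin (Fintype.card (ChiGen N))) → Grassmann (ChiGen N) →L[ℂ] ℂ := fun i =>
    LinearMap.toContinuousLinearMap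
      (LinearMap.proj i ∘ₗ (Grassmann.basis (ChiGen N)).equivFun.toLinearMap)
  have h : ∀ p : Spinor × Grassmann (ChiGen N), chiToTheta N p.1 p.2
      = ∑ i, c i p.2 • chiToTheta N p.1 (Grassmann.basis (ChiGen N) i) := fun p => by
    conv_lhs => rw [← (Grassmann.basis (ChiGen N)).sum_equivFun p.2]
    rw [map_sum]
    simp only [map_smul]
    rfl
  simp only [h]
  refine ContDiff.sum fun i _ => ?_
  exact ((c i).contDiff.comp contDiff_snd).smul
    ((contDiff_chiToTheta_left N _).comp contDiff_fst)

end GrassmannCalculus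

/-! ### Functions on twistor space restricted to lines -/

section TwistorFunctions

variable {E : Type*} [NormedAddCommGroup E] [NormedSpace ℂ E]
  {E' : Type*} [NormedAddCommGroup E'] [NormedSpace ℂ E']

theorem smoothHolo_incidence (U : Set Spacetime) : SmoothHolo U incidence where
  smooth := by
    refine ContDiff.contDiffOn ?_
    unfold incidence
    fun_prop
  holo lam _ := by
    refine Differentiable.differentiableOn ?_
    unfold incidence
    fun_prop

theorem contDiff_bar : ContDiff ℝ ∞ bar := by
  rw [contDiff_pi]
  exact fun i => Complex.conjCLE.contDiff.comp (contDiff_apply ℝ ℂ i)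

theorem smoothHolo_sum_mul_bar :
    SmoothHolo (univ : Set Spinor) (fun μ lam => ∑ α', μ α' * bar lam α') where
  smooth := by
    refine ContDiff.contDiffOn ?_
    have := contDiff_bar
    have h : ∀ i, ContDiff ℝ ∞ (fun p : Spinor × Spinor => bar p.2 i) := fun i =>
      (contDiff_pi.1 contDiff_bar i).comp contDiff_snd
    exact ContDiff.sum fun i _ => (by fun_prop : ContDiff ℝ ∞ fun p : Spinor × Spinor =>
      p.1 i).mul (h i)
  holo lam _ := by fun_prop

theorem incidence_smul (x : Spacetime) (b : ℂ) (lam : Spinor) :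
    incidence x (b • lam) = b • incidence x lam := by
  funext i
  simp [incidence]
  ring

/-- The chain rule for the restriction of a function on twistor space to a line. -/
theorem dX_comp_incidence (T : E →L[ℂ] E') {f : Spinor → Spinor → E} {lam : Spinor}
    (hf : Differentiable ℂ (fun μ => f μ lam)) (α α' : Fin 2) (x : Spacetime) :
    dX α α' (fun y => T (f (incidence y lam) lam)) x
      = lam α • T (dMu α' f (incidence x lam) lam) := by
  let L : Spacetime →ₗ[ℂ] Spinor :=
    { toFun := fun y => incidence y lam
      map_add' := fun y z => by funext i; simp [incidence]; ring
      map_smul' := fun c y => by funext i; simp [incidence]; ring }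
  have hL : HasFDerivAt (fun y => incidence y lam) L.toContinuousLinearMap x :=
    L.toContinuousLinearMap.hasFDerivAt
  have h := (T.hasFDerivAt.comp x ((hf (incidence x lam)).hasFDerivAt.comp x hL)).fderiv
  have h' : fderiv ℂ (fun y => T (f (incidence y lam) lam)) x = _ := h
  have hv : L (Pi.single α (Pi.single α' 1)) = lam α • (Pi.single α' 1 : Spinor) := by
    funext i
    fin_cases α <;> simp [L, incidence, Fin.sum_univ_two, Pi.single_apply]
  have hv' : L.toContinuousLinearMap (Pi.single α (Pi.single α' 1))
      = lam α • (Pi.single α' 1 : Spinor) := hv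
  rw [dX, h', ContinuousLinearMap.comp_apply, ContinuousLinearMap.comp_apply, hv', map_smul,
    map_smul]
  rfl

/-- Differentiating the homogeneity relation in μ produces one factor `b` from the chain rule. The
map `T` leaves room for the substitution χ ↦ bχ, and is the identity in the pure theory. -/
theorem dMu_smul (T : E →L[ℂ] E) {f : Spinor → Spinor → E} {b c : ℂ} {lam : Spinor}
    (hb : b ≠ 0) (hf : Differentiable ℂ (fun μ => f μ lam))
    (hf' : Differentiable ℂ (fun μ => f μ (b • lam)))
    (h : ∀ μ, T (f (b • μ) (b • lam)) = c • f μ lam) (α' : Fin 2) (μ : Spinor) :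
    T (dMu α' f (b • μ) (b • lam)) = (b⁻¹ * c) • dMu α' f μ lam := by
  have h1 : HasFDerivAt (fun ν => T (f (b • ν) (b • lam))) _ μ :=
    T.hasFDerivAt.comp μ (HasFDerivAt.comp (g := fun ν => f ν (b • lam)) μ
      (hf' (b • μ)).hasFDerivAt ((hasFDerivAt_id (𝕜 := ℂ) μ).const_smul b))
  have h2 : HasFDerivAt (fun ν => T (f (b • ν) (b • lam))) (c • fderiv ℂ (fun ν => f ν lam) μ)
      μ := by
    rw [funext h]
    exact (hf μ).hasFDerivAt.const_smul c
  have h3 := congrArg (fun S => S (Pi.single α' 1)) (h1.unique h2)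
  simp only [ContinuousLinearMap.comp_apply, _root_.smul_apply, ContinuousLinearMap.id_apply,
    map_smul] at h3
  rw [mul_smul, eq_inv_smul_iff₀ hb]
  exact h3

theorem SmoothHolo.comp_contDiff {X : Type*} [NormedAddCommGroup X] [NormedSpace ℂ X] {U : Set X}
    {F : X → Spinor → E} (hF : SmoothHolo U F) {T : Spinor → E → E'}
    (hT : ContDiff ℂ ∞ (fun p : Spinor × E => T p.1 p.2)) :
    SmoothHolo U (fun x lam => T lam (F x lam)) where
  smooth := (hT.restrict_scalars ℝ).comp_contDiffOn (contDiffOn_snd.prodMk hF.smooth)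
  holo lam hl := Differentiable.comp_differentiableOn (g := T lam)
    ((hT.differentiable (by simp)).comp ((differentiable_const lam).prodMk differentiable_id))
    (hF.holo lam hl)

theorem contDiff_matrix_map {D : Type*} [NormedAddCommGroup D] [NormedSpace ℂ D] {r : ℕ}
    {T : D → E → E'} (hT : ContDiff ℂ ∞ (fun p : D × E => T p.1 p.2)) :
    ContDiff ℂ ∞ (fun p : D × Matrix (Fin r) (Fin r) E => p.2.map (T p.1)) := by
  have h : ∀ i j, ContDiff ℂ ∞ (fun p : D × Matrix (Fin r) (Fin r) E => p.2 i j) := fun i j =>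
    (contDiff_apply_apply ℂ E i j).comp contDiff_snd
  exact contDiff_pi.2 fun i => contDiff_pi.2 fun j => hT.comp (contDiff_fst.prodMk (h i j))

end TwistorFunctions

/-! ### The super-twistor connection as frame data -/

section SuperTwistor

variable {r N : ℕ}

/-- The application of a linear map to the entries of a matrix. -/
noncomputable def entrywise (r : ℕ) {κ κ' : Type} [Fintype κ] [Fintype κ']
    (T : Grassmann κ →ₗ[ℂ] Grassmann κ') : SGl r κ →L[ℂ] SGl r κ' :=
  LinearMap.toContinuousLinearMap (T.mapMatrix : SGl r κ →ₗ[ℂ] SGl r κ')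

theorem contDiff_map_chiToTheta :
    ContDiff ℂ ∞ (fun p : Spinor × SGl r (ChiGen N) => p.2.map (chiToTheta N p.1)) :=
  contDiff_matrix_map (T := fun lam m => chiToTheta N lam m) (contDiff_chiToTheta N)

theorem smoothHolo_onLine {f : Spinor → Spinor → SGl r (ChiGen N)} (hf : SmoothHolo univ f)
    (U : Set Spacetime) : SmoothHolo U (onLine f) :=
  (hf.comp (smoothHolo_incidence U) (fun _ _ _ _ => mem_univ _)).comp_contDiff
    (T := fun lam M => M.map (chiToTheta N lam)) contDiff_map_chiToTheta

theorem SmoothHolo.sdMu {f : Spinor → Spinor → SGl r (ChiGen N)} (hf : SmoothHolo univ f)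
    (A : SIndex) : SmoothHolo univ (sdMu A f) := by
  rcases A with α' | a
  · exact hf.fderiv_apply isOpen_univ _
  · exact hf.clm_comp (entrywise r (oddDeriv (Sum.inl a)))

theorem smoothHolo_twistor (𝒜 : SuperRadiativeData r N) :
    SmoothHolo univ 𝒜.twistor :=
  SmoothHolo.comp (G := 𝒜.val) ⟨𝒜.smooth.mono fun _ hp => hp.2, fun lam hl =>
    (𝒜.holomorphic lam hl).differentiableOn⟩ smoothHolo_sum_mul_bar fun _ _ _ _ => mem_univ _

/-- Homogeneity of bidegree `(-k, -2)` on super-twistor space. -/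
def SuperHomogeneous (k : ℕ) (f : Spinor → Spinor → SGl r (ChiGen N)) : Prop :=
  ∀ (b : ℂ) (μ lam : Spinor), b ≠ 0 → lam ≠ 0 →
    (f (b • μ) (b • lam)).map (scaleChi N b) = (b ^ k * conj b ^ 2)⁻¹ • f μ lam

theorem superHomogeneous_twistor (𝒜 : SuperRadiativeData r N) :
    SuperHomogeneous 0 𝒜.twistor := by
  intro b μ lam hb hl
  have h := 𝒜.homogeneous b (∑ α', μ α' * bar lam α') lam hb hl
  have h1 : ∑ α', (b • μ) α' * bar (b • lam) α' = b * conj b * ∑ α', μ α' * bar lam α' := by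
    simp only [bar, Pi.smul_apply, smul_eq_mul, map_mul, Finset.mul_sum]
    exact Finset.sum_congr rfl fun _ _ => by ring
  rw [SuperRadiativeData.twistor, h1, h, pow_zero, one_mul]
  rfl

theorem SmoothHolo.differentiable_left {E : Type*} [NormedAddCommGroup E] [NormedSpace ℂ E]
    {f : Spinor → Spinor → E} (hf : SmoothHolo univ f) {lam : Spinor}
    (hl : lam ≠ 0) : Differentiable ℂ (fun μ => f μ lam) :=
  differentiableOn_univ.1 (hf.holo lam hl)

/-- Both μ and χ have weight one in λ, so every derivative ∂_A lowers the weight by one. -/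
theorem SuperHomogeneous.sdMu {k : ℕ} {f : Spinor → Spinor → SGl r (ChiGen N)}
    (hf : SmoothHolo univ f) (hh : SuperHomogeneous k f) (A : SIndex) :
    SuperHomogeneous (k + 1) (sdMu A f) := by
  intro b μ lam hb hl
  have hw : (b ^ (k + 1) * conj b ^ 2)⁻¹ = b⁻¹ * (b ^ k * conj b ^ 2)⁻¹ := by
    rw [← mul_inv, pow_succ']; ring
  rw [hw]
  rcases A with α' | a
  · exact dMu_smul (entrywise r (scaleChi N b).toLinearMap) hb (hf.differentiable_left hl)
      (hf.differentiable_left (smul_ne_zero hb hl)) (fun μ => hh b μ lam hb hl) α' μ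
  · rw [mul_smul, eq_inv_smul_iff₀ hb]
    have h := congrArg (fun M : SGl r (ChiGen N) => M.map (oddDeriv (Sum.inl a)))
      (hh b μ lam hb hl)
    refine Eq.trans ?_ (h.trans ?_)
    · ext i j
      exact (oddDeriv_scaleChi N b a _).symm
    · ext i j
      exact map_smul (oddDeriv (Sum.inl a)) _ _

theorem SuperHomogeneous.onLine {k : ℕ} {f : Spinor → Spinor → SGl r (ChiGen N)}
    (hh : SuperHomogeneous k f) (x : Spacetime) {b : ℂ} {lam : Spinor} (hb : b ≠ 0)
    (hl : lam ≠ 0) : onLine f x (b • lam) = (b ^ k * conj b ^ 2)⁻¹ • onLine f x lam := by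
  have h := hh b (incidence x lam) lam hb hl
  unfold SDYM.onLine
  rw [incidence_smul]
  have h1 := congrArg (fun M : SGl r (ChiGen N) => M.map (chiToTheta N lam)) h
  refine Eq.trans ?_ (h1.trans ?_)
  · ext i j
    exact chiToTheta_smul N b lam _
  · ext i j
    exact map_smul (chiToTheta N lam) _ _

/-- The parity automorphism and the odd derivations of superfields. -/
noncomputable def superDerivations (r N : ℕ) : OddDerivations (SGl r (ThetaGen N)) (Fin 4) where
  parity := (gInvol : Grassmann (ThetaGen N) →ₐ[ℂ] _).toRingHom.mapMatrix
  parity_smul c M := by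
    ext i j
    exact map_smul (gInvol : Grassmann (ThetaGen N) →ₐ[ℂ] _) _ _
  δ α a := (oddDeriv (Sum.inl (α, a))).mapMatrix
  δ_mul α a M M' := by
    ext i j
    change oddDeriv _ ((M * M') i j) = _
    rw [Matrix.mul_apply, map_sum, Matrix.add_apply, Matrix.mul_apply, Matrix.mul_apply,
      ← Finset.sum_add_distrib]
    exact Finset.sum_congr rfl fun k _ => leftDeriv_mul _ _ _
  δ_comm α a β b M := by
    ext i j
    exact leftDeriv_comm _ _ _

theorem superDerivations_gD (α : Fin 2) (A : SIndex) (f : Spacetime → SGl r (ThetaGen N))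
    (x : Spacetime) : (superDerivations r N).gD α A f x = sdX α A f x := by
  rcases A with _ | _ <;> rfl

theorem gradedSign_eq_sgn (A B : SIndex) : gradedSign A B = sgn A B := by
  rcases A with _ | _ <;> rcases B with _ | _ <;> rfl

theorem sdX_onLine {f : Spinor → Spinor → SGl r (ChiGen N)} (hf : SmoothHolo univ f)
    (α : Fin 2) (A : SIndex) (x : Spacetime) {lam : Spinor} (hl : lam ≠ 0) :
    sdX α A (fun y => onLine f y lam) x = lam α • onLine (sdMu A f) x lam := by
  rcases A with α' | a
  · exact dX_comp_incidence (entrywise r (chiToTheta N lam).toLinearMap)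
      (hf.differentiable_left hl) α α' x
  · ext i j
    exact oddDeriv_chiToTheta N lam α a _

theorem map_gInvol_of_isEven {κ : Type} {M : SGl r κ} (h : ∀ i j, IsEven (M i j)) :
    M.map gInvol = M := by
  ext i j
  exact gInvol_eq_of_isEven (h i j)

theorem map_gInvol_onLine (f : Spinor → Spinor → SGl r (ChiGen N)) (x : Spacetime)
    (lam : Spinor) : (onLine f x lam).map gInvol
      = ((f (incidence x lam) lam).map gInvol).map (chiToTheta N lam) := by
  ext i j
  exact gInvol_map _ _

/-- The connection is fixed by the parity automorphism. Derivatives in μ commute with this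
automorphism, while left derivatives in χ anticommute with it. -/
theorem map_gInvol_sdMu (𝒜 : SuperRadiativeData r N) (A : SIndex) (μ : Spinor) {lam : Spinor}
    (hl : lam ≠ 0) : (sdMu A 𝒜.twistor μ lam).map gInvol
      = (match A with | Sum.inl _ => (1 : ℂ) | Sum.inr _ => -1) • sdMu A 𝒜.twistor μ lam := by
  have he : ∀ ν, (𝒜.twistor ν lam).map gInvol = 𝒜.twistor ν lam := fun ν =>
    map_gInvol_of_isEven (𝒜.even _ lam hl)
  rcases A with α' | a
  · rw [one_smul]
    have h1 := ((entrywise r (gInvol (κ := ChiGen N)).toLinearMap).hasFDerivAt.comp μ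
      ((smoothHolo_twistor 𝒜).differentiable_left hl μ).hasFDerivAt).fderiv
    have h2 : fderiv ℂ (fun ν => 𝒜.twistor ν lam) μ = _ :=
      (congrArg (fun g => fderiv ℂ g μ) (funext fun ν => (he ν).symm)).trans h1
    exact (congrArg (fun T => T (Pi.single α' 1)) h2).symm
  · ext i j
    change gInvol (leftDeriv _ (𝒜.twistor μ lam i j)) = _
    rw [gInvol_leftDeriv]
    have h3 : gInvol (𝒜.twistor μ lam i j) = 𝒜.twistor μ lam i j := congrFun₂ (he μ) i j
    rw [h3, Matrix.smul_apply, neg_smul, one_smul]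
    rfl

theorem twist_onLine_sdMu (𝒜 : SuperRadiativeData r N) (A B : SIndex) (x : Spacetime)
    {lam : Spinor} (hl : lam ≠ 0) :
    (superDerivations r N).twist A (onLine (sdMu B 𝒜.twistor) x lam)
      = gradedSign A B • onLine (sdMu B 𝒜.twistor) x lam := by
  rcases A with α' | a
  · rw [gradedSign, one_smul]
    · rfl
    · simp
  · have h := map_gInvol_onLine (sdMu B 𝒜.twistor) x lam
    rw [map_gInvol_sdMu 𝒜 B _ hl] at h
    refine h.trans ?_
    ext i j
    rcases B with β' | b
    · exact map_smul (chiToTheta N lam) (1 : ℂ) _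
    · exact map_smul (chiToTheta N lam) (-1 : ℂ) _

theorem IsSuperFrame.frameData {U : Set Spacetime} (hU : IsOpen U) {𝒜 : SuperRadiativeData r N}
    {H : Spacetime → Spinor → SGl r (ThetaGen N)} (h : IsSuperFrame U 𝒜 H) :
    FrameData (superDerivations r N) U H (onLine 𝒜.twistor)
      (fun A => onLine (sdMu A 𝒜.twistor)) (fun A B => onLine (sdMu A (sdMu B 𝒜.twistor))) where
  isOpen := hU
  holo_H := ⟨h.smooth, h.holomorphic⟩
  holo_a := smoothHolo_onLine (smoothHolo_twistor 𝒜) U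
  holo_a₁ A := smoothHolo_onLine ((smoothHolo_twistor 𝒜).sdMu A) U
  holo_a₂ A B := smoothHolo_onLine (((smoothHolo_twistor 𝒜).sdMu B).sdMu A) U
  isUnit := h.invertible
  parity_H x hx lam hl := map_gInvol_of_isEven (h.even x hx lam hl)
  parity_a x hx lam hl := by
    refine (map_gInvol_onLine 𝒜.twistor x lam).trans ?_
    have h1 : (𝒜.twistor (incidence x lam) lam).map gInvol = 𝒜.twistor (incidence x lam) lam :=
      map_gInvol_of_isEven (𝒜.even _ lam hl)
    rw [h1]
    rfl
  twist_a₁ A B x _ lam hl := twist_onLine_sdMu 𝒜 A B x hl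
  gD_a α A x _ lam hl := by
    rw [superDerivations_gD]
    exact sdX_onLine (smoothHolo_twistor 𝒜) α A x hl
  gD_a₁ α A B x _ lam hl := by
    rw [superDerivations_gD]
    exact sdX_onLine ((smoothHolo_twistor 𝒜).sdMu B) α A x hl
  smul_H := h.homogeneous
  smul_a₁ A x _ b lam hb hl := by
    have := ((superHomogeneous_twistor 𝒜).sdMu (smoothHolo_twistor 𝒜) A).onLine x hb hl
    simpa using this
  smul_a₂ A B x _ b lam hb hl :=
    (((superHomogeneous_twistor 𝒜).sdMu (smoothHolo_twistor 𝒜) B).sdMu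
      ((smoothHolo_twistor 𝒜).sdMu B) A).onLine x hb hl
  sparling x hx lam hl := by
    have h1 := h.sparling x hx lam hl 1
    rw [up_one, neg_smul, ← sub_eq_add_neg, sub_eq_zero] at h1
    exact h1

end SuperTwistor

/-! ### The pure Yang-Mills connection as frame data without odd directions -/

section PureTwistor

variable {r : ℕ}

theorem smoothHolo_pureTwistor (𝒜 : RadiativeData r) : SmoothHolo univ 𝒜.twistor :=
  SmoothHolo.comp (G := 𝒜.val) ⟨𝒜.smooth.mono fun _ hp => hp.2, fun lam hl =>
    (𝒜.holomorphic lam hl).differentiableOn⟩ smoothHolo_sum_mul_bar fun _ _ _ _ => mem_univ _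

theorem twistor_smul (𝒜 : RadiativeData r) {b : ℂ} (μ : Spinor) {lam : Spinor} (hb : b ≠ 0)
    (hl : lam ≠ 0) : 𝒜.twistor (b • μ) (b • lam) = ((conj b) ^ 2)⁻¹ • 𝒜.twistor μ lam := by
  have h := 𝒜.homogeneous b (∑ α', μ α' * bar lam α') lam hb hl
  have h1 : ∑ α', (b • μ) α' * bar (b • lam) α' = b * conj b * ∑ α', μ α' * bar lam α' := by
    simp only [bar, Pi.smul_apply, smul_eq_mul, map_mul, Finset.mul_sum]
    exact Finset.sum_congr rfl fun _ _ => by ring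
  rw [RadiativeData.twistor, h1, h]
  rfl

theorem SmoothHolo.dMu {f : Spinor → Spinor → Gl r} (hf : SmoothHolo univ f) (α' : Fin 2) :
    SmoothHolo univ (dMu α' f) :=
  hf.fderiv_apply isOpen_univ _

theorem dMu_smul_of_smul {f : Spinor → Spinor → Gl r} (hf : SmoothHolo univ f) {b c : ℂ}
    {lam : Spinor} (hb : b ≠ 0) (hl : lam ≠ 0) (h : ∀ μ, f (b • μ) (b • lam) = c • f μ lam)
    (α' : Fin 2) (μ : Spinor) : dMu α' f (b • μ) (b • lam) = (b⁻¹ * c) • dMu α' f μ lam :=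
  dMu_smul (ContinuousLinearMap.id ℂ (Gl r)) hb (hf.differentiable_left hl)
    (hf.differentiable_left (smul_ne_zero hb hl)) h α' μ

theorem smoothHolo_comp_incidence {f : Spinor → Spinor → Gl r} (hf : SmoothHolo univ f)
    (U : Set Spacetime) : SmoothHolo U (fun x lam => f (incidence x lam) lam) :=
  hf.comp (smoothHolo_incidence U) fun _ _ _ _ => mem_univ _

/-- The derivations of fields on spacetime, none of which is odd. -/
noncomputable def pureDerivations (r : ℕ) : OddDerivations (Gl r) Empty where
  parity := RingHom.id _
  parity_smul _ _ := rfl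
  δ _ a := a.elim
  δ_mul _ a := a.elim
  δ_comm _ a := a.elim

/-- The dotted index of a `2|0` index. -/
def dotted : Fin 2 ⊕ Empty → Fin 2 := Sum.elim id Empty.elim

theorem pureDerivations_gD (α : Fin 2) (A : Fin 2 ⊕ Empty) (f : Spacetime → Gl r)
    (x : Spacetime) : (pureDerivations r).gD α A f x = dX α (dotted A) f x := by
  rcases A with _ | a
  · rfl
  · exact a.elim

theorem pure_gradedSign (A B : Fin 2 ⊕ Empty) : gradedSign A B = 1 := by
  rcases A with _ | a
  · rw [gradedSign]; simp
  · exact a.elim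

theorem IsHolomorphicFrame.frameData {U : Set Spacetime} (hU : IsOpen U) {𝒜 : RadiativeData r}
    {H : Spacetime → Spinor → Gl r} (h : IsHolomorphicFrame U 𝒜 H) :
    FrameData (pureDerivations r) U H (fun x lam => 𝒜.twistor (incidence x lam) lam)
      (fun A x lam => dMu (dotted A) 𝒜.twistor (incidence x lam) lam)
      (fun A B x lam => dMu (dotted A) (dMu (dotted B) 𝒜.twistor) (incidence x lam) lam) where
  isOpen := hU
  holo_H := ⟨h.smooth, h.holomorphic⟩
  holo_a := smoothHolo_comp_incidence (smoothHolo_pureTwistor 𝒜) U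
  holo_a₁ _ := smoothHolo_comp_incidence ((smoothHolo_pureTwistor 𝒜).dMu _) U
  holo_a₂ _ _ := smoothHolo_comp_incidence (((smoothHolo_pureTwistor 𝒜).dMu _).dMu _) U
  isUnit := h.invertible
  parity_H _ _ _ _ := rfl
  parity_a _ _ _ _ := rfl
  twist_a₁ A B x _ lam _ := by
    rw [pure_gradedSign, one_smul]
    rcases A with _ | a
    · rfl
    · exact a.elim
  gD_a α A x _ lam hl := by
    rw [pureDerivations_gD]
    exact dX_comp_incidence (ContinuousLinearMap.id ℂ (Gl r))
      ((smoothHolo_pureTwistor 𝒜).differentiable_left hl) α _ x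
  gD_a₁ α A B x _ lam hl := by
    rw [pureDerivations_gD]
    exact dX_comp_incidence (ContinuousLinearMap.id ℂ (Gl r))
      (((smoothHolo_pureTwistor 𝒜).dMu _).differentiable_left hl) α _ x
  smul_H := h.homogeneous
  smul_a₁ A x _ b lam hb hl := by
    simp only [incidence_smul]
    rw [dMu_smul_of_smul (smoothHolo_pureTwistor 𝒜) hb hl
      (fun μ => twistor_smul 𝒜 μ hb hl), mul_inv]
  smul_a₂ A B x _ b lam hb hl := by
    simp only [incidence_smul]
    rw [dMu_smul_of_smul ((smoothHolo_pureTwistor 𝒜).dMu _) hb hl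
      (fun μ => dMu_smul_of_smul (smoothHolo_pureTwistor 𝒜) hb hl
        (fun μ => twistor_smul 𝒜 μ hb hl) _ μ), mul_inv, ← mul_assoc, ← mul_inv, ← pow_two]
  sparling x hx lam hl := by
    have h1 := h.sparling x hx lam hl 1
    rw [up_one, neg_smul, ← sub_eq_add_neg, sub_eq_zero] at h1
    exact h1

theorem dressed_eq_dress (H : Spacetime → Spinor → Gl r) (f : Spinor → Spinor → Gl r)
    (x : Spacetime) (lam : Spinor) :
    dressed H f x lam = dress H (fun x lam => f (incidence x lam) lam) x lam := by
  rw [dressed, dress, Matrix.nonsing_inv_eq_ringInverse]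

theorem potentialIntegrand_eq (𝒜 : RadiativeData r) (H : Spacetime → Spinor → Gl r)
    (iota : Spinor) (x : Spacetime) (α' : Fin 2) :
    potentialIntegrand 𝒜 H iota x α' = fun lam => (angle iota lam)⁻¹ •
      dress H (fun x lam => dMu α' 𝒜.twistor (incidence x lam) lam) x lam := by
  funext lam
  rw [potentialIntegrand, dressed_eq_dress]

theorem singleIntegrand_eq (𝒜 : RadiativeData r) (H : Spacetime → Spinor → Gl r)
    (x : Spacetime) (α' β' : Fin 2) : singleIntegrand 𝒜 H x α' β'
      = dress H (fun x lam => dMu α' (dMu β' 𝒜.twistor) (incidence x lam) lam) x := by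
  funext lam
  rw [singleIntegrand, dressed_eq_dress]

theorem doubleIntegrand_eq (𝒜 : RadiativeData r) (H : Spacetime → Spinor → Gl r)
    (x : Spacetime) (α' β' : Fin 2) : doubleIntegrand 𝒜 H x α' β'
      = fun lam₁ lam₂ => (angle lam₁ lam₂)⁻¹ •
        gradedComm (Sum.inl α' : Fin 2 ⊕ Empty) (Sum.inl β')
          (dress H (fun x lam => dMu α' 𝒜.twistor (incidence x lam) lam) x lam₁)
          (dress H (fun x lam => dMu β' 𝒜.twistor (incidence x lam) lam) x lam₂) := by
  funext lam₁ lam₂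
  simp only [doubleIntegrand, dressed_eq_dress, gradedComm, pure_gradedSign, one_smul]

theorem fieldStrength_eq (𝒜 : RadiativeData r) (H : Spacetime → Spinor → Gl r)
    (x : Spacetime) (α' β' : Fin 2) : fieldStrength 𝒜 H x α' β'
      = FrameData.curvFormula H (fun A x lam => dMu (dotted A) 𝒜.twistor (incidence x lam) lam)
        (fun A B x lam => dMu (dotted A) (dMu (dotted B) 𝒜.twistor) (incidence x lam) lam)
        (Sum.inl α') (Sum.inl β') x := by
  rw [fieldStrength, singleIntegrand_eq, doubleIntegrand_eq]
  rfl

theorem IsHolomorphicFrame.isPotential_iff {U : Set Spacetime} (hU : IsOpen U)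
    {𝒜 : RadiativeData r} {H : Spacetime → Spinor → Gl r} (h : IsHolomorphicFrame U 𝒜 H)
    (A : Spacetime → Fin 2 → Fin 2 → Gl r) :
    IsPotential U H A ↔ ∀ x ∈ U, ∀ α B, A x α (dotted B)
      = Complex.I • FrameData.conn (pureDerivations r) H α B x := by
  refine Iff.trans ?_ ((h.frameData hU).isPotential_iff (A := fun x α B => A x α (dotted B)))
  simp only [pureDerivations_gD, IsPotential, Matrix.nonsing_inv_eq_ringInverse]
  exact ⟨fun hA x hx lam hl B => hA x hx lam hl (dotted B),
    fun hA x hx lam hl α' => hA x hx lam hl (Sum.inl α')⟩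

theorem IsSuperFrame.isSuperPotential_iff {N : ℕ} {U : Set Spacetime} (hU : IsOpen U)
    {𝒜 : SuperRadiativeData r N} {H : Spacetime → Spinor → SGl r (ThetaGen N)}
    (h : IsSuperFrame U 𝒜 H) (A : Spacetime → Fin 2 → SIndex → SGl r (ThetaGen N)) :
    IsSuperPotential U H A ↔ ∀ x ∈ U, ∀ α B, A x α B
      = Complex.I • FrameData.conn (superDerivations r N) H α B x := by
  refine Iff.trans ?_ ((h.frameData hU).isPotential_iff (A := A))
  simp only [superDerivations_gD]
  rfl

theorem curvature_eq_neg_swap (A : Spacetime → Fin 2 → Fin 2 → Gl r) (x : Spacetime)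
    (α α' β β' : Fin 2) : curvature A x α α' β β' = -curvature A x β β' α α' := by
  simp only [curvature, smul_sub]
  abel

end PureTwistor

/-! ### Curvature formulas in both theories -/

section Main

variable {r : ℕ} {U : Set Spacetime}

theorem IsHolomorphicFrame.curvature_eq (hU : IsOpen U) {𝒜 : RadiativeData r}
    {H : Spacetime → Spinor → Gl r} (h : IsHolomorphicFrame U 𝒜 H)
    {A : Spacetime → Fin 2 → Fin 2 → Gl r} (hA : IsPotential U H A) {x : Spacetime} (hx : x ∈ U)
    (α α' β β' : Fin 2) :
    curvature A x α α' β β' = eps α β • fieldStrength 𝒜 H x α' β' := by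
  have h1 := (h.frameData hU).curvature_potential (V := fun x α B => A x α (dotted B))
    ((h.isPotential_iff hU A).1 hA) α β (Sum.inl α') (Sum.inl β') hx
  simp only [pureDerivations_gD, pure_gradedSign, one_smul, gradedComm] at h1
  rw [fieldStrength_eq]
  exact h1

theorem IsSuperFrame.superCurvature_eq {N : ℕ} (hU : IsOpen U) {𝒜 : SuperRadiativeData r N}
    {H : Spacetime → Spinor → SGl r (ThetaGen N)} (h : IsSuperFrame U 𝒜 H)
    {A : Spacetime → Fin 2 → SIndex → SGl r (ThetaGen N)} (hA : IsSuperPotential U H A)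
    {x : Spacetime} (hx : x ∈ U) (α β : Fin 2) (B C : SIndex) :
    superCurvature A x α B β C = eps α β • superFieldStrength 𝒜 H x B C := by
  have h1 := (h.frameData hU).curvature_potential ((h.isSuperPotential_iff hU A).1 hA) α β B C hx
  simp only [superDerivations_gD, gradedComm, FrameData.curvFormula, gradedSign_eq_sgn] at h1
  exact h1

theorem IsHolomorphicFrame.exists_isPotential (hU : IsOpen U) {𝒜 : RadiativeData r}
    {H : Spacetime → Spinor → Gl r} (h : IsHolomorphicFrame U 𝒜 H) :
    ∃ A : Spacetime → Fin 2 → Fin 2 → Gl r, IsPotential U H A := by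
  refine ⟨fun x α α' => Complex.I • FrameData.conn (pureDerivations r) H α (Sum.inl α') x,
    (h.isPotential_iff hU _).2 fun x _ α B => ?_⟩
  rcases B with _ | b
  · rfl
  · exact b.elim

end Main

end SDYM

open SDYM

theorem mainTheorem8 (r : ℕ) (U : Set Spacetime) (hU : IsOpen U) :
    -- pure Yang-Mills theory
    (∀ (𝒜 : RadiativeData r) (H : Spacetime → Spinor → Gl r), IsHolomorphicFrame U 𝒜 H →
      -- the gauge potential, for a frame that is the identity at `ι`
      (∀ iota : Spinor, iota ≠ 0 → (∀ x ∈ U, H x iota = 1) →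
        (∀ x ∈ U, ∀ α' : Fin 2, LineIntegrable (potentialIntegrand 𝒜 H iota x α')) ∧
        ∀ A : Spacetime → Fin 2 → Fin 2 → Gl r,
          IsPotential U H A ↔ ∀ x ∈ U, ∀ α α' : Fin 2,
            A x α α' = (iota α / (2 * Real.pi)) •
              lineIntegral (potentialIntegrand 𝒜 H iota x α')) ∧
      -- the field strength, for any frame
      (∃ A : Spacetime → Fin 2 → Fin 2 → Gl r, IsPotential U H A) ∧
      (∀ x ∈ U, ∀ α' β' : Fin 2,
        LineIntegrable (singleIntegrand 𝒜 H x α' β') ∧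
        LineIntegrable₂ (doubleIntegrand 𝒜 H x α' β') ∧
        fieldStrength 𝒜 H x α' β' = fieldStrength 𝒜 H x β' α') ∧
      ∀ A : Spacetime → Fin 2 → Fin 2 → Gl r, IsPotential U H A →
        (∀ α α' : Fin 2, DifferentiableOn ℂ (fun x => A x α α') U) ∧
        ∀ x ∈ U, ∀ α α' β β' : Fin 2,
          curvature A x α α' β β' = eps α β • fieldStrength 𝒜 H x α' β') ∧
    -- `𝒩 = 4` super-Yang-Mills theory
    (∀ (N : ℕ) (𝒜 : SuperRadiativeData r N) (H : Spacetime → Spinor → SGl r (ThetaGen N)),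
      IsSuperFrame U 𝒜 H →
      -- the super-connection, for a frame that is the identity at `ι`
      (∀ iota : Spinor, iota ≠ 0 → (∀ x ∈ U, H x iota = 1) →
        (∀ x ∈ U, ∀ B : SIndex, LineIntegrable (superPotentialIntegrand 𝒜 H iota x B)) ∧
        ∀ A : Spacetime → Fin 2 → SIndex → SGl r (ThetaGen N),
          IsSuperPotential U H A ↔ ∀ x ∈ U, ∀ (α : Fin 2) (B : SIndex),
            A x α B = (iota α / (2 * Real.pi)) •
              lineIntegral (superPotentialIntegrand 𝒜 H iota x B)) ∧
      -- the super-curvature, for any frame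
      (∃ A : Spacetime → Fin 2 → SIndex → SGl r (ThetaGen N), IsSuperPotential U H A) ∧
      (∀ x ∈ U, ∀ B C : SIndex,
        LineIntegrable (superSingleIntegrand 𝒜 H x B C) ∧
        LineIntegrable₂ (superDoubleIntegrand 𝒜 H x B C)) ∧
      ∀ A : Spacetime → Fin 2 → SIndex → SGl r (ThetaGen N), IsSuperPotential U H A →
        (∀ (α : Fin 2) (B : SIndex), DifferentiableOn ℂ (fun x => A x α B) U) ∧
        ∀ x ∈ U, ∀ α β : Fin 2,
          (∀ α' β' : Fin 2, superCurvature A x α (Sum.inl α') β (Sum.inl β')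
            = eps α β • superFieldStrength 𝒜 H x (Sum.inl α') (Sum.inl β')) ∧
          (∀ (a : Fin 4) (α' : Fin 2), superCurvature A x α (Sum.inr a) β (Sum.inl α')
            = eps α β • psiTilde 𝒜 H x a α') ∧
          (∀ a b : Fin 4, superCurvature A x α (Sum.inr a) β (Sum.inr b)
            = eps α β • phi 𝒜 H x a b)) := by
  refine ⟨fun 𝒜 H h => ?_, fun N 𝒜 H h => ?_⟩
  · have hF := h.frameData hU
    refine ⟨fun iota hi hH => ⟨fun x hx α' => ?_, fun A => ?_⟩, h.exists_isPotential hU,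
      fun x hx α' β' => ⟨?_, ?_, ?_⟩, fun A hA => ⟨fun α α' => ?_, fun x hx α α' β β' =>
        h.curvature_eq hU hA hx α α' β β'⟩⟩
    · rw [potentialIntegrand_eq]
      exact hF.integrable_potential iota (Sum.inl α') hx
    · rw [h.isPotential_iff hU]
      simp only [potentialIntegrand_eq]
      constructor
      · intro hA x hx α α'
        exact (hA x hx α (Sum.inl α')).trans
          (hF.conn_eq_lineIntegral hi hH α (Sum.inl α') hx)
      · intro hA x hx α B
        exact (hA x hx α (dotted B)).trans (hF.conn_eq_lineIntegral hi hH α B hx).symm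
    · rw [singleIntegrand_eq]
      exact hF.integrable_dress₂ (Sum.inl α') (Sum.inl β') hx
    · rw [doubleIntegrand_eq]
      exact hF.integrable_double (Sum.inl α') (Sum.inl β') hx
    -- Symmetry of the field strength follows from antisymmetry of the curvature under exchange of
    -- index pairs, together with the antisymmetry of ε.
    · obtain ⟨A, hA⟩ := h.exists_isPotential hU
      have h1 := h.curvature_eq hU hA hx 0 α' 1 β'
      have h2 := h.curvature_eq hU hA hx 1 β' 0 α'
      rw [curvature_eq_neg_swap, h2] at h1
      simpa [eps] using h1.symm
    · exact hF.potential_holo ((h.isPotential_iff hU A).1 hA) α (Sum.inl α')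
  · have hF := h.frameData hU
    refine ⟨fun iota hi hH => ⟨fun x hx B => hF.integrable_potential iota B hx, fun A => ?_⟩,
      ⟨fun x α B => Complex.I • FrameData.conn (superDerivations r N) H α B x,
        (h.isSuperPotential_iff hU _).2 fun _ _ _ _ => rfl⟩,
      fun x hx B C => ⟨hF.integrable_dress₂ B C hx, ?_⟩, fun A hA => ⟨fun α B =>
        hF.potential_holo ((h.isSuperPotential_iff hU A).1 hA) α B, fun x hx α β =>
        ⟨fun α' β' => h.superCurvature_eq hU hA hx α β _ _,
          fun a α' => h.superCurvature_eq hU hA hx α β _ _,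
          fun a b => h.superCurvature_eq hU hA hx α β _ _⟩⟩⟩
    · rw [h.isSuperPotential_iff hU]
      constructor
      · intro hA x hx α B
        exact (hA x hx α B).trans (hF.conn_eq_lineIntegral hi hH α B hx)
      · intro hA x hx α B
        exact (hA x hx α B).trans (hF.conn_eq_lineIntegral hi hH α B hx).symm
    · have h1 := hF.integrable_double B C hx
      simp only [gradedComm, gradedSign_eq_sgn] at h1
      exact h1
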